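/- A set system $(U,\mathcal F)$ consists of a finite ground set $U$ and a family $\mathcal F$ of finite sets with $\emptyset\in\mathcal F$; its solutions are the $X\in\mathcal F$ with $X\subseteq U$, and a solution is maximal if no other solution contains it. The system is commutable if (i) for all solutions $X\subsetneq Y$ there is $z\in Y\setminus X$ with $X\cup\{z\}\in\mathcal F$ (strong accessibility), and (ii) for all solutions $\emptyset\ne X\subsetneq Y$ and all $a,b\in Y\setminus X$, if $X\cup\{a\}\in\mathcal F$ and $X\cup\{b\}\in\mathcal F$ then $X\cup\{a,b\}\in\mathcal F$. Let $\mathcal C$ be a class of commutable set systems given algorithmically: an instance is a pair $(x,U)$, where the string (tree) $x$ describes the family $\mathcal F_x$ and $U$ is the explicitly listed ground set; the size of the instance is the length of the encoding of $(x,U)$, and for $X\subseteq U$ it can be checked in time polynomial in the size of the instance whether $X\in\mathcal F_x$. The general problem for $\mathcal C$ is: given an instance $(x,U)$, list all maximal solutions of $(U,\mathcal F_x)$. The restricted problem is: given an instance $(x,U)$, a maximal solution $P$ of $(U,\mathcal F_x)$ and $w\in U\setminus P$, list all maximal solutions $R\neq P$ of the reduced system $(P\cup\{w\},\mathcal F_x)$.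 A deterministic listing algorithm outputs every solution exactly once. It has polynomial total time if its running time is at most polynomial in the input size plus the number of solutions to be listed; polynomial time if its running time is polynomial in the input size alone; polynomial delay if the time before the first output, between consecutive outputs, and after the last output is polynomial in the input size; polynomial space if its working memory (not counting trees already output) is polynomial in the input size. Time and space are those of while programs on binary trees in which each operation is charged for the sizes of the trees involved, which is polynomially equivalent to multitape Turing machines. Then: 1. If the restricted problem can be solved in polynomial total time and polynomial space, then so can the general problem. Conversely, if $\mathcal C$ is closed under reduction, that is, $(x,P\cup\{w\})$ is an instance of $\mathcal C$ for every instance $(x,U)$, every maximal solution $P$ of it and every $w\in U\setminus P$, then solvability of the general problem in polynomial total time and polynomial space implies the same for the restricted problem. Hence for classes closed under reduction the two are equivalent. 2. If the restricted problem can be solved in polynomial time and polynomial space, then the general problem can be solved with polynomial delay and polynomial space. -/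

import Mathlib

namespace Listing

/-! ### Set systems

A set system `(U, F)` is a finite ground set `U` with a family `F` of finite sets; its solutions
are the members of `F` that are contained in `U`. -/

section SetSystems

variable {α : Type*} [DecidableEq α]

/-- The inclusion-maximal solutions of the set system `(U, F)`. -/
def maximalSolutions (U : Finset α) (F : Set (Finset α)) : Set (Finset α) :=
  {X | Maximal (fun Y => Y ∈ F ∧ Y ⊆ U) X}

/-- Between two solutions `X ⊂ Y` one can always add an element of `Y` to `X`. -/
def StronglyAccessible (U : Finset α) (F : Set (Finset α)) : Prop :=
  ∀ X ∈ F, ∀ Y ∈ F, Y ⊆ U → X ⊂ Y → ∃ z ∈ Y \ X, insert z X ∈ F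

/-- The commutable property: below a common solution `Y`, two possible additions to a nonempty
solution `X` can be performed together. -/
def CommutableProperty (U : Finset α) (F : Set (Finset α)) : Prop :=
  ∀ X ∈ F, ∀ Y ∈ F, Y ⊆ U → X.Nonempty → X ⊂ Y → ∀ a ∈ Y \ X, ∀ b ∈ Y \ X,
    insert a X ∈ F → insert b X ∈ F → insert a (insert b X) ∈ F

/-- Commutable set systems (with the standing convention `∅ ∈ F`). -/
structure IsCommutable (U : Finset α) (F : Set (Finset α)) : Prop where
  empty_mem : ∅ ∈ F
  stronglyAccessible : StronglyAccessible U F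
  commutable : CommutableProperty U F

end SetSystems

/-! ### The machine model

While programs over binary trees (lists in the sense of LISP).  Every evaluation of an expression
is charged for the sizes of all trees that occur in it, so that time and space agree with those of
multitape Turing machines up to a polynomial. -/

/-- The data manipulated by programs: binary trees without labels. -/
abbrev Data := BinaryTree Unit

/-- The pair of two trees. -/
def cons (a b : Data) : Data := BinaryTree.node () a b

/-- First component (`nil` for `nil`). -/
def hd : Data → Data
  | .nil => .nil
  | .node _ a _ => a

/-- Second component (`nil` for `nil`). -/
def tl : Data → Data
  | .nil => .nil
  | .node _ _ b => b

/-- The list `[d₁, …, dₖ]` as a tree. -/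
def encList (l : List Data) : Data := l.foldr cons .nil

/-- Contents of the variables. -/
abbrev Store := ℕ → Data

/-- Initial store: the input is in variable `0`, all other variables are `nil`. -/
def initStore (d : Data) : Store := fun v => if v = 0 then d else .nil

/-- Expressions. -/
inductive Expr where
  | var (v : ℕ)
  | nil
  | cons (e₁ e₂ : Expr)
  | hd (e : Expr)
  | tl (e : Expr)
  | eq (e₁ e₂ : Expr)

namespace Expr

/-- Value of an expression; truth values are `cons nil nil` and `nil`. -/
def eval (σ : Store) : Expr → Data
  | var v => σ v
  | nil => .nil
  | cons e₁ e₂ => Listing.cons (e₁.eval σ) (e₂.eval σ)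
  | hd e => Listing.hd (e.eval σ)
  | tl e => Listing.tl (e.eval σ)
  | eq e₁ e₂ => if e₁.eval σ = e₂.eval σ then Listing.cons .nil .nil else .nil

/-- Cost of evaluating an expression: `1` plus the size of the value, for each subexpression. -/
def cost (σ : Store) : Expr → ℕ
  | var v => (σ v).numNodes + 1
  | nil => 1
  | cons e₁ e₂ => e₁.cost σ + e₂.cost σ + ((cons e₁ e₂).eval σ).numNodes + 1
  | hd e => e.cost σ + ((hd e).eval σ).numNodes + 1
  | tl e => e.cost σ + ((tl e).eval σ).numNodes + 1
  | eq e₁ e₂ => e₁.cost σ + e₂.cost σ + ((eq e₁ e₂).eval σ).numNodes + 1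

/-- Variables of an expression. -/
def vars : Expr → Finset ℕ
  | var v => {v}
  | nil => ∅
  | cons e₁ e₂ => e₁.vars ∪ e₂.vars
  | hd e => e.vars
  | tl e => e.vars
  | eq e₁ e₂ => e₁.vars ∪ e₂.vars

end Expr

/-- Programs. -/
inductive Cmd where
  | skip
  | assign (v : ℕ) (e : Expr)
  | seq (c₁ c₂ : Cmd)
  | ite (e : Expr) (c₁ c₂ : Cmd)
  | loop (e : Expr) (c : Cmd)
  | output (e : Expr)

/-- Variables of a program. -/
def Cmd.vars : Cmd → Finset ℕ
  | skip => ∅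
  | assign v e => insert v e.vars
  | seq c₁ c₂ => c₁.vars ∪ c₂.vars
  | ite e c₁ c₂ => e.vars ∪ c₁.vars ∪ c₂.vars
  | loop e c => e.vars ∪ c.vars
  | output e => e.vars

/-- What happens during a run: an elementary step of a given cost, started in the store `σ`,
or the output of a tree. -/
inductive Event where
  | step (cost : ℕ) (σ : Store)
  | out (d : Data)

/-- `Exec c σ tr σ'`: the program `c`, started in the store `σ`, terminates in the store `σ'`,
and `tr` is the list of events of this run. -/
inductive Exec : Cmd → Store → List Event → Store → Prop
  | skip (σ : Store) : Exec .skip σ [.step 1 σ] σ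
  | assign (v : ℕ) (e : Expr) (σ : Store) :
      Exec (.assign v e) σ [.step (e.cost σ) σ] (Function.update σ v (e.eval σ))
  | seq {c₁ c₂ : Cmd} {σ σ₁ σ₂ : Store} {t₁ t₂ : List Event} :
      Exec c₁ σ t₁ σ₁ → Exec c₂ σ₁ t₂ σ₂ → Exec (.seq c₁ c₂) σ (t₁ ++ t₂) σ₂
  | iteTrue {e : Expr} {c₁ c₂ : Cmd} {σ σ' : Store} {t : List Event} :
      e.eval σ ≠ .nil → Exec c₁ σ t σ' →
      Exec (.ite e c₁ c₂) σ (.step (e.cost σ) σ :: t) σ'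
  | iteFalse {e : Expr} {c₁ c₂ : Cmd} {σ σ' : Store} {t : List Event} :
      e.eval σ = .nil → Exec c₂ σ t σ' →
      Exec (.ite e c₁ c₂) σ (.step (e.cost σ) σ :: t) σ'
  | loopDone {e : Expr} {c : Cmd} {σ : Store} :
      e.eval σ = .nil → Exec (.loop e c) σ [.step (e.cost σ) σ] σ
  | loopStep {e : Expr} {c : Cmd} {σ σ₁ σ₂ : Store} {t₁ t₂ : List Event} :
      e.eval σ ≠ .nil → Exec c σ t₁ σ₁ → Exec (.loop e c) σ₁ t₂ σ₂ →
      Exec (.loop e c) σ (.step (e.cost σ) σ :: (t₁ ++ t₂)) σ₂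
  | output (e : Expr) (σ : Store) :
      Exec (.output e) σ [.step (e.cost σ) σ, .out (e.eval σ)] σ

/-- Time taken by an event. -/
def Event.time : Event → ℕ
  | step k _ => k
  | out _ => 0

/-- Space in use during an event: the contents of the variables in `V` and the intermediate values
of the expression that is evaluated.  Trees that were output are not stored. -/
def Event.space (V : Finset ℕ) : Event → ℕ
  | step k σ => (∑ v ∈ V, (σ v).numNodes) + k
  | out _ => 0

/-- The tree that is output, if any. -/
def Event.output? : Event → Option Data
  | step _ _ => none
  | out d => some d

/-- Total time of a list of events. -/
def time (tr : List Event) : ℕ := (tr.map Event.time).sum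

/-- Peak space of a list of events. -/
def space (V : Finset ℕ) (tr : List Event) : ℕ := (tr.map (Event.space V)).foldr max 0

/-- The trees that are output, in order. -/
def outputs (tr : List Event) : List Data := tr.filterMap Event.output?

/-- Delay at most `b`: every stretch of the run without output takes time at most `b` (before the
first output, between two consecutive outputs, and after the last output). -/
def DelayLE (tr : List Event) (b : ℕ) : Prop :=
  ∀ s : List Event, s <:+: tr → outputs s = [] → time s ≤ b

/-! ### Listing problems and their complexity -/

/-- A listing problem: instances, the input tree of each instance, and the set of trees to list. -/
structure ListingProblem where
  ι : Type
  input : ι → Data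
  sols : ι → Set Data

namespace ListingProblem

variable (Q : ListingProblem)

/-- Size of the input. -/
def size (i : Q.ι) : ℕ := (Q.input i).numNodes

/-- The program `c`, run on the input of the instance `i`, terminates with events `tr` and outputs
each solution exactly once, and nothing else. -/
def Lists (c : Cmd) (i : Q.ι) (tr : List Event) : Prop :=
  (∃ σ' : Store, Exec c (initStore (Q.input i)) tr σ') ∧
    (outputs tr).Nodup ∧ ∀ d : Data, d ∈ outputs tr ↔ d ∈ Q.sols i

/-- Polynomial total time (polynomial in the size of the input and the number of solutions) and
polynomial space (polynomial in the size of the input). -/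
def PolyTotalTimePolySpace : Prop :=
  ∃ (c : Cmd) (p : Polynomial ℕ), ∀ i : Q.ι, ∃ tr : List Event, Q.Lists c i tr ∧
    time tr ≤ p.eval (Q.size i + (Q.sols i).ncard) ∧ space c.vars tr ≤ p.eval (Q.size i)

/-- Polynomial time and polynomial space (both polynomial in the size of the input). -/
def PolyTimePolySpace : Prop :=
  ∃ (c : Cmd) (p : Polynomial ℕ), ∀ i : Q.ι, ∃ tr : List Event, Q.Lists c i tr ∧
    time tr ≤ p.eval (Q.size i) ∧ space c.vars tr ≤ p.eval (Q.size i)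

/-- Polynomial delay and polynomial space (both polynomial in the size of the input). -/
def PolyDelayPolySpace : Prop :=
  ∃ (c : Cmd) (p : Polynomial ℕ), ∀ i : Q.ι, ∃ tr : List Event, Q.Lists c i tr ∧
    DelayLE tr (p.eval (Q.size i)) ∧ space c.vars tr ≤ p.eval (Q.size i)

end ListingProblem

/-! ### Classes of set systems -/

/-- A subset `X` of the ground set `U`, as the list of its elements in the order of `U`. -/
def encSet (U : List Data) (X : Finset Data) : Data := encList (U.filter (· ∈ X))

/-- A class of algorithmic set systems.  An instance consists of a description `x` (for example a
graph) and a ground set, given as a list `U` without repetitions, whose elements are arbitrary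
trees.  It stands for the set system `(U, family x)`. -/
structure SetSystemClass where
  IsInstance : Data → List Data → Prop
  nodup : ∀ x U, IsInstance x U → U.Nodup
  family : Data → Set (Finset Data)

namespace SetSystemClass

variable (C : SetSystemClass)

/-- All set systems of the class are commutable. -/
def Commutable : Prop :=
  ∀ x U, C.IsInstance x U → IsCommutable U.toFinset (C.family x)

/-- Whether a subset of the ground set is a solution can be decided in polynomial time: the answer
is left in variable `0`. -/
def PolyTimeMembership : Prop :=
  ∃ (c : Cmd) (p : Polynomial ℕ), ∀ x U, C.IsInstance x U → ∀ X : Finset Data, X ⊆ U.toFinset →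
    ∃ (tr : List Event) (σ' : Store),
      Exec c (initStore (cons x (cons (encList U) (encSet U X)))) tr σ' ∧
      (σ' 0 ≠ .nil ↔ X ∈ C.family x) ∧
      time tr ≤ p.eval (cons x (cons (encList U) (encSet U X))).numNodes

/-- The reduced set systems `(P ∪ {w}, family x)` of the restricted problem belong to the class. -/
def ClosedUnderReduction : Prop :=
  ∀ x U, C.IsInstance x U → ∀ P ∈ maximalSolutions U.toFinset (C.family x), ∀ w ∈ U, w ∉ P →
    C.IsInstance x (U.filter (· ∈ insert w P))

/-- The general problem: given `(U, F)`, list all its maximal solutions. -/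
def generalProblem : ListingProblem where
  ι := {q : Data × List Data // C.IsInstance q.1 q.2}
  input := fun ⟨(x, U), _⟩ => cons x (encList U)
  sols := fun ⟨(x, U), _⟩ => encSet U '' maximalSolutions U.toFinset (C.family x)

/-- The restricted problem: given `(U, F)`, a maximal solution `P` of it and `w ∈ U \ P`, list all
maximal solutions `R ≠ P` of `(P ∪ {w}, F)`. -/
def restrictedProblem : ListingProblem where
  ι := {q : Data × List Data × Finset Data × Data // C.IsInstance q.1 q.2.1 ∧
    q.2.2.1 ∈ maximalSolutions q.2.1.toFinset (C.family q.1) ∧ q.2.2.2 ∈ q.2.1 ∧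
    q.2.2.2 ∉ q.2.2.1}
  input := fun ⟨(x, U, P, w), _⟩ => cons x (cons (encList U) (cons (encSet U P) w))
  sols := fun ⟨(x, U, P, w), _⟩ =>
    encSet U '' {R | R ∈ maximalSolutions (insert w P) (C.family x) ∧ R ≠ P}

end SetSystemClass

end Listing

namespace Listing

open Finset

/-! ### Sizes, costs and traces -/

/-! The maximal solutions are arranged in a forest that can be traversed with little memory, a form
of reverse search. Fix a starting point `s` such that `{s}` is a solution, and a schedule that
repeats the ground list as often as it has elements. Every solution `Y` containing `s` is rebuilt
from `{s}` by walking along the schedule and accepting each `u ∈ Y` that keeps the current set `X` a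
solution; the accepted steps, read as a binary number `val`, order these solutions linearly. For a
solution `E` containing `s`, `canon` makes the same walk but accepts `u` when both `X ∪ {u}` and `X
∪ E ∪ {u}` are solutions. By commutability (`IsCommutable.insert_mem`) this test rejects nothing
useful: the result is a maximal solution containing `E`, and its `val` is largest among the
solutions containing `E` (`IsCommutable.val_le_complete`).

The parent of a nonempty maximal solution `S` is the completion `P` of the last stage `D` of its
walk that is not completed to `S`; if there is no such stage, `S` is a root and the completion of
its seed. The parent has a larger `val` or an earlier seed, so passing to parents terminates
(`IsNode.nodeRank_parent_lt`). The stage of `S` after `D` is `D ∪ {u}`; it is completed to `S`, and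
optimality of completions forces `u ∉ P`. Take a maximal solution `R` of the reduced system on `P ∪
{u}` above `D ∪ {u}`. Since `R` is not better than `S`, its walk has the same stage `D ∪ {u}`. Hence
`S` is the completion of a stage of `R` (`IsNode.exists_restricted`): completing all stages of all
solutions of the restricted problems for `P` yields every child of `P`, and recomputing the parent
discards the rest.

The depth-first traversal remembers only the current node and the last visited child; the next child
is recomputed as the first later one in a fixed order, so no stack is kept. Nodes at odd depth are
output on entering and nodes at even depth on leaving, so no two consecutive moves are silent, and
the delay is governed by the cost of a single move. This gives part 2.

For total time, a restricted problem has at most `|U|` times as many solutions as the general one: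
`R` is determined by its seed and its completion, because two solutions sharing these data have a
union that is again a solution (`IsCommutable.ncard_restricted_le`). So a move is polynomial in the
input size plus the number of maximal solutions, and so is the total time. Conversely, `P` is itself
a maximal solution of the reduced system, and a general solver run there with the output `P`
suppressed solves the restricted problem.

On the machine side, `Comp` is a class of computable functions whose time may depend on an extra
parameter `T` but whose space may not; it is closed under composition, case distinction and loops.
`Comp.hook` runs a program and folds over its outputs as they appear, so that exponentially many
outputs never have to be stored. -/

/-- Size of a tree. -/
abbrev sz (d : Data) : ℕ := d.numNodes

@[simp] lemma sz_nil : sz .nil = 0 := rfl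
@[simp] lemma sz_cons (a b : Data) : sz (cons a b) = sz a + sz b + 1 := rfl
@[simp] lemma hd_cons (a b : Data) : hd (cons a b) = a := rfl
@[simp] lemma tl_cons (a b : Data) : tl (cons a b) = b := rfl
@[simp] lemma cons_ne_nil (a b : Data) : cons a b ≠ .nil := by intro h; cases h

lemma sz_hd_le (d : Data) : sz (hd d) ≤ sz d := by
  cases d with
  | nil => simp [hd]
  | node _ a b => simp only [hd, sz, BinaryTree.numNodes]; omega

lemma sz_tl_le (d : Data) : sz (tl d) ≤ sz d := by
  cases d with
  | nil => simp [tl]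
  | node _ a b => simp only [tl, sz, BinaryTree.numNodes]; omega

@[simp] lemma cons_inj {a b c d : Data} : cons a b = cons c d ↔ a = c ∧ b = d := by
  simp [cons]

lemma polynomial_eval_mono (p : Polynomial ℕ) {m n : ℕ} (h : m ≤ n) : p.eval m ≤ p.eval n := by
  rw [Polynomial.eval_eq_sum_range, Polynomial.eval_eq_sum_range]
  exact Finset.sum_le_sum fun i _ => Nat.mul_le_mul_left _ (Nat.pow_le_pow_left h i)

lemma Expr.sz_eval_lt_cost (σ : Store) (e : Expr) : sz (e.eval σ) + 1 ≤ e.cost σ := by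
  cases e <;> simp only [Expr.cost, Expr.eval, sz, BinaryTree.numNodes] <;> omega

lemma Expr.eval_congr {σ τ : Store} (e : Expr) (h : ∀ v ∈ e.vars, τ v = σ v) :
    e.eval τ = e.eval σ := by
  induction e with
  | var v => exact h v (by simp [Expr.vars])
  | nil => rfl
  | cons e₁ e₂ h₁ h₂ | eq e₁ e₂ h₁ h₂ =>
    simp only [Expr.vars, mem_union] at h
    simp only [Expr.eval, h₁ fun v hv => h v (.inl hv), h₂ fun v hv => h v (.inr hv)]
  | hd e h₁ | tl e h₁ => simp only [Expr.eval, h₁ h]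

lemma Expr.cost_congr {σ τ : Store} (e : Expr) (h : ∀ v ∈ e.vars, τ v = σ v) :
    e.cost τ = e.cost σ := by
  induction e with
  | var v => simp only [Expr.cost, h v (by simp [Expr.vars])]
  | nil => rfl
  | cons e₁ e₂ h₁ h₂ | eq e₁ e₂ h₁ h₂ =>
    have h' := Expr.eval_congr _ h
    simp only [Expr.vars, mem_union] at h
    simp only [Expr.cost, h', h₁ fun v hv => h v (.inl hv), h₂ fun v hv => h v (.inr hv)]
  | hd e h₁ | tl e h₁ =>
    have h' := Expr.eval_congr _ h
    simp only [Expr.cost, h', h₁ h]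

/-- The cost of an expression is linear in the sizes of its variables. -/
lemma Expr.exists_cost_le (e : Expr) :
    ∃ k, ∀ (σ : Store) (n : ℕ), (∀ v ∈ e.vars, sz (σ v) ≤ n) → e.cost σ ≤ k * (n + 1) := by
  induction e with
  | var v => exact ⟨1, fun σ n h => by have := h v (by simp [Expr.vars]); simp [Expr.cost]; omega⟩
  | nil => exact ⟨1, fun σ n h => by simp [Expr.cost]⟩
  | cons e₁ e₂ h₁ h₂ =>
    obtain ⟨k₁, h₁⟩ := h₁
    obtain ⟨k₂, h₂⟩ := h₂
    refine ⟨2 * k₁ + 2 * k₂ + 2, fun σ n h => ?_⟩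
    simp only [Expr.vars, mem_union] at h
    have := h₁ σ n fun v hv => h v (.inl hv)
    have := h₂ σ n fun v hv => h v (.inr hv)
    have := Expr.sz_eval_lt_cost σ e₁
    have := Expr.sz_eval_lt_cost σ e₂
    have := sz_cons (e₁.eval σ) (e₂.eval σ)
    simp only [Expr.cost, Expr.eval, sz] at *
    linarith
  | eq e₁ e₂ h₁ h₂ =>
    obtain ⟨k₁, h₁⟩ := h₁
    obtain ⟨k₂, h₂⟩ := h₂
    refine ⟨k₁ + k₂ + 2, fun σ n h => ?_⟩
    simp only [Expr.vars, mem_union] at h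
    have := h₁ σ n fun v hv => h v (.inl hv)
    have := h₂ σ n fun v hv => h v (.inr hv)
    have : sz (if e₁.eval σ = e₂.eval σ then Listing.cons .nil .nil else .nil) ≤ 1 := by
      split_ifs <;> simp
    simp only [Expr.cost, Expr.eval, sz] at *
    linarith
  | hd e ih | tl e ih =>
    obtain ⟨k, ih⟩ := ih
    refine ⟨2 * k + 1, fun σ n h => ?_⟩
    have := ih σ n h
    have := Expr.sz_eval_lt_cost σ e
    have := sz_hd_le (e.eval σ)
    have := sz_tl_le (e.eval σ)
    simp only [Expr.cost, Expr.eval, sz] at *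
    linarith

@[simp] lemma time_nil : time [] = 0 := rfl
@[simp] lemma time_cons (ev : Event) (t : List Event) : time (ev :: t) = ev.time + time t := rfl
@[simp] lemma time_append (s t : List Event) : time (s ++ t) = time s + time t := by
  simp [time]
@[simp] lemma outputs_nil : outputs [] = [] := rfl
@[simp] lemma outputs_append (s t : List Event) : outputs (s ++ t) = outputs s ++ outputs t := by
  simp [outputs]
@[simp] lemma outputs_step (k : ℕ) (σ : Store) (t : List Event) :
    outputs (.step k σ :: t) = outputs t := rfl
@[simp] lemma outputs_out (d : Data) (t : List Event) :
    outputs (.out d :: t) = d :: outputs t := rfl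
@[simp] lemma Event.time_step (k : ℕ) (σ : Store) : (Event.step k σ).time = k := rfl
@[simp] lemma Event.time_out (d : Data) : (Event.out d).time = 0 := rfl
@[simp] lemma Event.space_step (V : Finset ℕ) (k : ℕ) (σ : Store) :
    (Event.step k σ).space V = (∑ v ∈ V, sz (σ v)) + k := rfl
@[simp] lemma Event.space_out (V : Finset ℕ) (d : Data) : (Event.out d).space V = 0 := rfl

@[simp] lemma space_nil (V : Finset ℕ) : space V [] = 0 := rfl
@[simp] lemma space_cons (V : Finset ℕ) (ev : Event) (t : List Event) :
    space V (ev :: t) = max (ev.space V) (space V t) := rfl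
@[simp] lemma space_append (V : Finset ℕ) (s t : List Event) :
    space V (s ++ t) = max (space V s) (space V t) := by
  induction s with
  | nil => simp
  | cons a s ih => simp [ih, max_assoc]

lemma space_mono {V W : Finset ℕ} (h : V ⊆ W) (t : List Event) : space V t ≤ space W t := by
  induction t with
  | nil => simp
  | cons ev t ih =>
    have : ev.space V ≤ ev.space W := by
      cases ev with
      | step k σ =>
        simpa using Finset.sum_le_sum_of_subset (f := fun v => sz (σ v)) h
      | out d => simp
    simp only [space_cons]
    omega

/-! ### Runs in larger stores -/

/-- The store that agrees with `σ` on `V` and with `τ` elsewhere. -/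
def overwrite (V : Finset ℕ) (τ σ : Store) : Store := fun v => if v ∈ V then σ v else τ v

lemma sum_sz_le_of_agree {V : Finset ℕ} {σ τ : Store} (h : ∀ v ∈ V, τ v = σ v) (W : Finset ℕ) :
    ∑ v ∈ W, sz (τ v) ≤ ∑ v ∈ V, sz (σ v) + ∑ v ∈ W \ V, sz (τ v) := by
  rw [← Finset.sum_congr rfl fun v hv => congrArg sz (h v hv),
    ← Finset.sum_union disjoint_sdiff]
  refine Finset.sum_le_sum_of_subset fun v hv => ?_
  by_cases h : v ∈ V <;> simp [h, hv]

/-- A run only depends on the variables of the program. -/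
theorem Exec.frame {c : Cmd} {σ σ' : Store} {t : List Event} (h : Exec c σ t σ') {V : Finset ℕ} :
    ∀ {τ : Store}, c.vars ⊆ V → (∀ v ∈ V, τ v = σ v) →
    ∃ t', Exec c τ t' (overwrite V τ σ') ∧ time t' = time t ∧ outputs t' = outputs t ∧
      ∀ W, space W t' ≤ space V t + ∑ v ∈ W \ V, sz (τ v) := by
  have key : ∀ {σ τ : Store}, (∀ v ∈ V, τ v = σ v) → overwrite V τ σ = τ := by
    intro σ τ h
    funext v
    by_cases hv : v ∈ V <;> simp [overwrite, hv, h]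
  have agree : ∀ σ τ : Store, ∀ v ∈ V, overwrite V τ σ v = σ v := by
    intro σ τ v hv
    simp [overwrite, hv]
  have trans : ∀ σ₁ σ₂ τ : Store, overwrite V (overwrite V τ σ₁) σ₂ = overwrite V τ σ₂ := by
    intro σ₁ σ₂ τ
    funext v
    by_cases hv : v ∈ V <;> simp [overwrite, hv]
  have sums : ∀ σ τ : Store, ∀ W, ∑ v ∈ W \ V, sz (overwrite V τ σ v) = ∑ v ∈ W \ V, sz (τ v) := by
    intro σ τ W
    refine Finset.sum_congr rfl fun v hv => ?_
    simp [overwrite, (mem_sdiff.1 hv).2]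
  have step : ∀ {σ τ : Store} {e : Expr}, (∀ v ∈ V, τ v = σ v) → ∀ W,
      (Event.step (e.cost σ) τ).space W ≤
        (Event.step (e.cost σ) σ).space V + ∑ v ∈ W \ V, sz (τ v) := by
    intro σ τ e h W
    have := sum_sz_le_of_agree h W
    simp only [Event.space_step]
    omega
  induction h with
  | skip σ =>
    intro τ _ hτ
    refine ⟨[.step 1 τ], by rw [key hτ]; exact Exec.skip τ, rfl, rfl, fun W => ?_⟩
    -- `skip` is charged exactly like the evaluation of the expression `nil`.
    simpa [Expr.cost] using step (e := .nil) hτ W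
  | assign v e σ =>
    intro τ hV hτ
    have hv : v ∈ V := hV (by simp [Cmd.vars])
    have he : ∀ v ∈ e.vars, τ v = σ v := fun v hv => hτ v (hV (by simp [Cmd.vars, hv]))
    have : overwrite V τ (Function.update σ v (e.eval σ)) = Function.update τ v (e.eval τ) := by
      funext w
      by_cases hw : w = v
      · subst hw
        simp [overwrite, hv, Expr.eval_congr _ he]
      · by_cases hwV : w ∈ V <;> simp [overwrite, hw, hwV, hτ]
    refine ⟨[.step (e.cost τ) τ], by rw [this]; exact Exec.assign v e τ,
      by simp [Expr.cost_congr _ he], rfl, fun W => ?_⟩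
    simpa [Expr.cost_congr _ he] using step hτ W
  | seq h₁ h₂ ih₁ ih₂ =>
    intro τ hV hτ
    obtain ⟨t₁, e₁, ht₁, ho₁, hs₁⟩ := ih₁ (subset_union_left.trans hV) hτ
    obtain ⟨t₂, e₂, ht₂, ho₂, hs₂⟩ := ih₂ (subset_union_right.trans hV) (agree _ τ)
    refine ⟨_, trans _ _ τ ▸ Exec.seq e₁ e₂, by simp [ht₁, ht₂], by simp [ho₁, ho₂], fun W => ?_⟩
    have := hs₁ W
    have := hs₂ W
    rw [sums] at this
    simp only [space_append]
    omega
  | iteTrue hc h ih =>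
    rename_i e c₁ c₂ σ σ' t
    intro τ hV hτ
    have he : ∀ v ∈ e.vars, τ v = σ v := fun v hv => hτ v (hV (by simp [Cmd.vars, hv]))
    obtain ⟨t', e', ht, ho, hs⟩ := ih (fun v hv => hV (by simp [Cmd.vars, hv])) hτ
    refine ⟨_, Exec.iteTrue (by rwa [Expr.eval_congr _ he]) e', by simp [Expr.cost_congr _ he, ht],
      by simpa using ho, fun W => ?_⟩
    have := hs W
    have := step hτ (e := e) W
    simp only [space_cons, Expr.cost_congr _ he]
    omega
  | iteFalse hc h ih =>
    rename_i e c₁ c₂ σ σ' t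
    intro τ hV hτ
    have he : ∀ v ∈ e.vars, τ v = σ v := fun v hv => hτ v (hV (by simp [Cmd.vars, hv]))
    obtain ⟨t', e', ht, ho, hs⟩ := ih (fun v hv => hV (by simp [Cmd.vars, hv])) hτ
    refine ⟨_, Exec.iteFalse (by rwa [Expr.eval_congr _ he]) e', by simp [Expr.cost_congr _ he, ht],
      by simpa using ho, fun W => ?_⟩
    have := hs W
    have := step hτ (e := e) W
    simp only [space_cons, Expr.cost_congr _ he]
    omega
  | loopDone hc =>
    rename_i e c σ
    intro τ hV hτ
    have he : ∀ v ∈ e.vars, τ v = σ v := fun v hv => hτ v (hV (by simp [Cmd.vars, hv]))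
    refine ⟨[.step (e.cost τ) τ],
      by rw [key hτ]; exact Exec.loopDone (by rwa [Expr.eval_congr _ he]), by simp [Expr.cost_congr _ he], rfl, fun W => ?_⟩
    simpa [Expr.cost_congr _ he] using step hτ W
  | loopStep hc h₁ h₂ ih₁ ih₂ =>
    rename_i e c σ σ₁ σ₂ t₁ t₂
    intro τ hV hτ
    have he : ∀ v ∈ e.vars, τ v = σ v := fun v hv => hτ v (hV (by simp [Cmd.vars, hv]))
    obtain ⟨t₁', e₁, ht₁, ho₁, hs₁⟩ := ih₁ (subset_union_right.trans hV) hτ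
    obtain ⟨t₂', e₂, ht₂, ho₂, hs₂⟩ := ih₂ hV (agree _ τ)
    refine ⟨_, trans _ _ τ ▸ Exec.loopStep (by rwa [Expr.eval_congr _ he]) e₁ e₂,
      by simp [ht₁, ht₂, Expr.cost_congr _ he], by simp [ho₁, ho₂], fun W => ?_⟩
    have := hs₁ W
    have := hs₂ W
    have := step hτ (e := e) W
    rw [sums] at *
    simp only [space_cons, space_append, Expr.cost_congr _ he]
    omega
  | output e σ =>
    intro τ hV hτ
    have he : ∀ v ∈ e.vars, τ v = σ v := fun v hv => hτ v (hV hv)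
    refine ⟨[.step (e.cost τ) τ, .out (e.eval τ)], by rw [key hτ]; exact Exec.output e τ,
      by simp [Expr.cost_congr _ he], by simp [Expr.eval_congr _ he], fun W => ?_⟩
    simpa [Expr.cost_congr _ he] using step hτ W

lemma sum_sz_update_le (V : Finset ℕ) (σ : Store) (v : ℕ) (d : Data) :
    ∑ w ∈ V, sz (Function.update σ v d w) ≤ ∑ w ∈ V, sz (σ w) + sz d := by
  by_cases hv : v ∈ V
  · rw [← Finset.sum_erase_add _ _ hv, ← Finset.sum_erase_add (a := v) _ _ hv]
    have : ∑ w ∈ V.erase v, sz (Function.update σ v d w) = ∑ w ∈ V.erase v, sz (σ w) :=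
      Finset.sum_congr rfl fun w hw => by simp [Finset.ne_of_mem_erase hw]
    rw [this]
    simp only [Function.update_self]
    omega
  · refine (Finset.sum_congr rfl fun w hw => ?_).le.trans (Nat.le_add_right _ _)
    rw [Function.update_of_ne fun h => hv (by rwa [← h])]

/-- The final store of a run fits into the space used by the run. -/
lemma Exec.sum_sz_le_space {c : Cmd} {σ σ' : Store} {t : List Event} (h : Exec c σ t σ')
    (V : Finset ℕ) : ∑ v ∈ V, sz (σ' v) ≤ space V t := by
  induction h with
  | skip σ | loopDone _ | output _ _ => simp
  | assign v e σ =>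
    have := sum_sz_update_le V σ v (e.eval σ)
    have := e.sz_eval_lt_cost σ
    simp
    omega
  | seq _ _ _ ih | iteTrue _ _ ih | iteFalse _ _ ih | loopStep _ _ _ _ ih =>
    simp
    omega

/-- Space is bounded by the space of the initial store plus the running time. -/
lemma Exec.space_le_time {c : Cmd} {σ σ' : Store} {t : List Event} (h : Exec c σ t σ')
    (V : Finset ℕ) : space V t ≤ ∑ v ∈ V, sz (σ v) + time t ∧
      ∑ v ∈ V, sz (σ' v) ≤ ∑ v ∈ V, sz (σ v) + time t := by
  induction h with
  | skip σ | loopDone _ | output _ _ => simp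
  | assign v e σ =>
    have := sum_sz_update_le V σ v (e.eval σ)
    have := e.sz_eval_lt_cost σ
    simp
    omega
  | seq _ _ ih₁ ih₂ | loopStep _ _ _ ih₁ ih₂ =>
    simp
    omega
  | iteTrue _ _ ih | iteFalse _ _ ih =>
    simp
    omega

lemma sum_sz_initStore (V : Finset ℕ) (d : Data) : ∑ v ∈ V, sz (initStore d v) ≤ sz d := by
  refine (Finset.sum_le_sum (g := fun v => if v = 0 then sz d else 0) fun v _ => ?_).trans ?_
  · by_cases h : v = 0 <;> simp [initStore, h]
  · rw [Finset.sum_ite_eq' V 0 (fun _ => sz d)]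
    split_ifs <;> simp

lemma exists_vars_subset (c : Cmd) : ∃ K, 0 < K ∧ c.vars ⊆ range K :=
  ⟨c.vars.sup id + 1, by omega, fun v hv => by
    have := Finset.le_sup (f := id) hv
    simp at this ⊢
    omega⟩

end Listing

namespace Listing

open Finset

/-! ### Computable functions -/

@[simp] lemma initStore_zero (d : Data) : initStore d 0 = d := rfl

lemma initStore_of_ne (d : Data) {v : ℕ} (h : v ≠ 0) : initStore d v = .nil := by
  simp [initStore, h]

@[simp] lemma update_initStore (a b : Data) :
    Function.update (initStore a) 0 b = initStore b := by
  funext v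
  by_cases h : v = 0
  · subst h; simp
  · simp [h, initStore]

lemma Exec.assign' {v : ℕ} {e : Expr} {σ σ' : Store}
    (h : Function.update σ v (e.eval σ) = σ') :
    Exec (.assign v e) σ [.step (e.cost σ) σ] σ' :=
  h ▸ Exec.assign v e σ

/-- The program `c`, whose variables are below `K`, computes `f i` from `e i` without any output,
in time polynomial in the size of `e i` and `T i` and in space polynomial in the size of `e i`,
and cleans up its variables. -/
structure Realizes (K : ℕ) (c : Cmd) (p : Polynomial ℕ) {ι : Type} (e : ι → Data) (T : ι → ℕ)
    (f : ι → Data) : Prop where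
  pos : 0 < K
  vars : c.vars ⊆ range K
  run : ∀ i, ∃ t, Exec c (initStore (e i)) t (initStore (f i)) ∧ outputs t = [] ∧
    time t ≤ p.eval (sz (e i) + T i) ∧ space (range K) t ≤ p.eval (sz (e i))

/-- `f i` can be computed from `e i` in time polynomial in the size of `e i` and `T i` and in
space polynomial in the size of `e i`. -/
def Comp {ι : Type} (e : ι → Data) (T : ι → ℕ) (f : ι → Data) : Prop :=
  ∃ K c p, Realizes K c p e T f

variable {ι κ β γ : Type} {e f g : ι → Data} {T : ι → ℕ}

/-- Running a program in a larger store. -/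
lemma Realizes.call {K : ℕ} {c : Cmd} {p : Polynomial ℕ} (h : Realizes K c p e T f) (i : ι)
    {τ : Store} (h0 : τ 0 = e i) (hτ : ∀ v, v ≠ 0 → v < K → τ v = .nil) :
    ∃ t, Exec c τ t (Function.update τ 0 (f i)) ∧ outputs t = [] ∧
      time t ≤ p.eval (sz (e i) + T i) ∧
      ∀ W, space W t ≤ p.eval (sz (e i)) + ∑ v ∈ W \ range K, sz (τ v) := by
  obtain ⟨t, ht, ho, htime, hsp⟩ := h.run i
  obtain ⟨t', ht', htime', ho', hsp'⟩ := ht.frame (τ := τ) h.vars fun v hv => by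
    by_cases h : v = 0
    · subst h; exact h0
    · rw [hτ v h (by simpa using hv), initStore_of_ne _ h]
  refine ⟨t', ?_, by rw [ho', ho], by omega, fun W => (hsp' W).trans (by omega)⟩
  convert ht' using 1
  funext v
  by_cases hv : v = 0
  · subst hv; simp [overwrite, h.pos]
  · by_cases hK : v < K
    · simp [overwrite, hv, hK, hτ, initStore_of_ne]
    · simp [overwrite, hv, hK]

/-- The result is left in a variable below `K`, so it is part of the space in use at the end. This
is what keeps compositions polynomial. -/
lemma Realizes.sz_le {K : ℕ} {c : Cmd} {p : Polynomial ℕ} (h : Realizes K c p e T f) (i : ι) :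
    sz (f i) ≤ p.eval (sz (e i)) := by
  obtain ⟨t, ht, -, -, hs⟩ := h.run i
  refine le_trans ?_ ((ht.sum_sz_le_space (range K)).trans hs)
  exact Finset.single_le_sum (f := fun v => sz (initStore (f i) v)) (fun _ _ => Nat.zero_le _)
    (mem_range.2 h.pos)

lemma Comp.exists_sz_le (h : Comp e T f) :
    ∃ p : Polynomial ℕ, ∀ i, sz (f i) ≤ p.eval (sz (e i)) := by
  obtain ⟨K, c, p, h⟩ := h
  exact ⟨p, h.sz_le⟩

lemma Comp.congr (h : Comp e T f) (hfg : ∀ i, f i = g i) : Comp e T g :=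
  (funext hfg : f = g) ▸ h

/-- Change of the index type. -/
lemma Comp.reindex {e' : κ → Data} {T' : κ → ℕ} (h : Comp e T f) (φ : κ → ι)
    (he : ∀ k, e (φ k) = e' k) (hT : ∀ k, T (φ k) ≤ T' k) : Comp e' T' (fun k => f (φ k)) := by
  obtain ⟨K, c, p, h⟩ := h
  refine ⟨K, c, p, h.pos, h.vars, fun i => ?_⟩
  obtain ⟨t, h1, h2, h3, h4⟩ := h.run (φ i)
  rw [he] at h1 h3 h4
  exact ⟨t, h1, h2, h3.trans (polynomial_eval_mono p (by have := hT i; omega)), h4⟩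

lemma Comp.expr (E : Expr) (hE : E.vars ⊆ {0}) :
    Comp e T (fun i => E.eval (initStore (e i))) := by
  obtain ⟨k, hk⟩ := E.exists_cost_le
  refine ⟨1, .assign 0 E, Polynomial.C (k + 1) * (Polynomial.X + 1), one_pos, ?_, fun i => ?_⟩
  · intro v hv
    simp only [Cmd.vars, mem_insert] at hv
    have := @hE v
    simp only [mem_singleton] at this
    simp only [mem_range]
    grind
  · have hc : E.cost (initStore (e i)) ≤ k * (sz (e i) + 1) := hk _ _ fun v hv => by
      have := hE hv
      simp only [mem_singleton] at this
      simp [this]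
    refine ⟨_, Exec.assign' (by simp), rfl, ?_, ?_⟩
    · simp
      nlinarith
    · simp
      nlinarith

/-- The intermediate value fits into the space of the first program, so its size is polynomial in
the input alone, whatever `T` is. The summand `X` in the substituted polynomial absorbs `T`. The map
`φ` allows the second function to live on another index type. -/
lemma Comp.comp' {e' : κ → Data} {T' : κ → ℕ} {g : κ → Data} (hg : Comp e' T' g)
    (hf : Comp e T f) (φ : ι → κ) (he : ∀ i, e' (φ i) = f i) (hT : ∀ i, T' (φ i) ≤ T i) :
    Comp e T (fun i => g (φ i)) := by
  obtain ⟨K₁, c₁, p₁, h₁⟩ := hf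
  obtain ⟨K₂, c₂, p₂, h₂⟩ := hg
  refine ⟨max K₁ K₂, .seq c₁ c₂, p₁ + p₂.comp (p₁ + Polynomial.X), ?_, ?_, fun i => ?_⟩
  · have := h₁.pos; omega
  · refine union_subset (h₁.vars.trans ?_) (h₂.vars.trans ?_) <;> simp
  obtain ⟨t₁, e₁, o₁, m₁, s₁⟩ := h₁.call i (τ := initStore (e i)) rfl
    fun v hv _ => initStore_of_ne _ hv
  obtain ⟨t₂, e₂, o₂, m₂, s₂⟩ := h₂.call (φ i) (τ := initStore (f i)) (he i).symm
    fun v hv _ => initStore_of_ne _ hv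
  rw [update_initStore] at e₁ e₂
  have hz : ∀ (d : Data) (K : ℕ), 0 < K → ∀ W, ∑ v ∈ W \ range K, sz (initStore d v) = 0 := by
    intro d K hK W
    refine Finset.sum_eq_zero fun v hv => ?_
    rw [initStore_of_ne]
    · rfl
    · simp at hv; omega
  have hsz := h₁.sz_le i
  rw [he] at m₂ s₂
  refine ⟨_, e₁.seq e₂, by simp [o₁, o₂], ?_, ?_⟩
  · have h1 : sz (f i) + T' (φ i) ≤ p₁.eval (sz (e i) + T i) + (sz (e i) + T i) := by
      have := hT i
      have := polynomial_eval_mono p₁ (Nat.le_add_right (sz (e i)) (T i))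
      omega
    have := polynomial_eval_mono p₂ h1
    simp
    omega
  · have := s₁ (range (max K₁ K₂))
    rw [hz _ _ h₁.pos] at this
    have := s₂ (range (max K₁ K₂))
    rw [hz _ _ h₂.pos] at this
    have : sz (f i) ≤ p₁.eval (sz (e i)) + sz (e i) := by omega
    have := polynomial_eval_mono p₂ this
    simp
    omega

lemma Comp.comp {g : ι → Data} (hg : Comp f T g) (hf : Comp e T f) : Comp e T g :=
  hg.comp' hf id (fun _ => rfl) fun _ => le_rfl

lemma Comp.id : Comp e T e :=
  Comp.expr (.var 0) (by simp [Expr.vars])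

lemma Comp.nil : Comp e T (fun _ => .nil) :=
  Comp.expr .nil (by simp [Expr.vars])

/-- Computing on the first component of a pair. -/
lemma Comp.first (h : Comp e T f) (r : ι → Data) :
    Comp (fun i => cons (e i) (r i)) T (fun i => cons (f i) (r i)) := by
  obtain ⟨K, c, p, h⟩ := h
  have hK := h.pos
  -- The second component waits in variable `K`, which `c` does not touch; resetting `K` at the end
  -- makes the final store an initial store again.
  refine ⟨K + 1, .seq (.assign K (.tl (.var 0))) (.seq (.assign 0 (.hd (.var 0))) (.seq c
    (.seq (.assign 0 (.cons (.var 0) (.var K))) (.assign K .nil)))),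
    3 * p + 10 * Polynomial.X + 20, K.succ_pos, ?_, fun i => ?_⟩
  · have := h.vars
    intro v hv
    simp only [Cmd.vars, Expr.vars, mem_union, mem_insert, mem_singleton, notMem_empty] at hv
    have := @this v
    simp only [mem_range] at *
    grind
  have hK' : K ≠ 0 := by omega
  obtain ⟨t, ht, ho, hm, hs⟩ := h.call i (τ := Function.update (initStore (e i)) K (r i))
    (by simp [hK'.symm]) fun v hv hvK => by simp [hvK.ne, initStore_of_ne _ hv]
  have hw : range (K + 1) \ range K = {K} := by
    ext v; simp; omega
  have hs := hs (range (K + 1))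
  rw [hw, sum_singleton, Function.update_self] at hs
  rw [Function.update_comm hK', update_initStore] at ht
  have e₁ : Exec (.assign K (.tl (.var 0))) (initStore (cons (e i) (r i))) _
    (Function.update (initStore (cons (e i) (r i))) K (r i)) := Exec.assign' (by simp [Expr.eval])
  have e₂ : Exec (.assign 0 (.hd (.var 0)))
      (Function.update (initStore (cons (e i) (r i))) K (r i)) _
      (Function.update (initStore (e i)) K (r i)) := Exec.assign' (by
    rw [Function.update_comm hK']
    simp [Expr.eval, hK'.symm])
  have e₃ : Exec (.assign 0 (.cons (.var 0) (.var K)))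
      (Function.update (initStore (f i)) K (r i)) _
      (Function.update (initStore (cons (f i) (r i))) K (r i)) := Exec.assign' (by
    rw [Function.update_comm hK']
    simp [Expr.eval, hK'.symm])
  have e₄ : Exec (.assign K .nil) (Function.update (initStore (cons (f i) (r i))) K (r i)) _
      (initStore (cons (f i) (r i))) := Exec.assign' (by
    funext v
    by_cases hv : v = K
    · subst hv; simp [Expr.eval, initStore_of_ne _ hK']
    · simp [hv])
  have hsum : ∀ a b : Data, ∑ v ∈ range (K + 1), sz (Function.update (initStore a) K b v) ≤
      sz a + sz b := fun a b =>
    (sum_sz_update_le _ _ _ _).trans (by have := sum_sz_initStore (range (K + 1)) a; omega)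
  have hsz := h.sz_le i
  have hp := polynomial_eval_mono p (Nat.le_add_right (sz (e i)) (T i))
  have hp₁ : p.eval (sz (e i) + T i) ≤ p.eval (sz (e i) + sz (r i) + 1 + T i) :=
    polynomial_eval_mono p (by omega)
  have hp₂ : p.eval (sz (e i)) ≤ p.eval (sz (e i) + sz (r i) + 1) :=
    polynomial_eval_mono p (by omega)
  refine ⟨_, e₁.seq (e₂.seq (ht.seq (e₃.seq e₄))), by simp [ho], ?_, ?_⟩
  · simp [Expr.cost, Expr.eval, hK'.symm]
    simp only [sz] at *
    omega
  · have h1 := sum_sz_initStore (range (K + 1)) (cons (e i) (r i))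
    have h2 := hsum (cons (e i) (r i)) (r i)
    have h3 := hsum (f i) (r i)
    have h4 := hsum (cons (f i) (r i)) (r i)
    simp only [sz_cons] at h1 h2 h3 h4
    simp [Expr.cost, Expr.eval, hK'.symm]
    simp only [sz] at *
    omega

/-- The pair of two computable functions. -/
lemma Comp.cons (hf : Comp e T f) (hg : Comp e T g) :
    Comp e T (fun i => cons (f i) (g i)) := by
  have h₁ : Comp e T (fun i => Listing.cons (e i) (e i)) :=
    Comp.expr (.cons (.var 0) (.var 0)) (by simp [Expr.vars])
  have h₂ := (hf.first e).comp h₁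
  have swap : ∀ {a b : ι → Data}, Comp (fun i => Listing.cons (a i) (b i)) T
      (fun i => Listing.cons (b i) (a i)) := fun {a b} =>
    (Comp.expr (.cons (.tl (.var 0)) (.hd (.var 0))) (by simp [Expr.vars])).congr
      fun i => by simp [Expr.eval]
  exact swap.comp ((hg.first f).comp (swap.comp h₂))

lemma Comp.hd (hf : Comp e T f) : Comp e T (fun i => hd (f i)) :=
  Comp.comp (Comp.expr (.hd (.var 0)) (by simp [Expr.vars])) hf

lemma Comp.tl (hf : Comp e T f) : Comp e T (fun i => tl (f i)) :=
  Comp.comp (Comp.expr (.tl (.var 0)) (by simp [Expr.vars])) hf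

/-- Truth values. -/
def tt : Data := cons .nil .nil

lemma tt_ne_nil : tt ≠ .nil := cons_ne_nil _ _

/-- Computable predicates. -/
def CompP (e : ι → Data) (T : ι → ℕ) (p : ι → Prop) : Prop :=
  ∃ b : ι → Data, Comp e T b ∧ ∀ i, b i ≠ .nil ↔ p i

lemma CompP.eq (hf : Comp e T f) (hg : Comp e T g) : CompP e T (fun i => f i = g i) := by
  refine ⟨_, Comp.comp (Comp.expr (.eq (.hd (.var 0)) (.tl (.var 0))) (by simp [Expr.vars]))
    (hf.cons hg), fun i => ?_⟩
  by_cases h : f i = g i <;> simp [Expr.eval, h]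

lemma CompP.ne_nil (hf : Comp e T f) : CompP e T (fun i => f i ≠ .nil) := ⟨f, hf, fun _ => Iff.rfl⟩

/-- Definition by cases. -/
lemma Comp.cases {p : ι → Prop} (hp : CompP e T p)
    (h₁ : Comp (fun i : {i // p i} => e i) (fun i => T i) (fun i => f i))
    (h₂ : Comp (fun i : {i // ¬ p i} => e i) (fun i => T i) (fun i => f i)) : Comp e T f := by
  obtain ⟨b, hb, hbp⟩ := hp
  -- The truth value is put in front of the input; the program tests it, drops it, and runs the
  -- branch. Each branch only has to be correct on its own subtype.
  refine Comp.comp (f := fun i => Listing.cons (b i) (e i)) ?_ (hb.cons Comp.id)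
  obtain ⟨K₁, c₁, p₁, h₁⟩ := h₁
  obtain ⟨K₂, c₂, p₂, h₂⟩ := h₂
  refine ⟨max K₁ K₂, .ite (.hd (.var 0)) (.seq (.assign 0 (.tl (.var 0))) c₁)
    (.seq (.assign 0 (.tl (.var 0))) c₂), p₁ + p₂ + 10 * Polynomial.X + 10, ?_, ?_, fun i => ?_⟩
  · have := h₁.pos; omega
  · have h0 := h₁.pos
    have h₁ := h₁.vars
    have h₂ := h₂.vars
    intro v hv
    simp only [Cmd.vars, Expr.vars, mem_union, mem_insert, mem_singleton] at hv
    have := @h₁ v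
    have := @h₂ v
    simp only [mem_range] at *
    grind
  have hz : ∀ (d : Data) (K : ℕ), 0 < K → ∀ W, ∑ v ∈ W \ range K, sz (initStore d v) = 0 := by
    intro d K hK W
    refine Finset.sum_eq_zero fun v hv => ?_
    rw [initStore_of_ne]
    · rfl
    · simp at hv; omega
  have e₁ : Exec (.assign 0 (.tl (.var 0))) (initStore (Listing.cons (b i) (e i))) _
    (initStore (e i)) := Exec.assign' (by simp [Expr.eval])
  have hsum := sum_sz_initStore (range (max K₁ K₂)) (Listing.cons (b i) (e i))
  simp only [sz_cons] at hsum
  by_cases hpi : p i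
  · obtain ⟨t, ht, ho, hm, hs⟩ := h₁.call ⟨i, hpi⟩ (τ := initStore (e i)) rfl
      fun v hv _ => initStore_of_ne _ hv
    rw [update_initStore] at ht
    have hs := hs (range (max K₁ K₂))
    rw [hz _ _ h₁.pos] at hs
    refine ⟨_, Exec.iteTrue ?_ (e₁.seq ht), by simp [ho], ?_, ?_⟩
    · simpa [Expr.eval] using (hbp i).2 hpi
    · have := polynomial_eval_mono p₁
        (show sz (e i) + T i ≤ sz (b i) + sz (e i) + 1 + T i by omega)
      simp [Expr.cost, Expr.eval]
      simp only [sz] at *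
      omega
    · have := polynomial_eval_mono p₁ (show sz (e i) ≤ sz (b i) + sz (e i) + 1 by omega)
      simp [Expr.cost, Expr.eval]
      simp only [sz] at *
      omega
  · obtain ⟨t, ht, ho, hm, hs⟩ := h₂.call ⟨i, hpi⟩ (τ := initStore (e i)) rfl
      fun v hv _ => initStore_of_ne _ hv
    rw [update_initStore] at ht
    have hs := hs (range (max K₁ K₂))
    rw [hz _ _ h₂.pos] at hs
    refine ⟨_, Exec.iteFalse ?_ (e₁.seq ht), by simp [ho], ?_, ?_⟩
    · simpa [Expr.eval] using (hbp i).not.2 hpi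
    · have := polynomial_eval_mono p₂
        (show sz (e i) + T i ≤ sz (b i) + sz (e i) + 1 + T i by omega)
      simp [Expr.cost, Expr.eval]
      simp only [sz] at *
      omega
    · have := polynomial_eval_mono p₂ (show sz (e i) ≤ sz (b i) + sz (e i) + 1 by omega)
      simp [Expr.cost, Expr.eval]
      simp only [sz] at *
      omega

lemma Comp.restrict (hf : Comp e T f) (p : ι → Prop) :
    Comp (fun i : {i // p i} => e i) (fun i => T i) (fun i => f i) :=
  hf.reindex Subtype.val (fun _ => rfl) fun _ => le_rfl

lemma Comp.ite {p : ι → Prop} [DecidablePred p] (hp : CompP e T p) (hf : Comp e T f)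
    (hg : Comp e T g) : Comp e T (fun i => if p i then f i else g i) :=
  Comp.cases hp ((hf.restrict p).congr fun i => by simp [i.2])
    ((hg.restrict _).congr fun i => by simp [i.2])

/-- A computable predicate has a computable characteristic function. -/
lemma CompP.comp_ite {p : ι → Prop} [DecidablePred p] (hp : CompP e T p) :
    Comp e T (fun i => if p i then tt else .nil) :=
  Comp.ite hp (Comp.nil.cons Comp.nil) Comp.nil

lemma CompP.cases {p q : ι → Prop} (hp : CompP e T p)
    (h₁ : CompP (fun i : {i // p i} => e i) (fun i => T i) (fun i => q i))
    (h₂ : CompP (fun i : {i // ¬ p i} => e i) (fun i => T i) (fun i => q i)) : CompP e T q := by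
  classical
  refine ⟨fun i => if q i then tt else .nil, ?_, fun i => by simp [tt_ne_nil]⟩
  exact Comp.cases hp h₁.comp_ite h₂.comp_ite

lemma CompP.congr {p q : ι → Prop} (hp : CompP e T p) (h : ∀ i, p i ↔ q i) : CompP e T q := by
  obtain ⟨b, hb, hbp⟩ := hp
  exact ⟨b, hb, fun i => (hbp i).trans (h i)⟩

lemma CompP.restrict {p : ι → Prop} (hp : CompP e T p) (q : ι → Prop) :
    CompP (fun i : {i // q i} => e i) (fun i => T i) (fun i => p i) := by
  obtain ⟨b, hb, hbp⟩ := hp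
  exact ⟨_, hb.restrict q, fun i => hbp i⟩

lemma CompP.reindex {e' : κ → Data} {T' : κ → ℕ} {p : ι → Prop} (h : CompP e T p) (φ : κ → ι)
    (he : ∀ k, e (φ k) = e' k) (hT : ∀ k, T (φ k) ≤ T' k) : CompP e' T' (fun k => p (φ k)) := by
  obtain ⟨b, hb, hbp⟩ := h
  exact ⟨_, hb.reindex φ he hT, fun i => hbp _⟩

lemma CompP.true : CompP e T (fun _ => True) := by
  refine (CompP.ne_nil (Comp.nil.cons Comp.nil)).congr fun i => by simp

lemma CompP.not {p : ι → Prop} (hp : CompP e T p) : CompP e T (fun i => ¬ p i) := by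
  classical
  refine (CompP.eq hp.comp_ite Comp.nil).congr fun i => ?_
  by_cases h : p i <;> simp [h, tt_ne_nil]

lemma CompP.and {p q : ι → Prop} (hp : CompP e T p) (hq : CompP e T q) :
    CompP e T (fun i => p i ∧ q i) :=
  CompP.cases hp ((hq.restrict p).congr fun i => by simp [i.2])
    (CompP.true.not.congr fun i => by simp [i.2])

lemma CompP.or {p q : ι → Prop} (hp : CompP e T p) (hq : CompP e T q) :
    CompP e T (fun i => p i ∨ q i) :=
  (hp.not.and hq.not).not.congr fun i => by tauto

/-! ### Loops -/

/-- Iterating a computable function as long as the first component is not `nil`. -/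
lemma Comp.while {e' f' : κ → Data} {T' : κ → ℕ} (hc : Comp e' T' f') (d : ι → ℕ → Data)
    (n : ι → ℕ) (φ : ∀ i k, k < n i → κ) (he : ∀ i k h, e' (φ i k h) = d i k)
    (hf : ∀ i k h, f' (φ i k h) = d i (k + 1)) (hT : ∀ i k h, T' (φ i k h) ≤ T i)
    (hrun : ∀ i k, k < n i → Listing.hd (d i k) ≠ .nil) (hend : ∀ i, Listing.hd (d i (n i)) = .nil)
    (q : Polynomial ℕ) (hq : ∀ i k, k ≤ n i → sz (d i k) ≤ q.eval (sz (d i 0)))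
    (hn : ∀ i, n i ≤ q.eval (sz (d i 0))) :
    Comp (fun i => d i 0) T (fun i => d i (n i)) := by
  obtain ⟨K, c, p, h⟩ := hc
  -- At most `q` rounds and one last test; `3 * q + 2` pays for a test and for the store during it,
  -- and `p.comp (q + X)` for the body on a state of size at most `q`.
  refine ⟨K, .loop (.hd (.var 0)) c, (q + 1) * (3 * q + 2 + p.comp (q + Polynomial.X)), h.pos, ?_,
    fun i => ?_⟩
  · have := h.pos
    refine union_subset ?_ h.vars
    simpa [Expr.vars] using this
  -- Induction on the number `m` of rounds still to come.
  have key : ∀ m k, k + m = n i → ∃ t, Exec (.loop (.hd (.var 0)) c) (initStore (d i k)) t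
      (initStore (d i (n i))) ∧ outputs t = [] ∧
      time t ≤ (m + 1) * (3 * q.eval (sz (d i 0)) + 2 + p.eval (q.eval (sz (d i 0)) + T i)) ∧
      space (range K) t ≤ 3 * q.eval (sz (d i 0)) + 2 + p.eval (q.eval (sz (d i 0))) := by
    intro m
    induction m with
    | zero =>
      intro k hk
      have hk : k = n i := by omega
      subst hk
      have h1 := hq i (n i) le_rfl
      have h2 := sz_hd_le (d i (n i))
      have h3 := sum_sz_initStore (range K) (d i (n i))
      refine ⟨_, Exec.loopDone (by simpa [Expr.eval] using hend i), rfl, ?_, ?_⟩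
      · simp [Expr.cost, Expr.eval]
        simp only [sz] at *
        omega
      · simp [Expr.cost, Expr.eval]
        simp only [sz] at *
        omega
    | succ m ih =>
      intro k hk
      have hk' : k < n i := by omega
      obtain ⟨t₂, e₂, o₂, m₂, s₂⟩ := ih (k + 1) (by omega)
      obtain ⟨t₁, e₁, o₁, m₁, s₁⟩ := h.run (φ i k hk')
      rw [he] at e₁ m₁ s₁
      rw [hf] at e₁
      have h1 := hq i k hk'.le
      have h2 := sz_hd_le (d i k)
      have h3 := sum_sz_initStore (range K) (d i k)
      refine ⟨_, Exec.loopStep (by simpa [Expr.eval] using hrun i k hk') e₁ e₂,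
        by simp [o₁, o₂], ?_, ?_⟩
      · have := polynomial_eval_mono p
          (show sz (d i k) + T' (φ i k hk') ≤ q.eval (sz (d i 0)) + T i by
            have := hT i k hk'; omega)
        have hcost : (Expr.hd (.var 0)).cost (initStore (d i k)) ≤
            3 * q.eval (sz (d i 0)) + 2 := by
          simp [Expr.cost, Expr.eval]
          simp only [sz] at *
          omega
        simp only [time_cons, time_append, Event.time_step]
        nlinarith
      · have := polynomial_eval_mono p h1
        simp [Expr.cost, Expr.eval]
        simp only [sz] at *
        omega
  obtain ⟨t, h1, h2, h3, h4⟩ := key (n i) 0 (by omega)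
  refine ⟨t, h1, h2, h3.trans ?_, h4.trans ?_⟩
  · have h5 := polynomial_eval_mono q (Nat.le_add_right (sz (d i 0)) (T i))
    have h6 := polynomial_eval_mono p
      (show q.eval (sz (d i 0)) + T i ≤ q.eval (sz (d i 0) + T i) + (sz (d i 0) + T i) by omega)
    simp only [Polynomial.eval_mul, Polynomial.eval_add, Polynomial.eval_comp, Polynomial.eval_X,
      Polynomial.eval_one, Polynomial.eval_ofNat]
    have := hn i
    gcongr
    omega
  · have h6 := polynomial_eval_mono p
      (show q.eval (sz (d i 0)) ≤ q.eval (sz (d i 0)) + sz (d i 0) by omega)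
    simp only [Polynomial.eval_mul, Polynomial.eval_add, Polynomial.eval_comp, Polynomial.eval_X,
      Polynomial.eval_one, Polynomial.eval_ofNat]
    nlinarith

@[simp] lemma encList_nil : encList [] = .nil := rfl
@[simp] lemma encList_cons (a : Data) (l : List Data) : encList (a :: l) = cons a (encList l) := rfl

lemma length_le_sz_encList (l : List Data) : l.length ≤ sz (encList l) := by
  induction l with
  | nil => simp
  | cons a l ih => simp; omega

lemma sz_encList_le_of_sublist {l₁ l₂ : List Data} (h : l₁.Sublist l₂) :
    sz (encList l₁) ≤ sz (encList l₂) := by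
  induction h with
  | slnil => simp
  | cons a _ ih => simp; omega
  | cons_cons a _ ih => simp; omega

lemma encList_injective : Function.Injective encList := by
  intro l₁
  induction l₁ with
  | nil =>
    intro l₂ h
    cases l₂ with
    | nil => rfl
    | cons a l => cases h
  | cons a l₁ ih =>
    intro l₂ h
    cases l₂ with
    | nil => cases h
    | cons b l₂ =>
      simp only [encList_cons, cons_inj] at h
      rw [h.1, ih h.2]

/-- Folding a computable function over a list; the intermediate states have polynomial size. -/
lemma Comp.foldl_take (l : ι → List γ) (ea : ι → γ → Data) (es : ι → β → Data) (s0 : ι → β)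
    (step : ι → β → γ → β)
    (hl : Comp e T (fun i => encList ((l i).map (ea i)))) (hs : Comp e T (fun i => es i (s0 i)))
    (hsz : ∃ q : Polynomial ℕ, ∀ i k, sz (es i (((l i).take k).foldl (step i) (s0 i))) ≤
      q.eval (sz (e i)))
    (hc : Comp (ι := {z : ι × ℕ // z.2 < (l z.1).length})
      (fun z => Listing.cons (ea z.1.1 ((l z.1.1)[z.1.2]'z.2)) (Listing.cons
        (es z.1.1 (((l z.1.1).take z.1.2).foldl (step z.1.1) (s0 z.1.1))) (e z.1.1)))
      (fun z => T z.1.1) (fun z => es z.1.1 (step z.1.1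
        (((l z.1.1).take z.1.2).foldl (step z.1.1) (s0 z.1.1)) ((l z.1.1)[z.1.2]'z.2)))) :
    Comp e T (fun i => es i ((l i).foldl (step i) (s0 i))) := by
  obtain ⟨q, hq⟩ := hsz
  let S : ι → ℕ → β := fun i k => ((l i).take k).foldl (step i) (s0 i)
  have hS1 : ∀ i k (h : k < (l i).length), S i (k + 1) = step i (S i k) (l i)[k] := by
    intro i k h
    simp only [S, List.take_add_one, List.getElem?_eq_getElem h, Option.toList_some,
      List.foldl_append, List.foldl_cons, List.foldl_nil]
  -- The loop state: the rest of the list, the accumulator, and the input, which the body may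
  -- consult. The loop stops when the rest is `nil`.
  let D : ι → ℕ → Data := fun i k => Listing.cons (encList (((l i).drop k).map (ea i)))
    (Listing.cons (es i (S i k)) (e i))
  have hD : ∀ i k (h : k < (l i).length), D i k = Listing.cons
      (Listing.cons (ea i (l i)[k]) (encList (((l i).drop (k + 1)).map (ea i))))
      (Listing.cons (es i (S i k)) (e i)) := by
    intro i k h
    simp only [D, List.drop_eq_getElem_cons h, List.map_cons, encList_cons]
  let κ' := {z : ι × ℕ // z.2 < (l z.1).length}
  have c₁ : Comp (fun z : κ' => D z.1.1 z.1.2) (fun z => T z.1.1) (fun z => Listing.cons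
      (Listing.cons (ea z.1.1 ((l z.1.1)[z.1.2]'z.2))
        (Listing.cons (es z.1.1 (S z.1.1 z.1.2)) (e z.1.1)))
      (Listing.cons (encList (((l z.1.1).drop (z.1.2 + 1)).map (ea z.1.1))) (e z.1.1))) :=
    (Comp.expr (.cons (.cons (.hd (.hd (.var 0))) (.tl (.var 0)))
      (.cons (.tl (.hd (.var 0))) (.tl (.tl (.var 0))))) (by simp [Expr.vars])).congr fun z => by
      simp [Expr.eval, hD z.1.1 z.1.2 z.2]
  have c₂ := hc.first (fun z : κ' => Listing.cons
      (encList (((l z.1.1).drop (z.1.2 + 1)).map (ea z.1.1))) (e z.1.1))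
  have c₃ : Comp (fun z : κ' => D z.1.1 z.1.2) (fun z => T z.1.1)
      (fun z => D z.1.1 (z.1.2 + 1)) :=
    (Comp.comp (Comp.expr (.cons (.hd (.tl (.var 0))) (.cons (.hd (.var 0)) (.tl (.tl (.var 0)))))
      (by simp [Expr.vars])) (c₂.comp c₁)).congr fun z => by
        simp [Expr.eval, D, hS1 z.1.1 z.1.2 z.2, S]
  have hDb : ∀ i k, sz (D i k) ≤
      (Polynomial.X + q.comp Polynomial.X + 2 : Polynomial ℕ).eval (sz (D i 0)) := by
    intro i k
    have h1 := hq i k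
    have h2 : sz (encList (((l i).drop k).map (ea i))) ≤ sz (encList ((l i).map (ea i))) :=
      sz_encList_le_of_sublist ((List.drop_sublist k (l i)).map _)
    have h3 : sz (D i 0) =
        sz (encList ((l i).map (ea i))) + (sz (es i (S i 0)) + sz (e i) + 1) + 1 := by
      simp [D]
    have h4 := polynomial_eval_mono q (show sz (e i) ≤ sz (D i 0) by omega)
    simp only [D, S, sz_cons, Polynomial.eval_add, Polynomial.eval_comp, Polynomial.eval_X,
      Polynomial.eval_ofNat] at *
    omega
  have c₄ := c₃.while (T := T) D (fun i => (l i).length) (fun i k h => ⟨(i, k), h⟩)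
    (fun _ _ _ => rfl) (fun _ _ _ => rfl) (fun _ _ _ => le_rfl)
    (fun i k h => by simp [hD i k h]) (fun i => by
      simp only [D, hd_cons, List.drop_length, List.map_nil, encList_nil]) _ (fun i k _ => hDb i k)
    (fun i => by
      have := length_le_sz_encList ((l i).map (ea i))
      simp [D] at this ⊢
      omega)
  have c₅ : Comp e T (fun i => D i 0) := (hl.cons (hs.cons Comp.id)).congr fun i => by simp [D, S]
  exact (c₄.comp c₅).tl.hd.congr fun i => by simp [D, S]

/-- Folding a computable function over a list, with an invariant that bounds the states. -/
lemma Comp.foldl (l : ι → List γ) (ea : ι → γ → Data) (es : ι → β → Data) (s0 : ι → β)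
    (step : ι → β → γ → β) (Inv : ι → β → Prop)
    (hl : Comp e T (fun i => encList ((l i).map (ea i)))) (hs : Comp e T (fun i => es i (s0 i)))
    (h0 : ∀ i, Inv i (s0 i)) (hstep : ∀ i s a, Inv i s → a ∈ l i → Inv i (step i s a))
    (hsz : ∃ q : Polynomial ℕ, ∀ i s, Inv i s → sz (es i s) ≤ q.eval (sz (e i)))
    (hc : Comp (ι := {z : ι × β × γ // Inv z.1 z.2.1 ∧ z.2.2 ∈ l z.1})
      (fun z => Listing.cons (ea z.1.1 z.1.2.2) (Listing.cons (es z.1.1 z.1.2.1) (e z.1.1)))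
      (fun z => T z.1.1) (fun z => es z.1.1 (step z.1.1 z.1.2.1 z.1.2.2))) :
    Comp e T (fun i => es i ((l i).foldl (step i) (s0 i))) := by
  have hS : ∀ i k, Inv i (((l i).take k).foldl (step i) (s0 i)) := by
    intro i k
    have : ∀ l' : List γ, (∀ a ∈ l', a ∈ l i) → ∀ s, Inv i s → Inv i (l'.foldl (step i) s) := by
      intro l'
      induction l' with
      | nil => intro _ s hs; exact hs
      | cons a l' ih =>
        intro h s hs
        exact ih (fun b hb => h b (by simp [hb])) _ (hstep i s a hs (h a (by simp)))
    exact this _ (fun a ha => List.mem_of_mem_take ha) _ (h0 i)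
  obtain ⟨q, hq⟩ := hsz
  refine Comp.foldl_take l ea es s0 step hl hs ⟨q, fun i k => hq i _ (hS i k)⟩ ?_
  exact hc.reindex (fun z : {z : ι × ℕ // z.2 < (l z.1).length} =>
    ⟨(z.1.1, ((l z.1.1).take z.1.2).foldl (step z.1.1) (s0 z.1.1),
    (l z.1.1)[z.1.2]'z.2), hS _ _, List.getElem_mem _⟩) (fun _ => rfl) fun _ => le_rfl

end Listing

namespace Listing

open Finset

/-! ### Processing the output of a program -/

lemma Exec.eq_of_notMem_vars {c : Cmd} {σ σ' : Store} {t : List Event} (h : Exec c σ t σ') {v : ℕ}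
    (hv : v ∉ c.vars) : σ' v = σ v := by
  induction h with
  | skip | loopDone | output => rfl
  | assign w e σ =>
    simp only [Cmd.vars, mem_insert, not_or] at hv
    simp [hv.1]
  | seq _ _ ih₁ ih₂ =>
    simp only [Cmd.vars, mem_union, not_or] at hv
    rw [ih₂ hv.2, ih₁ hv.1]
  | iteTrue _ _ ih =>
    simp only [Cmd.vars, mem_union, not_or] at hv
    exact ih hv.1.2
  | iteFalse _ _ ih =>
    simp only [Cmd.vars, mem_union, not_or] at hv
    exact ih hv.2
  | loopStep _ _ _ ih₁ ih₂ =>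
    rw [ih₂ hv]
    simp only [Cmd.vars, mem_union, not_or] at hv
    exact ih₁ hv.2

/-- A run can be recharged so that variables outside the program contribute only their unchanged
contents; this converts a space bound for `c.vars` into one for any set of variables. -/
lemma Exec.frame_self {c : Cmd} {σ σ' : Store} {t : List Event} (h : Exec c σ t σ') :
    ∃ t', Exec c σ t' σ' ∧ time t' = time t ∧ outputs t' = outputs t ∧
      ∀ W, space W t' ≤ space c.vars t + ∑ v ∈ W \ c.vars, sz (σ v) := by
  obtain ⟨t', h1, h2⟩ := h.frame (V := c.vars) (τ := σ) (Subset.refl _) fun _ _ => rfl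
  refine ⟨t', ?_, h2⟩
  convert h1 using 1
  funext v
  by_cases hv : v ∈ c.vars
  · simp [overwrite, hv]
  · simp [overwrite, hv, h.eq_of_notMem_vars hv]

lemma Exec.sz_output_le {c : Cmd} {σ σ' : Store} {t : List Event} (h : Exec c σ t σ')
    (V : Finset ℕ) {d : Data} (hd : d ∈ outputs t) : sz d ≤ space V t := by
  induction h with
  | skip | loopDone | assign => simp at hd
  | seq _ _ ih₁ ih₂ | loopStep _ _ _ ih₁ ih₂ =>
    simp only [outputs_step, outputs_append, List.mem_append] at hd
    simp only [space_cons, space_append]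
    rcases hd with hd | hd
    · have := ih₁ hd; omega
    · have := ih₂ hd; omega
  | iteTrue _ _ ih | iteFalse _ _ ih =>
    have := ih hd
    simp only [space_cons]
    omega
  | output e σ =>
    have := e.sz_eval_lt_cost σ
    simp only [outputs_step, outputs_out, outputs_nil, List.mem_singleton] at hd
    subst hd
    simp only [space_cons, Event.space_step]
    omega

/-- Shifting the variables of an expression. -/
def Expr.shift (K : ℕ) : Expr → Expr
  | var v => var (K + v)
  | nil => nil
  | cons e₁ e₂ => cons (e₁.shift K) (e₂.shift K)
  | hd e => hd (e.shift K)
  | tl e => tl (e.shift K)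
  | eq e₁ e₂ => eq (e₁.shift K) (e₂.shift K)

/-- Shift the variables of a program and replace every output command by the program `b`, which
finds the tree in front of the contents of variable `0`. -/
def Cmd.hook (K : ℕ) (b : Cmd) : Cmd → Cmd
  | skip => skip
  | assign v e => assign (K + v) (e.shift K)
  | seq c₁ c₂ => seq (hook K b c₁) (hook K b c₂)
  | ite e c₁ c₂ => ite (e.shift K) (hook K b c₁) (hook K b c₂)
  | loop e c => loop (e.shift K) (hook K b c)
  | output e => seq (assign 0 (.cons (e.shift K) (.var 0))) b

/-- The store with `a` in variable `0` and with the contents of `σ`, shifted by `K`. -/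
def shiftedStore (K : ℕ) (a : Data) (σ : Store) : Store :=
  fun v => if v < K then initStore a v else σ (v - K)

lemma Expr.eval_shift (K : ℕ) (a : Data) (σ : Store) (e : Expr) :
    (e.shift K).eval (shiftedStore K a σ) = e.eval σ := by
  induction e <;> simp_all [Expr.shift, Expr.eval, shiftedStore]

lemma Expr.cost_shift (K : ℕ) (a : Data) (σ : Store) (e : Expr) :
    (e.shift K).cost (shiftedStore K a σ) = e.cost σ := by
  have h := Expr.eval_shift K a σ
  induction e with
  | var v => simp [Expr.shift, Expr.cost, shiftedStore]
  | nil => rfl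
  | cons e₁ e₂ h₁ h₂ | eq e₁ e₂ h₁ h₂ =>
    simp only [Expr.shift, Expr.cost, Expr.eval, h, h₁, h₂]
  | hd e h₁ | tl e h₁ => simp only [Expr.shift, Expr.cost, Expr.eval, h, h₁]

lemma Expr.vars_shift {K N : ℕ} {e : Expr} (h : e.vars ⊆ range N) :
    (e.shift K).vars ⊆ range (K + N) := by
  induction e with
  | var v => simpa [Expr.shift, Expr.vars] using h
  | nil => simp [Expr.shift, Expr.vars]
  | cons e₁ e₂ h₁ h₂ | eq e₁ e₂ h₁ h₂ =>
    exact union_subset (h₁ (subset_union_left.trans h)) (h₂ (subset_union_right.trans h))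
  | hd e h₁ | tl e h₁ => exact h₁ h

lemma Cmd.vars_hook {K N : ℕ} {b c : Cmd} (hK : 0 < K) (hb : b.vars ⊆ range K)
    (h : c.vars ⊆ range N) : (Cmd.hook K b c).vars ⊆ range (K + N) := by
  induction c with
  | skip => simp [Cmd.hook, Cmd.vars]
  | assign v e =>
    simp only [Cmd.vars, Cmd.hook, insert_subset_iff, mem_range] at h ⊢
    exact ⟨by omega, Expr.vars_shift h.2⟩
  | seq c₁ c₂ h₁ h₂ =>
    exact union_subset (h₁ (subset_union_left.trans h)) (h₂ (subset_union_right.trans h))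
  | ite e c₁ c₂ h₁ h₂ =>
    simp only [Cmd.vars, Cmd.hook, union_subset_iff] at h ⊢
    exact ⟨⟨Expr.vars_shift h.1.1, h₁ h.1.2⟩, h₂ h.2⟩
  | loop e c h₁ =>
    simp only [Cmd.vars, Cmd.hook, union_subset_iff] at h ⊢
    exact ⟨Expr.vars_shift h.1, h₁ h.2⟩
  | output e =>
    simp only [Cmd.vars, Cmd.hook, Expr.vars, union_subset_iff, insert_subset_iff, mem_range,
      singleton_subset_iff] at h ⊢
    refine ⟨⟨by omega, Expr.vars_shift h, by omega⟩, hb.trans ?_⟩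
    simp

lemma sum_sz_shiftedStore {K : ℕ} (hK : 0 < K) (N : ℕ) (a : Data) (σ : Store) :
    ∑ v ∈ range (K + N), sz (shiftedStore K a σ v) = sz a + ∑ v ∈ range N, sz (σ v) := by
  rw [Finset.sum_range_add]
  congr 1
  · rw [Finset.sum_eq_single_of_mem 0 (by simpa using hK)]
    · simp [shiftedStore, hK]
    · intro v hv h0
      simp at hv
      simp [shiftedStore, hv, initStore_of_ne _ h0]
  · simp [shiftedStore]

lemma update_shiftedStore_zero {K : ℕ} (hK : 0 < K) (a b : Data) (σ : Store) :
    Function.update (shiftedStore K a σ) 0 b = shiftedStore K b σ := by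
  funext v
  by_cases h : v = 0
  · subst h; simp [shiftedStore, hK]
  · by_cases hv : v < K <;> simp [shiftedStore, h, hv, initStore_of_ne]

/-- The original program runs unchanged in the shifted variables, while variable `0` carries the
accumulator `G s`; each output becomes one fold step performed by `b` below `K`. The invariant
bounds the accumulator, so the overhead per fold step is uniform. -/
lemma Exec.hook {β : Type} {K N : ℕ} {b c : Cmd} (hK : 0 < K) (hb : b.vars ⊆ range K)
    (G : β → Data) (step : β → Data → β) (Inv : β → Prop) (D : Set Data) {M tb bb : ℕ}
    (hM : ∀ s, Inv s → sz (G s) ≤ M)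
    (hrun : ∀ s d, Inv s → d ∈ D → Inv (step s d) ∧ ∃ t,
      Exec b (initStore (cons d (G s))) t (initStore (G (step s d))) ∧ outputs t = [] ∧
      time t ≤ tb ∧ space (range K) t ≤ bb)
    {σ σ' : Store} {t : List Event} (h : Exec c σ t σ') :
    ∀ s, Inv s → (∀ d ∈ outputs t, d ∈ D) → Inv ((outputs t).foldl step s) ∧ ∃ t',
      Exec (Cmd.hook K b c) (shiftedStore K (G s) σ) t'
        (shiftedStore K (G ((outputs t).foldl step s)) σ') ∧ outputs t' = [] ∧
      time t' ≤ (2 * M + 5 + tb) * time t ∧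
      space (range (K + N)) t' ≤ 2 * space (range N) t + 3 * M + 3 + bb := by
  have hsum := fun s σ => sum_sz_shiftedStore hK N (G s) σ
  have hstep : ∀ k : ℕ, k ≤ (2 * M + 5 + tb) * k := fun k => by nlinarith
  induction h with
  | skip σ =>
    intro s hs _
    refine ⟨hs, _, Exec.skip _, rfl, ?_, ?_⟩
    · simp
      omega
    · have := hM s hs
      simp [hsum]
      omega
  | assign v e σ =>
    intro s hs _
    have heq : Function.update (shiftedStore K (G s) σ) (K + v)
        ((e.shift K).eval (shiftedStore K (G s) σ)) =
        shiftedStore K (G s) (Function.update σ v (e.eval σ)) := by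
      rw [Expr.eval_shift]
      funext w
      by_cases hw : w = K + v
      · subst hw; simp [shiftedStore]
      · by_cases hwK : w < K
        · simp [shiftedStore, hw, hwK]
        · have : w - K ≠ v := by omega
          simp [shiftedStore, hw, hwK, this]
    refine ⟨hs, _, Exec.assign' heq, rfl, ?_, ?_⟩
    · simpa [Expr.cost_shift] using hstep (e.cost σ)
    · have := hM s hs
      simp [hsum, Expr.cost_shift]
      omega
  | seq _ _ ih₁ ih₂ =>
    intro s hs hD
    simp only [outputs_append, List.mem_append] at hD
    obtain ⟨i₁, t₁, e₁, o₁, m₁, s₁⟩ := ih₁ s hs fun d hd => hD d (.inl hd)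
    obtain ⟨i₂, t₂, e₂, o₂, m₂, s₂⟩ := ih₂ _ i₁ fun d hd => hD d (.inr hd)
    rw [outputs_append, List.foldl_append]
    refine ⟨i₂, _, e₁.seq e₂, by simp [o₁, o₂], ?_, ?_⟩
    · simp only [time_append]
      linarith
    · simp only [space_append]
      omega
  | iteTrue hc _ ih =>
    rename_i e c₁ c₂ σ σ' t _
    intro s hs hD
    obtain ⟨i₁, t₁, e₁, o₁, m₁, s₁⟩ := ih s hs hD
    refine ⟨i₁, _, Exec.iteTrue (by rwa [Expr.eval_shift]) e₁, by simpa using o₁, ?_, ?_⟩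
    · have := hstep (e.cost σ)
      simp only [time_cons, Event.time_step, Expr.cost_shift]
      linarith
    · have := hM s hs
      simp only [space_cons, Event.space_step, hsum, Expr.cost_shift]
      omega
  | iteFalse hc _ ih =>
    rename_i e c₁ c₂ σ σ' t _
    intro s hs hD
    obtain ⟨i₁, t₁, e₁, o₁, m₁, s₁⟩ := ih s hs hD
    refine ⟨i₁, _, Exec.iteFalse (by rwa [Expr.eval_shift]) e₁, by simpa using o₁, ?_, ?_⟩
    · have := hstep (e.cost σ)
      simp only [time_cons, Event.time_step, Expr.cost_shift]
      linarith
    · have := hM s hs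
      simp only [space_cons, Event.space_step, hsum, Expr.cost_shift]
      omega
  | loopDone hc =>
    rename_i e c σ
    intro s hs _
    refine ⟨hs, _, Exec.loopDone (by rwa [Expr.eval_shift]), rfl, ?_, ?_⟩
    · simpa [Expr.cost_shift] using hstep (e.cost σ)
    · have := hM s hs
      simp [hsum, Expr.cost_shift]
      omega
  | loopStep hc _ _ ih₁ ih₂ =>
    rename_i e c σ σ₁ σ₂ t₁ t₂ _ _
    intro s hs hD
    simp only [outputs_step, outputs_append, List.mem_append] at hD
    obtain ⟨i₁, t₁, e₁, o₁, m₁, s₁⟩ := ih₁ s hs fun d hd => hD d (.inl hd)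
    obtain ⟨i₂, t₂, e₂, o₂, m₂, s₂⟩ := ih₂ _ i₁ fun d hd => hD d (.inr hd)
    rw [outputs_step, outputs_append, List.foldl_append]
    refine ⟨i₂, _, Exec.loopStep (by rwa [Expr.eval_shift]) e₁ e₂, by simp [o₁, o₂], ?_, ?_⟩
    · have := hstep (e.cost σ)
      simp only [time_cons, Event.time_step, time_append, Expr.cost_shift]
      linarith
    · have := hM s hs
      simp only [space_cons, space_append, Event.space_step, hsum, Expr.cost_shift]
      omega
  | output e σ =>
    intro s hs hD
    simp only [outputs_step, outputs_out, outputs_nil, List.mem_singleton, forall_eq] at hD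
    obtain ⟨hi, t, ht, ho, hm, hsp⟩ := hrun s (e.eval σ) hs hD
    obtain ⟨t', ht', hm', ho', hsp'⟩ := ht.frame (V := range K)
      (τ := shiftedStore K (cons (e.eval σ) (G s)) σ) hb fun v hv => by
        simp [shiftedStore, mem_range.1 hv]
    have heq : overwrite (range K) (shiftedStore K (cons (e.eval σ) (G s)) σ)
        (initStore (G (step s (e.eval σ)))) = shiftedStore K (G (step s (e.eval σ))) σ := by
      funext v
      by_cases hv : v < K <;> simp [overwrite, shiftedStore, hv]
    rw [heq] at ht'
    have hsz0 : sz (shiftedStore K (G s) σ 0) = sz (G s) := by simp [shiftedStore, hK]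
    have h0 : shiftedStore K (G s) σ 0 = G s := by simp [shiftedStore, hK]
    have hcost : (Expr.cons (e.shift K) (.var 0)).cost (shiftedStore K (G s) σ) ≤
        2 * e.cost σ + 2 * M + 2 := by
      have h1 := e.sz_eval_lt_cost σ
      have h2 := hM s hs
      have h3 := sz_cons (e.eval σ) (G s)
      simp only [Expr.cost, Expr.eval, Expr.cost_shift, Expr.eval_shift, h0, sz] at *
      omega
    refine ⟨hi, _, Exec.seq (Exec.assign' ?_) ht', ?_, ?_, ?_⟩
    · rw [update_shiftedStore_zero hK]
      simp [Expr.eval, Expr.eval_shift, h0]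
    · simp [ho', ho]
    -- Evaluating the output expression costs at least `1`, and this unit of the old running time,
    -- times the factor, pays for one run of the body.
    · have : 1 ≤ e.cost σ := by have := e.sz_eval_lt_cost σ; omega
      simp only [time_append, time_cons, Event.time_step, time_nil, Event.time_out, hm']
      nlinarith
    · have h1 := hsp' (range (K + N))
      have h2 : ∑ v ∈ range (K + N) \ range K, sz (shiftedStore K (cons (e.eval σ) (G s)) σ v) =
          ∑ v ∈ range N, sz (σ v) := by
        rw [← Nat.Ico_zero_eq_range, ← Nat.Ico_zero_eq_range, ← Nat.Ico_zero_eq_range,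
          show Ico 0 (K + N) \ Ico 0 K = Ico K (K + N) by ext; simp; omega,
          Finset.sum_Ico_eq_sum_range]
        simp [shiftedStore]
      have h3 := hM s hs
      simp only [space_append, space_cons, Event.space_step, Event.space_out, space_nil, hsum]
      omega

/-- Reset the variables `K, …, K + N - 1`. -/
def Cmd.clear (K : ℕ) : ℕ → Cmd
  | 0 => skip
  | N + 1 => seq (clear K N) (assign (K + N) .nil)

lemma Cmd.vars_clear (K N : ℕ) : (Cmd.clear K N).vars ⊆ range (K + N) := by
  induction N with
  | zero => simp [Cmd.clear, Cmd.vars]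
  | succ N ih =>
    intro v hv
    have := @ih v
    simp only [Cmd.clear, Cmd.vars, Expr.vars, mem_union, mem_insert, notMem_empty, or_false,
      mem_range] at hv this ⊢
    rcases hv with hv | hv
    · have := this hv; omega
    · omega

/-- Variables from `N` on are `nil` already, so resetting the shifted block leaves an initial store,
as `Realizes` demands. -/
lemma Exec.clear (K N : ℕ) (a : Data) (σ : Store) (hσ : ∀ v, N ≤ v → σ v = .nil) (hK : 0 < K) :
    ∃ t, Exec (Cmd.clear K N) (shiftedStore K a σ) t (initStore a) ∧ outputs t = [] ∧
      time t ≤ N + 1 ∧ ∀ L, space (range (K + L)) t ≤ sz a + ∑ v ∈ range L, sz (σ v) + 1 := by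
  suffices ∀ m ≤ N, ∃ t, Exec (Cmd.clear K m) (shiftedStore K a σ) t
      (shiftedStore K a (fun v => if v < m then .nil else σ v)) ∧ outputs t = [] ∧
      time t ≤ m + 1 ∧ ∀ L, space (range (K + L)) t ≤ sz a + ∑ v ∈ range L, sz (σ v) + 1 by
    convert this N le_rfl using 5
    funext v
    by_cases hv : v < K
    · simp [shiftedStore, hv]
    · have h0 : v ≠ 0 := by omega
      by_cases hv' : v - K < N
      · simp [shiftedStore, hv, hv', initStore_of_ne _ h0]
      · simp [shiftedStore, hv, hv', initStore_of_ne _ h0, hσ _ (not_lt.1 hv')]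
  intro m
  induction m with
  | zero =>
    intro _
    refine ⟨_, by simpa [Cmd.clear] using Exec.skip _, rfl, by simp, fun L => ?_⟩
    simp [sum_sz_shiftedStore hK]
  | succ m ih =>
    intro hm
    obtain ⟨t, e, o, ht, hs⟩ := ih (by omega)
    refine ⟨_, e.seq (Exec.assign' (e := .nil) ?_), by simp [o], ?_, fun L => ?_⟩
    · funext w
      by_cases hw : w = K + m
      · subst hw; simp [shiftedStore, Expr.eval]
      · by_cases hwK : w < K
        · simp [shiftedStore, hw, hwK]
        · by_cases h : w - K < m
          · simp [shiftedStore, hw, hwK, h, h.trans m.lt_succ_self]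
          · have : ¬ w - K < m + 1 := by omega
            simp [shiftedStore, hw, hwK, h, this]
    · simp [Expr.cost]
      omega
    · have h1 := hs L
      have h2 : ∑ v ∈ range L, sz (if v < m then .nil else σ v) ≤ ∑ v ∈ range L, sz (σ v) :=
        Finset.sum_le_sum fun v _ => by split_ifs <;> simp
      simp only [space_append, space_cons, Event.space_step, sum_sz_shiftedStore hK, Expr.cost,
        space_nil]
      omega

variable {ι β : Type} {e : ι → Data} {T : ι → ℕ}

/-- Folding a computable function over the outputs of a program. -/
lemma Comp.hook (c : Cmd) (inp : ι → Data) (t : ι → List Event) (σ : ι → Store)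
    (hexec : ∀ i, Exec c (initStore (inp i)) (t i) (σ i)) (p : Polynomial ℕ)
    (htime : ∀ i, time (t i) ≤ p.eval (sz (e i) + T i))
    (hspace : ∀ i, space c.vars (t i) ≤ p.eval (sz (e i)))
    (es : ι → β → Data) (s0 : ι → β) (step : ι → β → Data → β) (Inv : ι → β → Prop)
    (hinp : Comp e T inp) (hs : Comp e T (fun i => es i (s0 i)))
    (h0 : ∀ i, Inv i (s0 i)) (hstep : ∀ i s d, Inv i s → d ∈ outputs (t i) → Inv i (step i s d))
    (hsz : ∃ q : Polynomial ℕ, ∀ i s, Inv i s → sz (es i s) ≤ q.eval (sz (e i)))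
    (hc : Comp (ι := {z : ι × β × Data // Inv z.1 z.2.1 ∧ z.2.2 ∈ outputs (t z.1)})
      (fun z => Listing.cons z.1.2.2 (Listing.cons (es z.1.1 z.1.2.1) (e z.1.1)))
      (fun z => T z.1.1) (fun z => es z.1.1 (step z.1.1 z.1.2.1 z.1.2.2))) :
    Comp e T (fun i => Listing.cons (σ i 0)
      (es i ((outputs (t i)).foldl (step i) (s0 i)))) := by
  obtain ⟨q, hq⟩ := hsz
  obtain ⟨r, hr⟩ := hinp.exists_sz_le
  obtain ⟨N, hN, hcN⟩ := exists_vars_subset c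
  -- The body has to hand back the context `e i` together with the new accumulator, because the next
  -- call reads it again.
  have hbody : Comp (ι := {z : ι × β × Data // Inv z.1 z.2.1 ∧ z.2.2 ∈ outputs (t z.1)})
      (fun z => Listing.cons z.1.2.2 (Listing.cons (es z.1.1 z.1.2.1) (e z.1.1)))
      (fun z => T z.1.1) (fun z => Listing.cons (es z.1.1 (step z.1.1 z.1.2.1 z.1.2.2))
        (e z.1.1)) := hc.cons (Comp.id.tl.tl.congr fun z => by simp)
  suffices Comp (fun i => Listing.cons (inp i) (Listing.cons (es i (s0 i)) (e i))) T
      (fun i => Listing.cons (σ i 0)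
        (Listing.cons (es i ((outputs (t i)).foldl (step i) (s0 i))) (e i))) by
    have h := this.comp (hinp.cons (hs.cons Comp.id))
    exact (h.hd.cons h.tl.hd).congr fun i => by simp
  obtain ⟨K, b, pb, h⟩ := hbody
  have hK := h.pos
  -- Here `p + r` bounds the store and the output trees of `c`, `q` the accumulator, and `X` the
  -- context; so `m` bounds every input of the body.
  let m : Polynomial ℕ := p + r + q + Polynomial.X + 3
  -- Move the input of `c` to variable `K`, its shifted variable `0`, leave accumulator and context
  -- in variable `0`, run the hooked program, attach its final variable `0`, and clean up.
  refine ⟨K + N, .seq (.assign K (.hd (.var 0))) (.seq (.assign 0 (.tl (.var 0)))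
    (.seq (Cmd.hook K b c) (.seq (.assign 0 (.cons (.var K) (.var 0))) (.clear K N)))),
    (2 * m + 6 + pb.comp (m + Polynomial.X)) * (p + 1) + 20 * (p + m) + Polynomial.C N + 20,
    by omega, ?_, fun i => ?_⟩
  · have h1 := Cmd.vars_hook hK h.vars hcN
    have h2 := Cmd.vars_clear K N
    intro v hv
    have h1 := @h1 v
    have h2 := @h2 v
    simp only [Cmd.vars, Expr.vars, mem_union, mem_insert, mem_singleton, mem_range] at *
    grind
  obtain ⟨ti, hti, htt, hto, htsp⟩ := (hexec i).frame_self
  obtain ⟨n, hn⟩ : ∃ n, n = sz (e i) := ⟨_, rfl⟩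
  have hq := hq i
  have hrn := hr i
  have htime := htime i
  have hspace := hspace i
  rw [← hn] at hq hrn htime hspace
  have htsp : space (range N) ti ≤ p.eval n + r.eval n := by
    refine (htsp _).trans (add_le_add hspace (le_trans ?_ hrn))
    exact sum_sz_initStore _ _
  have hσ : ∀ v, N ≤ v → σ i v = .nil := fun v hv => by
    rw [(hexec i).eq_of_notMem_vars fun h => by have := hcN h; simp at this; omega,
      initStore_of_ne _ (by omega)]
  obtain ⟨M, hMdef⟩ : ∃ M, M = m.eval n := ⟨_, rfl⟩
  have hMval : M = p.eval n + r.eval n + q.eval n + n + 3 := by simp [hMdef, m]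
  have hG : ∀ s, Inv i s → sz (Listing.cons (es i s) (e i)) ≤ M := fun s hs => by
    have := hq s hs
    rw [sz_cons]
    omega
  obtain ⟨-, t', ht', ho', hm', hsp'⟩ := hti.hook (N := N) hK h.vars
    (fun s => Listing.cons (es i s) (e i)) (step i) (Inv i) {d | d ∈ outputs (t i)} (M := M)
    (tb := pb.eval (M + T i)) (bb := pb.eval M) hG (fun s d hs hd => by
      obtain ⟨tb, h1, h2, h3, h4⟩ := h.run ⟨(i, s, d), hs, hd⟩
      have hsd : sz (Listing.cons d (Listing.cons (es i s) (e i))) ≤ M := by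
        have h1 := hti.sz_output_le (range N) (d := d) (by rw [hto]; exact hd)
        have h2 := hq s hs
        rw [sz_cons, sz_cons]
        omega
      exact ⟨hstep i s d hs hd, tb, h1, h2,
        h3.trans (polynomial_eval_mono pb (Nat.add_le_add_right hsd _)),
        h4.trans (polynomial_eval_mono pb hsd)⟩) (s0 i) (h0 i) (by rw [hto]; exact fun d hd => hd)
  rw [hto] at ht'
  have hInv : Inv i ((outputs (t i)).foldl (step i) (s0 i)) := by
    have : ∀ l' : List Data, (∀ d ∈ l', d ∈ outputs (t i)) → ∀ s, Inv i s →
        Inv i (l'.foldl (step i) s) := by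
      intro l'
      induction l' with
      | nil => intro _ s hs; exact hs
      | cons a l' ih =>
        intro h s hs
        exact ih (fun b hb => h b (by simp [hb])) _ (hstep i s a hs (h a (by simp)))
    exact this _ (fun _ h => h) _ (h0 i)
  set s' := (outputs (t i)).foldl (step i) (s0 i) with hs'
  obtain ⟨tc, hct, hco, hcm, hcs⟩ := Exec.clear K N
    (Listing.cons (σ i 0) (Listing.cons (es i s') (e i))) (σ i) hσ hK
  have hσs : ∑ v ∈ range N, sz (σ i v) ≤ p.eval n + r.eval n :=
    (hti.sum_sz_le_space _).trans htsp
  have hσ0 : sz (σ i 0) ≤ p.eval n + r.eval n :=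
    (Finset.single_le_sum (f := fun v => sz (σ i v)) (fun _ _ => Nat.zero_le _)
      (mem_range.2 hN)).trans hσs
  have hG0 := hG _ (h0 i)
  have hG1 := hG _ hInv
  have e₁ : Exec (.assign K (.hd (.var 0)))
      (initStore (Listing.cons (inp i) (Listing.cons (es i (s0 i)) (e i)))) _
      (shiftedStore K (Listing.cons (inp i) (Listing.cons (es i (s0 i)) (e i)))
        (initStore (inp i))) := Exec.assign' (by
    funext v
    by_cases hv : v = K
    · subst hv; simp [Expr.eval, shiftedStore]
    · by_cases hv' : v < K
      · simp [hv, shiftedStore, hv']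
      · have h1 : v ≠ 0 := by omega
        have h2 : v - K ≠ 0 := by omega
        simp [hv, shiftedStore, hv', initStore_of_ne _ h1, initStore_of_ne _ h2])
  have e₂ : Exec (.assign 0 (.tl (.var 0)))
      (shiftedStore K (Listing.cons (inp i) (Listing.cons (es i (s0 i)) (e i)))
        (initStore (inp i))) _
      (shiftedStore K (Listing.cons (es i (s0 i)) (e i)) (initStore (inp i))) :=
    Exec.assign' (by
      rw [update_shiftedStore_zero hK]
      simp [Expr.eval, shiftedStore, hK])
  have e₃ : Exec (.assign 0 (.cons (.var K) (.var 0)))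
      (shiftedStore K (Listing.cons (es i s') (e i)) (σ i)) _
      (shiftedStore K (Listing.cons (σ i 0) (Listing.cons (es i s') (e i))) (σ i)) :=
    Exec.assign' (by
      rw [update_shiftedStore_zero hK]
      simp [Expr.eval, shiftedStore, hK])
  have hsizes : sz (Listing.cons (inp i) (Listing.cons (es i (s0 i)) (e i))) =
    sz (inp i) + sz (Listing.cons (es i (s0 i)) (e i)) + 1 := sz_cons _ _
  have hc1 : (Expr.hd (.var 0)).cost (initStore (Listing.cons (inp i)
      (Listing.cons (es i (s0 i)) (e i)))) ≤ 3 * M + 4 := by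
    simp only [Expr.cost, Expr.eval, initStore_zero, hd_cons, sz] at *
    omega
  have hc2 : (Expr.tl (.var 0)).cost (shiftedStore K (Listing.cons (inp i)
      (Listing.cons (es i (s0 i)) (e i))) (initStore (inp i))) ≤ 3 * M + 4 := by
    simp only [Expr.cost, Expr.eval, shiftedStore, hK, if_true, initStore_zero, tl_cons, sz] at *
    omega
  have hc3 : (Expr.cons (.var K) (.var 0)).cost
      (shiftedStore K (Listing.cons (es i s') (e i)) (σ i)) ≤ 4 * M + 4 := by
    have := sz_cons (σ i 0) (Listing.cons (es i s') (e i))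
    simp only [Expr.cost, Expr.eval, shiftedStore, hK, if_true, initStore_zero, lt_irrefl,
      if_false, Nat.sub_self, sz] at *
    omega
  refine ⟨_, e₁.seq (e₂.seq (ht'.seq (e₃.seq hct))), by simp [ho', hco], ?_, ?_⟩
  · have hle : n + T i ≤ sz (Listing.cons (inp i) (Listing.cons (es i (s0 i)) (e i))) + T i := by
      rw [sz_cons, sz_cons]; omega
    set n' := sz (Listing.cons (inp i) (Listing.cons (es i (s0 i)) (e i))) + T i with hn'
    have h1 : time ti ≤ p.eval n' := by
      rw [htt]; exact htime.trans (polynomial_eval_mono p hle)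
    have h2 : M ≤ m.eval n' := hMdef.trans_le (polynomial_eval_mono m (by omega))
    have h3 : pb.eval (M + T i) ≤ pb.eval (m.eval n' + n') := polynomial_eval_mono pb (by omega)
    have h4 : time t' ≤ (2 * m.eval n' + 6 + pb.eval (m.eval n' + n')) * (p.eval n' + 1) :=
      hm'.trans (Nat.mul_le_mul (by omega) (by omega))
    simp only [time_append, time_cons, Event.time_step, time_nil, Polynomial.eval_add,
      Polynomial.eval_mul, Polynomial.eval_comp, Polynomial.eval_X, Polynomial.eval_C,
      Polynomial.eval_ofNat, Polynomial.eval_one]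
    omega
  · have hle : n ≤ sz (Listing.cons (inp i) (Listing.cons (es i (s0 i)) (e i))) := by
      rw [sz_cons, sz_cons]; omega
    have hd1 := sum_sz_initStore (range (K + N))
      (Listing.cons (inp i) (Listing.cons (es i (s0 i)) (e i)))
    have hd2 := sum_sz_shiftedStore hK N (Listing.cons (inp i) (Listing.cons (es i (s0 i)) (e i)))
      (initStore (inp i))
    have hd3 := sum_sz_initStore (range N) (inp i)
    have hd4 := sum_sz_shiftedStore hK N (Listing.cons (es i s') (e i)) (σ i)
    have hd5 := hcs N
    have hd6 := sz_cons (σ i 0) (Listing.cons (es i s') (e i))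
    set n' := sz (Listing.cons (inp i) (Listing.cons (es i (s0 i)) (e i))) with hn'
    have h1 : p.eval n ≤ p.eval n' := polynomial_eval_mono p hle
    have h2 : M ≤ m.eval n' := hMdef.trans_le (polynomial_eval_mono m (by omega))
    have h3 : pb.eval M ≤ pb.eval (m.eval n' + n') := polynomial_eval_mono pb (by omega)
    have h4 : 2 * m.eval n' + 6 + pb.eval (m.eval n' + n') ≤
        (2 * m.eval n' + 6 + pb.eval (m.eval n' + n')) * (p.eval n' + 1) := by nlinarith
    simp only [space_append, space_cons, Event.space_step, Polynomial.eval_add, space_nil,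
      Polynomial.eval_mul, Polynomial.eval_comp, Polynomial.eval_X, Polynomial.eval_C,
      Polynomial.eval_ofNat, Polynomial.eval_one]
    generalize (2 * m.eval n' + 6 + pb.eval (m.eval n' + n')) * (p.eval n' + 1) = Y at h4 ⊢
    clear hm' hMdef
    simp only [max_le_iff]
    refine ⟨⟨?_, Nat.zero_le _⟩, ⟨?_, Nat.zero_le _⟩, ?_, ⟨?_, Nat.zero_le _⟩, ?_⟩ <;> omega

end Listing

namespace Listing

open Finset

/-! ### Listing programs -/

lemma time_le_of_isInfix {s t : List Event} (h : s <:+: t) : time s ≤ time t := by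
  obtain ⟨a, b, rfl⟩ := h
  simp only [time_append]
  omega

/-- Prepending a block of events to a run whose first output is not too late. -/
lemma DelayLE.append {s t : List Event} {a b c : ℕ} (hs : time s ≤ a)
    (ht : ∀ u, u <+: t → outputs u = [] → time u ≤ b) (hd : DelayLE t c) (hc : a + b ≤ c) :
    DelayLE (s ++ t) c := by
  intro u hu ho
  rcases List.infix_append_iff.1 hu with h | h | ⟨x, y, rfl, hx, hy⟩
  · have := time_le_of_isInfix h; omega
  · exact hd u h ho
  · rw [outputs_append, List.append_eq_nil_iff] at ho
    have h1 := time_le_of_isInfix hx.isInfix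
    have h2 := ht y hy ho.2
    rw [time_append]
    omega

/-- The total time is at most the number of stretches without output times the delay. -/
lemma DelayLE.time_le {b : ℕ} : ∀ {t : List Event}, DelayLE t b →
    time t ≤ ((outputs t).length + 1) * b := by
  -- `s` is the current silent stretch; an output closes it and is paid with one `b`.
  suffices ∀ t s : List Event, outputs s = [] → DelayLE (s ++ t) b →
      time (s ++ t) ≤ ((outputs t).length + 1) * b by
    intro t ht
    simpa using this t [] rfl (by simpa using ht)
  intro t
  induction t with
  | nil =>
    intro s hs hd
    simpa using hd s (by simp) hs
  | cons ev t ih =>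
    intro s hs hd
    cases ev with
    | step k σ =>
      have := ih (s ++ [.step k σ]) (by simp [hs]) (by simpa using hd)
      simpa using this
    | out d =>
      have h1 := hd s (List.prefix_append _ _).isInfix hs
      have h2 := ih [] rfl fun u hu ho => hd u (hu.trans ⟨s ++ [.out d], [], by simp⟩) ho
      simp only [List.nil_append] at h2
      simp only [time_append, time_cons, Event.time_out, outputs_out, List.length_cons]
      nlinarith

lemma isPrefix_append {α : Type*} {u s t : List α} (h : u <+: s ++ t) :
    u <+: s ∨ ∃ w, u = s ++ w ∧ w <+: t := by
  rcases List.prefix_or_prefix_of_prefix h (List.prefix_append s t) with h' | ⟨w, rfl⟩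
  · exact .inl h'
  · exact .inr ⟨w, rfl, (List.prefix_append_right_inj s).1 h⟩

lemma filterMap_range_succ {α : Type*} (f : ℕ → Option α) (m : ℕ) :
    (List.range (m + 1)).filterMap f =
      (f 0).toList ++ (List.range m).filterMap (fun k => f (k + 1)) := by
  rw [List.range_succ_eq_map, List.filterMap_cons, List.filterMap_map]
  cases f 0 <;> rfl

/-- Output the third component of the state if the second one is not `nil`. -/
def Cmd.emit : Cmd :=
  .ite (.hd (.tl (.var 0))) (.output (.hd (.tl (.tl (.var 0))))) .skip

/-- Output is governed by a separate flag, so that the tree `nil`, which encodes `∅`, can be output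
too. -/
lemma exec_emit (d : Data) (o : Option Data)
    (h : ∀ a, o = some a → hd (tl d) ≠ .nil ∧ hd (tl (tl d)) = a)
    (h' : o = none → hd (tl d) = .nil) :
    ∃ t, Exec Cmd.emit (initStore d) t (initStore d) ∧ outputs t = o.toList ∧
      time t ≤ 10 * sz d + 10 ∧ ∀ V, space V t ≤ 10 * sz d + 10 := by
  have h1 := sz_tl_le d
  have h2 := sz_hd_le (tl d)
  have h3 := sz_tl_le (tl d)
  have h4 := sz_hd_le (tl (tl d))
  cases o with
  | none =>
    refine ⟨_, Exec.iteFalse (by simpa [Expr.eval] using h' rfl) (Exec.skip _), rfl, ?_, ?_⟩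
    · simp [Expr.cost, Expr.eval]
      simp only [sz] at *
      omega
    · intro V
      have := sum_sz_initStore V d
      simp [Expr.cost, Expr.eval]
      simp only [sz] at *
      omega
  | some a =>
    refine ⟨_, Exec.iteTrue (by simpa [Expr.eval] using (h a rfl).1) (Exec.output _ _), ?_, ?_, ?_⟩
    · simp [Expr.eval, (h a rfl).2]
    · simp [Expr.cost, Expr.eval]
      simp only [sz] at *
      omega
    · intro V
      have := sum_sz_initStore V d
      simp [Expr.cost, Expr.eval]
      simp only [sz] at *
      omega

/-- A computable transition function, iterated as long as the state is running, gives a program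
that emits the outputs attached to the states; if there are no two consecutive silent transitions,
its delay is polynomial. -/
theorem exists_lister (Q : ListingProblem) (T : Q.ι → ℕ) {St : Type} (dat : St → Data)
    (inst : St → Q.ι) (run : St → Prop) (em : St → Option Data) (next : St → St) (init : Q.ι → St)
    (hrun : ∀ s, hd (dat s) ≠ .nil ↔ run s)
    (hem : ∀ s a, em s = some a → hd (tl (dat s)) ≠ .nil ∧ hd (tl (tl (dat s))) = a)
    (hem' : ∀ s, em s = none → hd (tl (dat s)) = .nil)
    (hinit : Comp Q.input T (fun i => dat (init i)))
    (hnext : Comp (fun s : {s // run s} => dat s) (fun s => T (inst s)) (fun s => dat (next s)))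
    (hinst₀ : ∀ i, inst (init i) = i) (hinst : ∀ s, run s → inst (next s) = inst s)
    (q : Polynomial ℕ) (hq : ∀ s, sz (dat s) ≤ q.eval (Q.size (inst s)))
    (hdelay : ∀ s, run s → run (next s) → em (next s) = none → run (next (next s)) →
      em (next (next s)) ≠ none)
    (n : Q.ι → ℕ) (hn : ∀ i, ∀ k < n i, run (next^[k] (init i)))
    (hend : ∀ i, ¬ run (next^[n i] (init i))) :
    ∃ (c : Cmd) (p : Polynomial ℕ), ∀ i, ∃ t σ', Exec c (initStore (Q.input i)) t σ' ∧
      outputs t = (List.range (n i + 1)).filterMap (fun k => em (next^[k] (init i))) ∧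
      DelayLE t (p.eval (Q.size i + T i)) ∧ space c.vars t ≤ p.eval (Q.size i) := by
  obtain ⟨K₁, c₁, p₁, h₁⟩ := hinit
  obtain ⟨K₂, c₂, p₂, h₂⟩ := hnext
  let B : Polynomial ℕ := p₁ + p₂.comp (q + Polynomial.X) + 20 * q + 20
  refine ⟨.seq c₁ (.seq .emit (.loop (.hd (.var 0)) (.seq c₂ .emit))), 4 * B, fun i => ?_⟩
  obtain ⟨L, hL⟩ : ∃ L, L = q.eval (Q.size i) := ⟨_, rfl⟩
  obtain ⟨b, hb⟩ : ∃ b, b = B.eval (Q.size i + T i) := ⟨_, rfl⟩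
  obtain ⟨b', hb'⟩ : ∃ b', b' = B.eval (Q.size i) := ⟨_, rfl⟩
  have hBb : p₁.eval (Q.size i + T i) + p₂.eval (L + T i) + 20 * L + 20 ≤ b := by
    have h1 : L ≤ q.eval (Q.size i + T i) := by
      rw [hL]; exact polynomial_eval_mono q (by omega)
    have h2 : p₂.eval (L + T i) ≤ p₂.eval (q.eval (Q.size i + T i) + (Q.size i + T i)) :=
      polynomial_eval_mono p₂ (by omega)
    simp only [hb, B, Polynomial.eval_add, Polynomial.eval_comp, Polynomial.eval_mul,
      Polynomial.eval_X, Polynomial.eval_ofNat]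
    omega
  have hBb' : p₁.eval (Q.size i) + p₂.eval L + 20 * L + 20 ≤ b' := by
    have h2 : p₂.eval L ≤ p₂.eval (q.eval (Q.size i) + Q.size i) :=
      polynomial_eval_mono p₂ (by omega)
    simp only [hb', B, Polynomial.eval_add, Polynomial.eval_comp, Polynomial.eval_mul,
      Polynomial.eval_X, Polynomial.eval_ofNat]
    omega
  set V := (Cmd.seq c₁ (.seq .emit (.loop (.hd (.var 0)) (.seq c₂ .emit)))).vars
  have hz : ∀ (d : Data) (K : ℕ), 0 < K → ∀ W, ∑ v ∈ W \ range K, sz (initStore d v) = 0 := by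
    intro d K hK W
    refine Finset.sum_eq_zero fun v hv => ?_
    rw [initStore_of_ne]
    · rfl
    · simp at hv; omega
  have hblock : ∀ s, inst s = i → run s → ∃ t, Exec (.seq c₂ .emit) (initStore (dat s)) t
      (initStore (dat (next s))) ∧ outputs t = (em (next s)).toList ∧
      (Expr.hd (.var 0)).cost (initStore (dat s)) + time t ≤ b ∧
      space V t ≤ b' := by
    intro s hs hr
    obtain ⟨t₁, e₁, o₁, m₁, s₁⟩ := h₂.call ⟨s, hr⟩ (τ := initStore (dat s)) rfl
      fun v hv _ => initStore_of_ne _ hv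
    rw [update_initStore] at e₁
    dsimp only at m₁ s₁
    obtain ⟨t₂, e₂, o₂, m₂, s₂⟩ := exec_emit (dat (next s)) (em (next s)) (hem _) (hem' _)
    have hL1 : sz (dat s) ≤ L := by rw [hL, ← hs]; exact hq s
    have hL2 : sz (dat (next s)) ≤ L := by rw [hL, ← hs, ← hinst s hr]; exact hq _
    have := sz_hd_le (dat s)
    refine ⟨_, e₁.seq e₂, by simp [o₁, o₂], ?_, ?_⟩
    · have := polynomial_eval_mono p₂ (show sz (dat s) + T (inst s) ≤ L + T i by rw [hs]; omega)
      simp only [time_append, Expr.cost, Expr.eval, initStore_zero, sz] at *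
      omega
    · have h3 := s₁ V
      rw [hz _ _ h₂.pos] at h3
      have := polynomial_eval_mono p₂ hL1
      have := s₂ V
      simp only [space_append]
      omega
  -- Each round costs at most `b`. The silent stretch at the start of the loop takes at most `b` if
  -- the loop stops at once, `2 * b` if the first move does not lead silently into a running state,
  -- and `3 * b` in general, since a silent move is followed by an output or by a halt. Together
  -- with the preceding block this gives the delay `4 * b`.
  have hloop : ∀ m s, inst s = i → (∀ k < m, run (next^[k] s)) → ¬ run (next^[m] s) →
      ∃ t σ', Exec (.loop (.hd (.var 0)) (.seq c₂ .emit)) (initStore (dat s)) t σ' ∧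
        outputs t = (List.range m).filterMap (fun k => em (next^[k + 1] s)) ∧
        (∀ u, u <+: t → outputs u = [] → time u ≤ 3 * b) ∧
        ((run s → run (next s) → em (next s) ≠ none) →
          ∀ u, u <+: t → outputs u = [] → time u ≤ 2 * b) ∧
        (¬ run s → time t ≤ b) ∧ DelayLE t (4 * b) ∧ space V t ≤ b' := by
    intro m
    induction m with
    | zero =>
      intro s hs _ hr
      have hL1 : sz (dat s) ≤ L := by rw [hL, ← hs]; exact hq s
      have h2 := sz_hd_le (dat s)
      have h3 := sum_sz_initStore V (dat s)
      have hc : (Expr.hd (.var 0)).cost (initStore (dat s)) ≤ 2 * L + 2 := by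
        simp only [Expr.cost, Expr.eval, initStore_zero, sz] at *
        omega
      have hle : ∀ u, u <:+: [Event.step ((Expr.hd (.var 0)).cost (initStore (dat s)))
          (initStore (dat s))] → time u ≤ b := fun u hu => by
        have := time_le_of_isInfix hu
        simp only [time_cons, time_nil, Event.time_step] at this
        omega
      refine ⟨_, _, Exec.loopDone ?_, rfl, fun u hu _ => (hle u hu.isInfix).trans (by omega),
        fun _ u hu _ => (hle u hu.isInfix).trans (by omega), fun _ => hle _ List.infix_rfl, fun u hu _ => (hle u hu).trans (by omega), ?_⟩
      · by_contra hc
        exact hr ((hrun s).1 hc)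
      · simp only [space_cons, space_nil, Event.space_step]
        omega
    | succ m ih =>
      intro s hs hk hr
      have hrs : run s := hk 0 (by omega)
      obtain ⟨t₁, e₁, o₁, m₁, s₁⟩ := hblock s hs hrs
      obtain ⟨t₂, σ', e₂, o₂, x₂, y₂, z₂, d₂, s₂⟩ := ih (next s) (by rw [hinst s hrs, hs])
        (fun k hkm => hk (k + 1) (by omega)) hr
      have hL1 : sz (dat s) ≤ L := by rw [hL, ← hs]; exact hq s
      have h2 := sz_hd_le (dat s)
      have h3 := sum_sz_initStore V (dat s)
      have hc : (Expr.hd (.var 0)).cost (initStore (dat s)) ≤ 2 * L + 2 := by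
        simp only [Expr.cost, Expr.eval, initStore_zero, sz] at *
        omega
      have hpre : ∀ u, u <+: .step ((Expr.hd (.var 0)).cost (initStore (dat s)))
          (initStore (dat s)) :: (t₁ ++ t₂) → outputs u = [] → (time u ≤ b ∨
            (outputs t₁ = [] ∧ ∃ w, w <+: t₂ ∧ outputs w = [] ∧ time u ≤ b + time w)) := by
        intro u hu ho
        rw [← List.cons_append] at hu
        rcases isPrefix_append hu with hu | ⟨w, rfl, hw⟩
        · refine .inl ((time_le_of_isInfix hu.isInfix).trans ?_)
          simpa using m₁
        · simp only [List.cons_append, outputs_step, outputs_append,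
            List.append_eq_nil_iff] at ho
          refine .inr ⟨ho.1, w, hw, ho.2, ?_⟩
          simp only [List.cons_append, time_cons, Event.time_step, time_append]
          omega
      refine ⟨_, _, Exec.loopStep ((hrun s).2 hrs) e₁ e₂, ?_, ?_, ?_, fun h => absurd hrs h, ?_, ?_⟩
      · rw [outputs_step, outputs_append, o₁, o₂, filterMap_range_succ]
        rfl
      · intro u hu ho
        rcases hpre u hu ho with h | ⟨h1, w, hw, hwo, h⟩
        · omega
        · rw [o₁, Option.toList_eq_nil_iff] at h1
          have := y₂ (fun hr' => hdelay s hrs hr' h1) w hw hwo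
          omega
      · intro h u hu ho
        rcases hpre u hu ho with h' | ⟨h1, w, hw, -, h2⟩
        · omega
        · rw [o₁, Option.toList_eq_nil_iff] at h1
          by_cases hr' : run (next s)
          · exact absurd h1 (h hrs hr')
          · have := z₂ hr'
            have := time_le_of_isInfix hw.isInfix
            omega
      · rw [← List.cons_append]
        exact DelayLE.append (a := b) (by simpa using m₁) x₂ d₂ (by omega)
      · simp only [space_cons, space_append, Event.space_step]
        omega
  obtain ⟨t₁, e₁, o₁, m₁, s₁⟩ := h₁.call i (τ := initStore (Q.input i)) rfl
    fun v hv _ => initStore_of_ne _ hv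
  rw [update_initStore] at e₁
  obtain ⟨t₂, e₂, o₂, m₂, s₂⟩ := exec_emit (dat (init i)) (em (init i)) (hem _) (hem' _)
  obtain ⟨t₃, σ', e₃, o₃, x₃, -, -, d₃, s₃⟩ := hloop (n i) (init i) (hinst₀ i) (hn i) (hend i)
  have hL0 : sz (dat (init i)) ≤ L := by
    have := hq (init i)
    rwa [hinst₀, ← hL] at this
  refine ⟨_, _, e₁.seq (e₂.seq e₃), ?_, ?_, ?_⟩
  · rw [outputs_append, outputs_append, o₁, o₂, o₃, filterMap_range_succ]
    rfl
  · rw [← List.append_assoc]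
    have : 4 * b = (4 * B).eval (Q.size i + T i) := by simp [hb]
    rw [← this]
    refine DelayLE.append (a := b) ?_ x₃ d₃ (by omega)
    simp only [time_append, ListingProblem.size, sz] at *
    omega
  · have h1 := s₁ V
    rw [hz _ _ h₁.pos] at h1
    have h2 := s₂ V
    have : 4 * b' = (4 * B).eval (Q.size i) := by simp [hb']
    rw [← this]
    simp only [space_append, ListingProblem.size, sz] at *
    omega

end Listing

namespace Listing

open Finset

/-! ### Greedy extension along a schedule -/

section Combinatorics

variable {α : Type*} [DecidableEq α]

open Classical in
/-- Run through the list `L` and add every element that `Q` admits. -/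
noncomputable def extend (Q : Finset α → α → Prop) (X : Finset α) (L : List α) : Finset α :=
  L.foldl (fun X u => if Q X u then insert u X else X) X

variable {Q : Finset α → α → Prop} {X : Finset α} {L : List α}

@[simp] lemma extend_nil : extend Q X [] = X := rfl

lemma extend_cons_of_pos {u : α} (h : Q X u) :
    extend Q X (u :: L) = extend Q (insert u X) L := by
  simp [extend, h]

lemma extend_cons_of_neg {u : α} (h : ¬ Q X u) : extend Q X (u :: L) = extend Q X L := by
  simp [extend, h]

lemma extend_append (L₁ L₂ : List α) :
    extend Q X (L₁ ++ L₂) = extend Q (extend Q X L₁) L₂ := by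
  simp [extend]

lemma extend_induction {P : Finset α → Prop} (h0 : P X)
    (h : ∀ Y u, u ∈ L → P Y → Q Y u → P (insert u Y)) : P (extend Q X L) := by
  induction L generalizing X with
  | nil => exact h0
  | cons u L ih =>
    by_cases hQ : Q X u
    · rw [extend_cons_of_pos hQ]
      exact ih (h X u (by simp) h0 hQ) fun Y v hv => h Y v (by simp [hv])
    · rw [extend_cons_of_neg hQ]
      exact ih h0 fun Y v hv => h Y v (by simp [hv])

lemma subset_extend : X ⊆ extend Q X L :=
  extend_induction (P := fun Y => X ⊆ Y) (Subset.refl _)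
    fun _ _ _ h _ => h.trans (subset_insert _ _)

/-- As long as nothing is added, the test `Q` is always made at the same set `X`; so an idle sweep
shows that nothing can be added at all. -/
lemma extend_eq_self_iff : extend Q X L = X ↔ ∀ u ∈ L, Q X u → u ∈ X := by
  induction L generalizing X with
  | nil => simp
  | cons u L ih =>
    by_cases hQ : Q X u
    · rw [extend_cons_of_pos hQ]
      by_cases hu : u ∈ X
      · rw [insert_eq_of_mem hu, ih]
        simp [hu]
      · refine iff_of_false (fun h => hu ?_) fun h => hu (h u (by simp) hQ)
        have := subset_extend (Q := Q) (X := insert u X) (L := L)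
        rw [h] at this
        exact this (mem_insert_self _ _)
    · rw [extend_cons_of_neg hQ, ih]
      simp [hQ]

/-- The list `U`, repeated `n` times. -/
def sweeps (U : List α) (n : ℕ) : List α := (List.replicate n U).flatten

omit [DecidableEq α] in
lemma mem_of_mem_sweeps {U : List α} {n : ℕ} {u : α} (h : u ∈ sweeps U n) : u ∈ U := by
  simp only [sweeps, List.mem_flatten, List.mem_replicate] at h
  obtain ⟨l, ⟨-, rfl⟩, hu⟩ := h
  exact hu

/-- After enough sweeps nothing more can be added. -/
lemma extend_sweeps_stuck {U : List α} (hX : X.Nonempty) (hXU : X ⊆ U.toFinset) :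
    ∀ u ∈ U, Q (extend Q X (sweeps U U.length)) u → u ∈ extend Q X (sweeps U U.length) := by
  -- A sweep that adds nothing makes all later sweeps idle; otherwise every sweep adds at least one
  -- element.
  have key : ∀ n (X : Finset α), X ⊆ U.toFinset →
      (∀ u ∈ U, Q (extend Q X (sweeps U n)) u → u ∈ extend Q X (sweeps U n)) ∨
        X.card + n ≤ (extend Q X (sweeps U n)).card := by
    intro n
    induction n with
    | zero => intro X _; right; simp [sweeps]
    | succ n ih =>
      intro X hX
      have hs : sweeps U (n + 1) = U ++ sweeps U n := by simp [sweeps, List.replicate_succ]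
      have hsub : extend Q X U ⊆ U.toFinset := extend_induction (P := fun Y => Y ⊆ U.toFinset) hX
        fun Y u hu hY _ => insert_subset (by simpa using hu) hY
      rw [hs, extend_append]
      by_cases h : extend Q X U = X
      · left
        rw [extend_eq_self_iff] at h
        have : extend Q X (sweeps U n) = X :=
          extend_eq_self_iff.2 fun u hu => h u (mem_of_mem_sweeps hu)
        rw [extend_eq_self_iff.2 h, this]
        exact h
      · rcases ih _ hsub with h' | h'
        · exact .inl h'
        · right
          have : X.card < (extend Q X U).card :=
            card_lt_card (subset_extend.ssubset_of_ne (Ne.symm h))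
          omega
  rcases key U.length X hXU with h | h
  · exact h
  · have h1 : (extend Q X (sweeps U U.length)) ⊆ U.toFinset :=
      extend_induction (P := fun Y => Y ⊆ U.toFinset) hXU
        fun Y u hu hY _ => insert_subset (by simpa using mem_of_mem_sweeps hu) hY
    have h2 := (card_le_card h1).trans (List.toFinset_card_le U)
    -- With `X` nonempty, `|U|` productive sweeps would exceed the size of `U`; for empty `X` this
    -- count would not close.
    have := hX.card_pos
    omega

/-- The steps of the canonical construction of `Y`. -/
noncomputable def greedy (F : Set (Finset α)) (Y X : Finset α) (L : List α) : Finset α :=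
  extend (fun X u => u ∈ Y ∧ insert u X ∈ F) X L

/-- The canonical extension of the solution `E`. -/
noncomputable def complete (F : Set (Finset α)) (E X : Finset α) (L : List α) : Finset α :=
  extend (fun X u => insert u X ∈ F ∧ insert u (X ∪ E) ∈ F) X L

open Classical in
/-- The steps at which `greedy` accepts, as a binary number. -/
noncomputable def val (F : Set (Finset α)) (Y : Finset α) : Finset α → List α → ℕ
  | _, [] => 0
  | X, u :: L => if u ∈ Y ∧ insert u X ∈ F then 2 ^ L.length + val F Y (insert u X) L
      else val F Y X L

variable {F : Set (Finset α)} {Y Y' E R S : Finset α}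

lemma val_lt : val F Y X L < 2 ^ L.length := by
  induction L generalizing X with
  | nil => simp [val]
  | cons u L ih =>
    rw [val, List.length_cons, pow_succ]
    have h1 := @ih X
    have h2 := @ih (insert u X)
    split_ifs <;> omega

/-- The leading digit outweighs all later ones, so equal values force the same decision at each
step, and both walks stay at the same set. -/
lemma greedy_eq_of_val_eq (h : val F Y X L = val F Y' X L) :
    greedy F Y X L = greedy F Y' X L := by
  induction L generalizing X with
  | nil => rfl
  | cons u L ih =>
    have h1 := fun X => val_lt (F := F) (Y := Y) (X := X) (L := L)
    have h2 := fun X => val_lt (F := F) (Y := Y') (X := X) (L := L)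
    have h3 := h1 X
    have h4 := h2 X
    rw [val, val] at h
    unfold greedy
    by_cases hu : u ∈ Y ∧ insert u X ∈ F <;> by_cases hu' : u ∈ Y' ∧ insert u X ∈ F
    · rw [extend_cons_of_pos hu, extend_cons_of_pos hu']
      rw [if_pos hu, if_pos hu'] at h
      exact ih (by omega)
    · rw [if_pos hu, if_neg hu'] at h
      omega
    · rw [if_neg hu, if_pos hu'] at h
      omega
    · rw [extend_cons_of_neg hu, extend_cons_of_neg hu']
      rw [if_neg hu, if_neg hu'] at h
      exact ih h

/-- If `R` contains the first steps of `S` and is not better than `S`, then it starts with the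
same steps. -/
lemma greedy_eq_of_val_le {L₁ L₂ : List α} (h : val F R X (L₁ ++ L₂) ≤ val F S X (L₁ ++ L₂))
    (hsub : greedy F S X L₁ ⊆ R) : greedy F R X L₁ = greedy F S X L₁ := by
  induction L₁ generalizing X with
  | nil => rfl
  | cons u L ih =>
    have h2 := val_lt (F := F) (Y := S) (X := X) (L := L ++ L₂)
    rw [List.cons_append, val, val] at h
    unfold greedy at hsub ⊢
    by_cases hu : u ∈ S ∧ insert u X ∈ F
    · rw [extend_cons_of_pos hu] at hsub
      have hu' : u ∈ R ∧ insert u X ∈ F :=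
        ⟨hsub (subset_extend (mem_insert_self _ _)), hu.2⟩
      rw [extend_cons_of_pos hu', extend_cons_of_pos hu]
      rw [if_pos hu, if_pos hu'] at h
      exact ih (by omega) hsub
    · rw [extend_cons_of_neg hu] at hsub
      by_cases hu' : u ∈ R ∧ insert u X ∈ F
      -- Here `R` would accept where `S` rejects and win by the leading digit.
      · rw [if_neg hu, if_pos hu'] at h
        omega
      · rw [extend_cons_of_neg hu', extend_cons_of_neg hu]
        rw [if_neg hu, if_neg hu'] at h
        exact ih h hsub

/-! ### Consequences of commutability: exchange, unions, optimality of the completion -/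

section Commutable

variable {U : Finset α} (hc : IsCommutable U F)
include hc

/-- Strong accessibility leads from `X` to `A` one element at a time, and commutability carries the
possible addition `b` along each step. `X` must be nonempty, as commutability says nothing about
additions to `∅`. -/
lemma IsCommutable.insert_mem {A : Finset α} {b : α} (hX : X ∈ F) (hX0 : X.Nonempty) (hA : A ∈ F)
    (hXA : X ⊆ A) (hY : Y ∈ F) (hYU : Y ⊆ U) (hAY : A ⊆ Y) (hb : b ∈ Y) (hbX : insert b X ∈ F) :
    insert b A ∈ F := by
  induction hn : (A \ X).card using Nat.strong_induction_on generalizing X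
  rename_i n ih
  by_cases hbA : b ∈ A
  · rwa [insert_eq_of_mem hbA]
  by_cases hXA' : X = A
  · rwa [← hXA']
  obtain ⟨z, hz, hzX⟩ := hc.stronglyAccessible X hX A hA (hAY.trans hYU) (hXA.ssubset_of_ne hXA')
  rw [mem_sdiff] at hz
  have hbX' : b ∉ X := fun h => hbA (hXA h)
  have h := hc.commutable X hX Y hY hYU hX0
    ((hXA.trans hAY).ssubset_of_ne fun h => hbX' (h ▸ hb)) b (mem_sdiff.2 ⟨hb, hbX'⟩) z
    (mem_sdiff.2 ⟨hAY hz.1, hz.2⟩) hbX hzX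
  have hlt : (A \ insert z X).card < (A \ X).card := card_lt_card <|
    (sdiff_subset_sdiff (Subset.refl _) (subset_insert _ _)).ssubset_of_ne fun he => by
      have : z ∈ A \ X := mem_sdiff.2 hz
      rw [← he] at this
      simp at this
  exact ih _ (hn ▸ hlt) hzX (insert_nonempty _ _) (insert_subset hz.1 hXA) h rfl

/-- The elements of `B` are added to `A` in an order in which they can be added to `X`; each
addition to `A` is legitimate by `insert_mem`, and `X` and `A` grow together. -/
lemma IsCommutable.union_mem {A B : Finset α} (hX : X ∈ F) (hX0 : X.Nonempty) (hA : A ∈ F)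
    (hB : B ∈ F) (hXA : X ⊆ A) (hXB : X ⊆ B) (hY : Y ∈ F) (hYU : Y ⊆ U) (hAY : A ⊆ Y)
    (hBY : B ⊆ Y) : A ∪ B ∈ F := by
  induction hn : (B \ X).card using Nat.strong_induction_on generalizing X A
  rename_i n ih
  by_cases hXB' : X = B
  · rwa [← hXB', union_eq_left.2 hXA]
  obtain ⟨z, hz, hzX⟩ := hc.stronglyAccessible X hX B hB (hBY.trans hYU) (hXB.ssubset_of_ne hXB')
  rw [mem_sdiff] at hz
  have hzA : insert z A ∈ F := hc.insert_mem hX hX0 hA hXA hY hYU hAY (hBY hz.1) hzX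
  have hlt : (B \ insert z X).card < (B \ X).card := card_lt_card <|
    (sdiff_subset_sdiff (Subset.refl _) (subset_insert _ _)).ssubset_of_ne fun he => by
      have : z ∈ B \ X := mem_sdiff.2 hz
      rw [← he] at this
      simp at this
  have := ih _ (hn ▸ hlt) hzX (insert_nonempty _ _) hzA (insert_subset_insert _ hXA)
    (insert_subset hz.1 hXB) (insert_subset (hBY hz.1) hAY) rfl
  rwa [insert_union, insert_eq_of_mem (mem_union_right _ hz.1)] at this

omit hc in
/-- The conditions on a state `X` in the canonical extension of `E`. -/
lemma complete_spec (hLU : ∀ u ∈ L, u ∈ U) (hX : X ∈ F)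
    (hXU : X ⊆ U) (hXE : X ∪ E ∈ F) :
    complete F E X L ∈ F ∧ complete F E X L ⊆ U ∧ complete F E X L ∪ E ∈ F :=
  extend_induction (P := fun Z => Z ∈ F ∧ Z ⊆ U ∧ Z ∪ E ∈ F) ⟨hX, hXU, hXE⟩
    fun Z u hu hZ hQ => ⟨hQ.1, insert_subset (hLU u hu) hZ.2.1, by
      rw [insert_union]; exact hQ.2⟩

/-- The canonical extension of `E` is the best solution that contains `E`. -/
lemma IsCommutable.val_le_complete (hLU : ∀ u ∈ L, u ∈ U) (hEU : E ⊆ U) (hX : X ∈ F)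
    (hX0 : X.Nonempty) (hXU : X ⊆ U) (hXE : X ∪ E ∈ F) (hY : Y ∈ F) (hYU : Y ⊆ U)
    (hXEY : X ∪ E ⊆ Y) : val F Y X L ≤ val F (complete F E X L) X L := by
  induction L generalizing X with
  | nil => simp [val]
  | cons u L ih =>
    have hLU' : ∀ v ∈ L, v ∈ U := fun v hv => hLU v (by simp [hv])
    obtain ⟨hC, hCU, hCE⟩ := complete_spec hLU hX hXU hXE
    have hXC : X ⊆ complete F E X (u :: L) := subset_extend
    -- A competitor that contains `E` and accepts `u` at `X` certifies, by `insert_mem` from `X` to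
    -- `X ∪ E`, that the completion may accept `u` as well.
    have key : ∀ Z, Z ∈ F → Z ⊆ U → X ∪ E ⊆ Z → u ∈ Z → insert u X ∈ F →
        insert u (X ∪ E) ∈ F := fun Z hZ hZU hXEZ huZ h =>
      hc.insert_mem hX hX0 hXE subset_union_left hZ hZU hXEZ huZ h
    by_cases hu : insert u X ∈ F ∧ insert u (X ∪ E) ∈ F
    · have heq : complete F E X (u :: L) = complete F E (insert u X) L := extend_cons_of_pos hu
      have huC : u ∈ complete F E (insert u X) L := subset_extend (mem_insert_self _ _)
      rw [heq, val, val, if_pos (c := u ∈ complete F E (insert u X) L ∧ _) ⟨huC, hu.1⟩]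
      split_ifs with hY'
      · refine Nat.add_le_add_left (ih hLU' hu.1 (insert_nonempty _ _) ?_ ?_ ?_) _
        · exact insert_subset (hLU u (by simp)) hXU
        · rw [insert_union]; exact hu.2
        · rw [insert_union]; exact insert_subset hY'.1 hXEY
      · have := val_lt (F := F) (Y := Y) (X := X) (L := L)
        omega
    · have heq : complete F E X (u :: L) = complete F E X L := extend_cons_of_neg hu
      have hYn : ¬ (u ∈ Y ∧ insert u X ∈ F) := fun h =>
        hu ⟨h.2, key Y hY hYU hXEY h.1 h.2⟩
      -- The completion may acquire `u` in a later step, so its `val` needs the same argument; the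
      -- common superset is the solution `complete ∪ E`.
      have hCn : ¬ (u ∈ complete F E X L ∧ insert u X ∈ F) := fun h =>
        hu ⟨h.2, key _ hCE (union_subset hCU hEU) (union_subset_union (by rw [heq]; exact subset_extend)
          (Subset.refl _)) (by rw [heq]; exact mem_union_left _ h.1) h.2⟩
      rw [heq, val, val, if_neg hYn, if_neg hCn]
      exact ih hLU' hX hX0 hXU hXE hXEY

end Commutable

/-! ### The canonical order and the parent of a maximal solution -/

section Parent

variable {U : List α} (hc : IsCommutable U.toFinset F)

/-- The solutions with a given starting point. -/
structure SolutionFrom (U : List α) (F : Set (Finset α)) (s : α) (Y : Finset α) : Prop where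
  singleton_mem : {s} ∈ F
  start_mem : s ∈ Y
  mem : Y ∈ F
  subset : Y ⊆ U.toFinset

/-- The schedule: as many sweeps as there are elements. -/
def schedule (U : List α) : List α := sweeps U U.length

lemma mem_schedule {u : α} (h : u ∈ schedule U) : u ∈ U.toFinset := by
  simpa using mem_of_mem_sweeps h

include hc

/-- If the walk ended strictly below `Y`, strong accessibility would provide another element of `Y`
to accept, although the sweeps have come to a standstill. -/
lemma SolutionFrom.greedy_eq {s : α} (h : SolutionFrom U F s Y) :
    greedy F Y {s} (schedule U) = Y := by
  obtain ⟨h1, h2, h3⟩ : greedy F Y {s} (schedule U) ∈ F ∧ greedy F Y {s} (schedule U) ⊆ Y ∧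
      {s} ⊆ greedy F Y {s} (schedule U) :=
    ⟨(extend_induction (P := fun Z => Z ∈ F ∧ Z ⊆ Y) ⟨h.singleton_mem, by simpa using h.start_mem⟩
      fun Z u _ hZ hQ => ⟨hQ.2, insert_subset hQ.1 hZ.2⟩).1,
    (extend_induction (P := fun Z => Z ⊆ Y) (by simpa using h.start_mem)
      fun Z u _ hZ hQ => insert_subset hQ.1 hZ), subset_extend⟩
  by_contra hne
  obtain ⟨z, hz, hzF⟩ := hc.stronglyAccessible _ h1 Y h.mem h.subset (h2.ssubset_of_ne hne)
  rw [mem_sdiff] at hz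
  refine hz.2 (extend_sweeps_stuck (singleton_nonempty s) ?_ z ?_ ⟨hz.1, hzF⟩)
  · simpa using h.subset h.start_mem
  · simpa using h.subset hz.1

/-- `val` determines the walk and the walk recovers the solution, so `val` is a linear order on the
solutions with starting point `s`. -/
lemma SolutionFrom.eq_of_val_eq {s : α} (h : SolutionFrom U F s Y) (h' : SolutionFrom U F s Y')
    (hv : val F Y {s} (schedule U) = val F Y' {s} (schedule U)) : Y = Y' := by
  rw [← h.greedy_eq hc, ← h'.greedy_eq hc, greedy_eq_of_val_eq hv]

omit hc in
lemma SolutionFrom.greedy {s : α} (h : SolutionFrom U F s Y) {L : List α} :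
    SolutionFrom U F s (greedy F Y {s} L) ∧ Listing.greedy F Y {s} L ⊆ Y := by
  obtain ⟨h1, h2⟩ : Listing.greedy F Y {s} L ∈ F ∧ Listing.greedy F Y {s} L ⊆ Y :=
    extend_induction (P := fun Z => Z ∈ F ∧ Z ⊆ Y) ⟨h.singleton_mem, by simpa using h.start_mem⟩
      fun Z u _ hZ hQ => ⟨hQ.2, insert_subset hQ.1 hZ.2⟩
  exact ⟨⟨h.singleton_mem, subset_extend (mem_singleton_self s), h1, h2.trans h.subset⟩, h2⟩

lemma SolutionFrom.val_le {s : α} (hE : SolutionFrom U F s E) (hY : SolutionFrom U F s Y)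
    (hEY : E ⊆ Y) :
    val F Y {s} (schedule U) ≤ val F (complete F E {s} (schedule U)) {s} (schedule U) := by
  have hsE : {s} ∪ E = E := union_eq_right.2 (by simpa using hE.start_mem)
  refine hc.val_le_complete (fun u hu => mem_schedule hu) hE.subset hE.singleton_mem
    (singleton_nonempty s) ?_ (by rw [hsE]; exact hE.mem) hY.mem hY.subset
    (by rw [hsE]; exact hEY)
  simpa using hE.subset hE.start_mem

/-- The canonical extension of `E` is a maximal solution that contains `E`. -/
lemma SolutionFrom.complete {s : α} (hE : SolutionFrom U F s E) :
    E ⊆ complete F E {s} (schedule U) ∧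
      complete F E {s} (schedule U) ∈ maximalSolutions U.toFinset F := by
  have hsU : {s} ⊆ U.toFinset := by simpa using hE.subset hE.start_mem
  obtain ⟨h1, h2, h3⟩ := complete_spec (L := schedule U) (fun u hu => mem_schedule hu)
    hE.singleton_mem hsU (by
      rw [union_eq_right.2 (by simpa using hE.start_mem)]; exact hE.mem)
  have stuck := extend_sweeps_stuck (Q := fun X u => insert u X ∈ F ∧ insert u (X ∪ E) ∈ F)
    (singleton_nonempty s) hsU
  change ∀ u ∈ U, insert u (Listing.complete F E {s} (schedule U)) ∈ F ∧ insert u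
    (Listing.complete F E {s} (schedule U) ∪ E) ∈ F → u ∈ Listing.complete F E {s} (schedule U)
    at stuck
  set C := Listing.complete F E {s} (schedule U)
  have hEC : E ⊆ C := by
    by_contra hne
    have hlt : C ⊂ C ∪ E := by
      refine subset_union_left.ssubset_of_ne fun h => hne ?_
      rw [h]; exact subset_union_right
    -- An element `z` of `E` that can be added to `C` passes both tests, since `C ∪ E` already
    -- contains it.
    obtain ⟨z, hz, hzF⟩ := hc.stronglyAccessible C h1 _ h3 (union_subset h2 hE.subset) hlt
    rw [mem_sdiff] at hz
    refine hz.2 (stuck z ?_ ⟨hzF, ?_⟩)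
    · simpa using union_subset h2 hE.subset hz.1
    · rwa [insert_eq_of_mem hz.1]
  -- Now `C ∪ E = C`, so the two tests coincide and every possible addition would have been made.
  refine ⟨hEC, ⟨h1, h2⟩, fun Y hY hCY => ?_⟩
  by_contra hne
  obtain ⟨z, hz, hzF⟩ := hc.stronglyAccessible C h1 Y hY.1 hY.2
    (hCY.ssubset_of_ne fun h => hne (h ▸ Subset.refl _))
  rw [mem_sdiff] at hz
  refine hz.2 (stuck z ?_ ⟨hzF, ?_⟩)
  · simpa using hY.2 hz.1
  · rwa [union_eq_left.2 hEC]

lemma SolutionFrom.complete_eq {s : α} (hS : SolutionFrom U F s S)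
    (hmax : S ∈ maximalSolutions U.toFinset F) : Listing.complete F S {s} (schedule U) = S := by
  obtain ⟨h1, h2⟩ := hS.complete hc
  exact ((show Maximal (fun Y => Y ∈ F ∧ Y ⊆ U.toFinset) S from hmax).eq_of_le h2.1 h1).symm

end Parent

end Combinatorics

end Listing

namespace Listing

open Finset

/-! ### Parents, their rank, and how children arise from restricted problems -/

section Tree

variable {α : Type*} [DecidableEq α] [Inhabited α] {U : List α} {F : Set (Finset α)}
  {S P R E : Finset α}

open Classical in
/-- The canonical starting point of a solution. -/
noncomputable def seed (U : List α) (F : Set (Finset α)) (S : Finset α) : α :=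
  (U.filter fun u => u ∈ S ∧ {u} ∈ F).headI

omit [Inhabited α] in
/-- The canonical maximal solution that contains `E`, with respect to the starting point `s`. -/
noncomputable def canon (U : List α) (F : Set (Finset α)) (s : α) (E : Finset α) : Finset α :=
  complete F E {s} (schedule U)

omit [Inhabited α] in
/-- The stages of the canonical construction of `S` from the starting point `s`. -/
noncomputable def stages (U : List α) (F : Set (Finset α)) (s : α) (S : Finset α) :
    List (Finset α) :=
  (List.range ((schedule U).length + 1)).map fun k => greedy F S {s} ((schedule U).take k)

open Classical in
/-- The parent of a maximal solution: the extension of its last stage that is not completed to the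
solution itself, or `∅` if there is none. -/
noncomputable def parent (U : List α) (F : Set (Finset α)) (S : Finset α) : Finset α :=
  (stages U F (seed U F S) S).foldl
    (fun P D => if canon U F (seed U F S) D ≠ S then canon U F (seed U F S) D else P) ∅

/-- The nonempty maximal solutions. -/
def IsNode (U : List α) (F : Set (Finset α)) (S : Finset α) : Prop :=
  S ∈ maximalSolutions U.toFinset F ∧ S.Nonempty

omit [Inhabited α] [DecidableEq α] in
-- The accumulator is overwritten by each entry different from `S`, so the last such entry survives.
-- This makes the fold in `parent` readable as a choice of a last stage.
lemma foldl_range_last {β : Type*} (f : ℕ → β) (S P₀ : β) [DecidableEq β] (n : ℕ) :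
    ((∀ k < n, f k = S) ∧
      (List.range n).foldl (fun P k => if f k ≠ S then f k else P) P₀ = P₀) ∨
    ∃ k < n, f k ≠ S ∧ (∀ k' < n, k < k' → f k' = S) ∧
      (List.range n).foldl (fun P k => if f k ≠ S then f k else P) P₀ = f k := by
  induction n with
  | zero => simp
  | succ n ih =>
    rw [List.range_succ, List.foldl_append, List.foldl_cons, List.foldl_nil]
    by_cases h : f n = S
    · rcases ih with ⟨h1, h2⟩ | ⟨k, hk, h1, h2, h3⟩
      · refine .inl ⟨fun k hk => ?_, by
        rw [if_neg (not_not.2 h)]; exact h2⟩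
        rcases Nat.lt_succ_iff_lt_or_eq.1 hk with hk | rfl
        · exact h1 k hk
        · exact h
      · refine .inr ⟨k, by omega, h1, fun k' hk' hkk' => ?_, by
        rw [if_neg (not_not.2 h)]; exact h3⟩
        rcases Nat.lt_succ_iff_lt_or_eq.1 hk' with hk' | rfl
        · exact h2 k' hk' hkk'
        · exact h
    · exact .inr ⟨n, by omega, h, fun k' hk' _ => by omega, by simp [h]⟩

omit [DecidableEq α] in
lemma headI_filter_mem {p : α → Prop} [DecidablePred p] {L : List α} {s : α} (hs : s ∈ L)
    (hp : p s) : (L.filter fun u => p u).headI ∈ L ∧ p (L.filter fun u => p u).headI := by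
  have hmem : s ∈ L.filter fun u => p u := List.mem_filter.2 ⟨hs, by simpa using hp⟩
  have key : ∀ l : List α, s ∈ l → l.headI ∈ l := fun l hl => by cases l <;> simp at hl ⊢
  simpa using List.mem_filter.1 (key _ hmem)

lemma idxOf_headI_filter_le {p : α → Prop} [DecidablePred p] {L : List α} {s : α} (hs : s ∈ L)
    (hp : p s) : L.idxOf (L.filter fun u => p u).headI ≤ L.idxOf s := by
  induction L with
  | nil => simp at hs
  | cons a L ih =>
    by_cases ha : p a
    · simp [ha]
    · have hsa : s ≠ a := fun h => ha (h ▸ hp)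
      have hs' : s ∈ L := by simpa [hsa] using hs
      have h := (headI_filter_mem hs' hp).2
      have hsa' : (L.filter fun u => p u).headI ≠ a := fun h' => ha (h' ▸ h)
      rw [List.filter_cons_of_neg (by simpa using ha), List.idxOf_cons_ne _ hsa.symm,
        List.idxOf_cons_ne _ hsa'.symm]
      exact Nat.succ_le_succ (ih hs')

/-- The seed is the first possible starting point in `U`. Applied to a parent, which contains the
seed of its child, it shows that seeds never move to later positions. -/
lemma idxOf_seed_le (hS : S ⊆ U.toFinset) {s : α} (hs : s ∈ S) (hsF : {s} ∈ F) :
    U.idxOf (seed U F S) ≤ U.idxOf s := by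
  classical
  exact idxOf_headI_filter_le (p := fun u => u ∈ S ∧ {u} ∈ F) (by simpa using hS hs) ⟨hs, hsF⟩

variable (hc : IsCommutable U.toFinset F)
include hc

/-- Strong accessibility between `∅` and `S` provides a singleton solution inside `S`, so the
default value of `headI` is never used. -/
lemma IsCommutable.seed_spec (hS : S ∈ F) (hSU : S ⊆ U.toFinset) (h0 : S.Nonempty) :
    SolutionFrom U F (seed U F S) S := by
  classical
  obtain ⟨z, hz, hzF⟩ := hc.stronglyAccessible ∅ hc.empty_mem S hS hSU
    (empty_ssubset.2 h0)
  have hz : z ∈ S := (mem_sdiff.1 hz).1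
  have hzF : {z} ∈ F := by simpa using hzF
  obtain ⟨-, h1, h2⟩ := headI_filter_mem (p := fun u => u ∈ S ∧ {u} ∈ F) (L := U)
    (by simpa using hSU hz) ⟨hz, hzF⟩
  exact ⟨h2, h1, hS, hSU⟩

lemma IsNode.seed_spec (hS : IsNode U F S) : SolutionFrom U F (seed U F S) S :=
  hc.seed_spec hS.1.1.1 hS.1.1.2 hS.2

omit [Inhabited α] in
lemma SolutionFrom.isNode_canon {s : α} (h : SolutionFrom U F s E) :
    IsNode U F (canon U F s E) ∧ E ⊆ canon U F s E :=
  ⟨⟨(h.complete hc).2, ⟨s, (h.complete hc).1 h.start_mem⟩⟩, (h.complete hc).1⟩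

omit [Inhabited α] in
lemma SolutionFrom.canon_eq {s : α} (hS : SolutionFrom U F s S) (hmax : IsNode U F S) :
    canon U F s S = S :=
  hS.complete_eq hc hmax.1

omit [Inhabited α] in
lemma SolutionFrom.canon {s : α} (h : SolutionFrom U F s E) :
    SolutionFrom U F s (Listing.canon U F s E) := by
  obtain ⟨h1, h2⟩ := h.isNode_canon hc
  exact ⟨h.singleton_mem, h2 h.start_mem, h1.1.1.1, h1.1.1.2⟩

/-- Either a maximal solution is a root, or there is a last stage `D` that is not completed to the
solution itself. -/
lemma IsNode.parent_spec (hS : IsNode U F S) :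
    (parent U F S = ∅ ∧ canon U F (seed U F S) {seed U F S} = S) ∨
    ∃ L₁ u L₂, schedule U = L₁ ++ u :: L₂ ∧
      canon U F (seed U F S) (greedy F S {seed U F S} L₁) = parent U F S ∧
      parent U F S ≠ S ∧ canon U F (seed U F S) (greedy F S {seed U F S} (L₁ ++ [u])) = S := by
  classical
  set s := seed U F S with hs
  have hSs : SolutionFrom U F s S := hS.seed_spec hc
  set L := schedule U
  have hpar : parent U F S = (List.range (L.length + 1)).foldl (fun P k =>
      if canon U F s (greedy F S {s} (L.take k)) ≠ S then canon U F s (greedy F S {s} (L.take k))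
      else P) ∅ := by
    rw [parent, stages, List.foldl_map]
  -- The final stage is `S` itself and is completed to `S`; hence the last exceptional stage has a
  -- successor.
  have hfull : canon U F s (greedy F S {s} (L.take L.length)) = S := by
    rw [List.take_length, hSs.greedy_eq hc, hSs.canon_eq hc hS]
  rcases foldl_range_last (fun k => canon U F s (greedy F S {s} (L.take k))) S ∅ (L.length + 1)
    with ⟨h1, h2⟩ | ⟨k, hk, h1, h2, h3⟩
  · left
    refine ⟨by rw [hpar, h2], ?_⟩
    have := h1 0 (by omega)
    simpa [greedy] using this
  · right
    have hkL : k < L.length := by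
      rcases Nat.lt_succ_iff_lt_or_eq.1 hk with hk | rfl
      · exact hk
      · exact absurd hfull h1
    refine ⟨L.take k, L[k], L.drop (k + 1), ?_, ?_, ?_, ?_⟩
    · rw [← List.drop_eq_getElem_cons hkL, List.take_append_drop]
    · rw [hpar, h3]
    · rw [hpar, h3]; exact h1
    · have := h2 (k + 1) (by omega) (by omega)
      rwa [List.take_add_one, List.getElem?_eq_getElem hkL] at this

lemma IsNode.parent_eq_empty_or (hS : IsNode U F S) :
    parent U F S = ∅ ∨ IsNode U F (parent U F S) := by
  rcases hS.parent_spec hc with ⟨h, -⟩ | ⟨L₁, u, L₂, -, h, -, -⟩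
  · exact .inl h
  · right
    rw [← h]
    exact ((hS.seed_spec hc).greedy.1.isNode_canon hc).1

/-- A measure that decreases from a maximal solution to its parent. -/
noncomputable def nodeRank (U : List α) (F : Set (Finset α)) (S : Finset α) : ℕ :=
  U.idxOf (seed U F S) * 2 ^ (schedule U).length +
    (2 ^ (schedule U).length - val F S {seed U F S} (schedule U))

/-- The parent `P` is the best solution above a stage of `S`, so `val` strictly increases from `S`
to `P` for the seed of `S`. If `P` has that same seed, the second summand of the rank drops; if its
seed is earlier, the factor `2 ^ (schedule U).length` outweighs any change of `val`. -/
lemma IsNode.nodeRank_parent_lt (hS : IsNode U F S) (hP : parent U F S ≠ ∅) :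
    nodeRank U F (parent U F S) < nodeRank U F S := by
  rcases hS.parent_spec hc with ⟨h, -⟩ | ⟨L₁, u, L₂, -, h, hne, -⟩
  · exact absurd h hP
  set s := seed U F S with hs
  have hSs : SolutionFrom U F s S := hS.seed_spec hc
  obtain ⟨hD, hDS⟩ := hSs.greedy (L := L₁)
  have hPs : SolutionFrom U F s (parent U F S) := h ▸ hD.canon hc
  have hle : val F S {s} (schedule U) ≤ val F (parent U F S) {s} (schedule U) := by
    rw [← h]; exact hD.val_le hc hSs hDS
  have hlt := hle.lt_of_ne fun h => hne (hPs.eq_of_val_eq hc hSs h.symm)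
  have hseed := idxOf_seed_le hPs.subset hPs.start_mem hPs.singleton_mem
  have hb := val_lt (F := F) (Y := parent U F S) (X := {s}) (L := schedule U)
  have hb' := val_lt (F := F) (Y := parent U F S) (X := {seed U F (parent U F S)})
    (L := schedule U)
  have hb'' := val_lt (F := F) (Y := S) (X := {s}) (L := schedule U)
  rcases hseed.lt_or_eq with hi | hi
  · rw [nodeRank, nodeRank, ← hs]
    have : (U.idxOf (seed U F (parent U F S)) + 1) * 2 ^ (schedule U).length ≤
        U.idxOf s * 2 ^ (schedule U).length := Nat.mul_le_mul_right _ hi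
    rw [add_mul, one_mul] at this
    omega
  · have : seed U F (parent U F S) = s := by
      refine (List.idxOf_inj ?_).1 hi
      have hPn := (hD.isNode_canon hc).1
      rw [h] at hPn
      simpa using hPn.1.1.2 (hPn.seed_spec hc).start_mem
    rw [nodeRank, nodeRank, ← hs, this]
    omega

/-- Every maximal solution can be found from a solution of a reduced set system of its parent. -/
lemma IsNode.exists_restricted (hS : IsNode U F S) (hP : parent U F S ≠ ∅) :
    ∃ w ∈ U, w ∉ parent U F S ∧ ∃ R ∈ maximalSolutions (insert w (parent U F S)) F,
      R ≠ parent U F S ∧ ∃ s ∈ R, {s} ∈ F ∧ ∃ D ∈ stages U F s R, canon U F s D = S := by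
  rcases hS.parent_spec hc with ⟨h, -⟩ | ⟨L₁, u, L₂, hL, h, hne, hS'⟩
  · exact absurd h hP
  set s := seed U F S with hs
  set P := parent U F S with hPdef
  have hSs : SolutionFrom U F s S := hS.seed_spec hc
  obtain ⟨hD, hDS⟩ := hSs.greedy (L := L₁)
  have hPs : SolutionFrom U F s P := h ▸ hD.canon hc
  obtain ⟨hD', hDS'⟩ := hSs.greedy (L := L₁ ++ [u])
  -- A rejected `u` would leave the stage unchanged, and its completion would still be `P`.
  have hacc : u ∈ S ∧ insert u (greedy F S {s} L₁) ∈ F := by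
    by_contra hn
    have : greedy F S {s} (L₁ ++ [u]) = greedy F S {s} L₁ := by
      rw [greedy, greedy, extend_append]
      exact extend_cons_of_neg hn
    rw [this, h] at hS'
    exact hne hS'
  have hDu : greedy F S {s} (L₁ ++ [u]) = insert u (greedy F S {s} L₁) := by
    rw [greedy, extend_append]
    exact extend_cons_of_pos hacc
  have hDP : greedy F S {s} L₁ ⊆ P := by rw [← h]; exact (hD.isNode_canon hc).2
  -- If `u ∈ P`, then `P` contains the stage `D ∪ {u}`, whose best extension is `S`; and `S`
  -- contains `D`, whose best extension is `P`. So both have the same `val` and coincide.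
  have huP : u ∉ P := by
    intro huP
    have h1 := hD'.val_le hc hPs (by rw [hDu]; exact insert_subset huP hDP)
    have h2 := hD.val_le hc hSs hDS
    change _ ≤ val F (canon U F s _) _ _ at h1 h2
    rw [hS'] at h1
    rw [h] at h2
    exact hne (hPs.eq_of_val_eq hc hSs (le_antisymm h1 h2))
  have huU : u ∈ U := by simpa using hS.1.1.2 hacc.1
  refine ⟨u, huU, huP, ?_⟩
  have hfin : {Y | Y ∈ F ∧ Y ⊆ insert u P}.Finite :=
    ((insert u P).powerset.finite_toSet).subset fun Y hY => mem_coe.2 (mem_powerset.2 hY.2)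
  -- The stage after `D` lies in `P ∪ {u}`; any maximal solution of the reduced system above it will
  -- do.
  obtain ⟨R, hDR, hR⟩ := hfin.exists_le_maximal
    (a := greedy F S {s} (L₁ ++ [u])) ⟨hD'.mem, by rw [hDu]; exact insert_subset_insert _ hDP⟩
  have hRU : R ⊆ U.toFinset := hR.1.2.trans (insert_subset (by simpa using huU) hPs.subset)
  have hRs : SolutionFrom U F s R := ⟨hSs.singleton_mem, hDR hD'.start_mem, hR.1.1, hRU⟩
  refine ⟨R, hR, ?_, s, hRs.start_mem, hRs.singleton_mem, _,
    List.mem_map.2 ⟨(L₁ ++ [u]).length, ?_, rfl⟩, ?_⟩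
  · rintro rfl
    exact huP (hDR (by rw [hDu]; exact mem_insert_self _ _))
  · rw [List.mem_range, hL]
    simp
  · have hL' : schedule U = (L₁ ++ [u]) ++ L₂ := by simp [hL]
    -- `S` is the best solution above this stage, so `R` is not better; as `R` contains the stage,
    -- its own walk passes through it.
    have hval := hD'.val_le hc hRs hDR
    change _ ≤ val F (canon U F s _) _ _ at hval
    rw [hS', hL'] at hval
    rw [hL', List.take_left, greedy_eq_of_val_le hval hDR, hS']

/-- The reduced set systems do not have many more solutions than the set system itself. -/
lemma IsCommutable.ncard_restricted_le (hP : P ⊆ U.toFinset) {w : α} (hw : w ∈ U) :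
    {R | R ∈ maximalSolutions (insert w P) F ∧ R ≠ P ∧ R.Nonempty}.ncard ≤
      U.length * (maximalSolutions U.toFinset F).ncard := by
  have hsub : insert w P ⊆ U.toFinset := insert_subset (by simpa using hw) hP
  have hfin : (maximalSolutions U.toFinset F).Finite :=
    (U.toFinset.powerset.finite_toSet).subset fun Y hY => mem_coe.2 (mem_powerset.2 hY.1.2)
  have hspec : ∀ R, R ∈ maximalSolutions (insert w P) F → R.Nonempty →
      SolutionFrom U F (seed U F R) R := fun R hR h0 =>
    hc.seed_spec hR.1.1 (hR.1.2.trans hsub) h0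
  have key : {R | R ∈ maximalSolutions (insert w P) F ∧ R ≠ P ∧ R.Nonempty}.ncard ≤
      ((U.toFinset : Set α) ×ˢ maximalSolutions U.toFinset F).ncard := by
    -- Injectivity: two solutions with the same seed lie in a common completion, so their union is a
    -- solution inside `P ∪ {w}`, and maximality makes both equal to it.
    refine Set.ncard_le_ncard_of_injOn (fun R => (seed U F R, canon U F (seed U F R) R)) ?_ ?_
      (U.toFinset.finite_toSet.prod hfin)
    · rintro R ⟨hR, -, h0⟩
      have h := hspec R hR h0
      exact ⟨h.subset h.start_mem, (h.isNode_canon hc).1.1⟩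
    · rintro R ⟨hR, -, h0⟩ R' ⟨hR', -, h0'⟩ heq
      simp only [Prod.mk.injEq] at heq
      have h := hspec R hR h0
      have h' := hspec R' hR' h0'
      have hS := (h.isNode_canon hc)
      have hS' := (h'.isNode_canon hc)
      rw [← heq.2] at hS'
      rw [← heq.1] at h'
      have hun : R ∪ R' ∈ F := hc.union_mem h.singleton_mem (singleton_nonempty _) h.mem h'.mem
        (by simpa using h.start_mem) (by simpa using h'.start_mem) hS.1.1.1.1 hS.1.1.1.2 hS.2
        hS'.2
      have hle : R ∪ R' ⊆ insert w P := union_subset hR.1.2 hR'.1.2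
      have h1 : R = R ∪ R' := Maximal.eq_of_le (P := fun Y => Y ∈ F ∧ Y ⊆ insert w P) hR
        ⟨hun, hle⟩ subset_union_left
      have h2 : R' = R ∪ R' := Maximal.eq_of_le (P := fun Y => Y ∈ F ∧ Y ⊆ insert w P) hR'
        ⟨hun, hle⟩ subset_union_right
      rw [h1, ← h2]
  refine key.trans ?_
  rw [Set.ncard_prod, Set.ncard_coe_finset]
  exact Nat.mul_le_mul_right _ (List.toFinset_card_le U)

end Tree

end Listing

namespace Listing

open Finset

variable {ι κ β γ : Type} {e f g : ι → Data} {T : ι → ℕ}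

/-! ### Computing with lists -/

/-- Computing in a larger context. -/
lemma Comp.pull {e' : κ → Data} {T' : κ → ℕ} {π : κ → ι} (hf : Comp e T f)
    (hπ : Comp e' T' (fun z => e (π z))) (hT : ∀ z, T (π z) ≤ T' z) :
    Comp e' T' (fun z => f (π z)) :=
  hf.comp' hπ π (fun _ => rfl) hT

lemma CompP.pull {e' : κ → Data} {T' : κ → ℕ} {π : κ → ι} {p : ι → Prop} (hp : CompP e T p)
    (hπ : Comp e' T' (fun z => e (π z))) (hT : ∀ z, T (π z) ≤ T' z) :
    CompP e' T' (fun z => p (π z)) := by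
  obtain ⟨b, hb, hbp⟩ := hp
  exact ⟨_, hb.pull hπ hT, fun z => hbp _⟩

lemma sz_encList_eq (l : List Data) : sz (encList l) = (l.map fun a => sz a + 1).sum := by
  induction l with
  | nil => rfl
  | cons a l ih => simp [ih]; ring

lemma sz_encList_append (l l' : List Data) :
    sz (encList (l ++ l')) = sz (encList l) + sz (encList l') := by
  simp [sz_encList_eq]

lemma sz_encList_reverse (l : List Data) : sz (encList l.reverse) = sz (encList l) := by
  simp [sz_encList_eq, List.sum_reverse]

lemma Comp.reverse {l : ι → List Data} (hl : Comp e T (fun i => encList (l i))) :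
    Comp e T (fun i => encList (l i).reverse) := by
  obtain ⟨q, hq⟩ := hl.exists_sz_le
  have h : ∀ m : List Data, m.foldl (fun acc a => a :: acc) [] = m.reverse := fun m => by
    simp
  refine (Comp.foldl_take l (fun _ a => a) (fun _ m => encList m) (fun _ => [])
    (fun _ acc a => a :: acc) (by simpa using hl) Comp.nil ⟨q, fun i k => ?_⟩ ?_).congr
    fun i => by rw [h]
  · rw [h, sz_encList_reverse]
    exact (sz_encList_le_of_sublist (List.take_sublist _ _)).trans (hq i)
  · exact Comp.id.hd.cons Comp.id.tl.hd |>.congr fun z => by simp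

lemma Comp.append {l l' : ι → List Data} (hl : Comp e T (fun i => encList (l i)))
    (hl' : Comp e T (fun i => encList (l' i))) : Comp e T (fun i => encList (l i ++ l' i)) := by
  obtain ⟨q, hq⟩ := hl.exists_sz_le
  obtain ⟨q', hq'⟩ := hl'.exists_sz_le
  have h : ∀ m m' : List Data, m.foldl (fun acc a => a :: acc) m' = m.reverse ++ m' := fun m m' => by
    simp
  refine (Comp.foldl_take (fun i => (l i).reverse) (fun _ a => a) (fun _ m => encList m) l'
    (fun _ acc a => a :: acc) (by simpa using hl.reverse) hl' ⟨q + q', fun i k => ?_⟩ ?_).congr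
    fun i => by rw [h, List.reverse_reverse]
  · rw [h, sz_encList_append, sz_encList_reverse, Polynomial.eval_add]
    refine Nat.add_le_add ?_ (hq' i)
    refine (sz_encList_le_of_sublist (List.take_sublist _ _)).trans ?_
    rw [sz_encList_reverse]
    exact hq i
  · exact Comp.id.hd.cons Comp.id.tl.hd |>.congr fun z => by simp

lemma Comp.filter {l : ι → List Data} (p : ι → Data → Prop) [∀ i, DecidablePred (p i)]
    (hl : Comp e T (fun i => encList (l i)))
    (hp : CompP (ι := {z : ι × Data // z.2 ∈ l z.1}) (fun z => Listing.cons z.1.2 (e z.1.1))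
      (fun z => T z.1.1) (fun z => p z.1.1 z.1.2)) :
    Comp e T (fun i => encList ((l i).filter fun a => p i a)) := by
  obtain ⟨q, hq⟩ := hl.exists_sz_le
  have h : ∀ i (m : List Data), m.foldl (fun acc a => if p i a then a :: acc else acc) [] =
      (m.filter fun a => p i a).reverse := fun i m => by
    induction m using List.reverseRecOn with
    | nil => rfl
    | append_singleton m a ih =>
      rw [List.foldl_append, ih]
      by_cases h : p i a <;> simp [h]
  -- Folding over the reversed list restores the original order, because each kept element is put in
  -- front.
  refine (Comp.foldl_take (fun i => (l i).reverse) (fun _ a => a) (fun _ m => encList m)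
    (fun _ => []) (fun i acc a => if p i a then a :: acc else acc) (by simpa using hl.reverse)
    Comp.nil ⟨q, fun i k => ?_⟩ ?_).congr fun i => by
      rw [h, List.filter_reverse, List.reverse_reverse]
  · rw [h, sz_encList_reverse]
    refine (sz_encList_le_of_sublist (List.filter_sublist.trans (List.take_sublist _ _))).trans ?_
    rw [sz_encList_reverse]
    exact hq i
  · have hp' := hp.reindex (κ := {z : ι × ℕ // z.2 < (l z.1).reverse.length})
      (e' := fun z => Listing.cons ((l z.1.1).reverse[z.1.2]'z.2) (e z.1.1))
      (T' := fun z => T z.1.1)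
      (fun z => ⟨(z.1.1, (l z.1.1).reverse[z.1.2]'z.2), List.mem_reverse.1 (List.getElem_mem _)⟩)
      (fun _ => rfl) fun _ => le_rfl
    have hp'' := hp'.pull (π := fun z => z) (T' := fun z => T z.1.1) (e' := fun z =>
      Listing.cons ((l z.1.1).reverse[z.1.2]'z.2) (Listing.cons (encList
        (((l z.1.1).reverse.take z.1.2).foldl (fun acc a => if p z.1.1 a then a :: acc else acc) []))
          (e z.1.1)))
      ((Comp.id.hd.cons Comp.id.tl.tl).congr fun z => by simp) fun _ => le_rfl
    refine (Comp.ite hp'' (Comp.id.hd.cons Comp.id.tl.hd) Comp.id.tl.hd).congr fun z => ?_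
    dsimp only
    split_ifs <;> simp

lemma encList_ne_nil {l : List Data} : encList l ≠ .nil ↔ l ≠ [] := by
  cases l <;> simp

lemma CompP.exists_mem {l : ι → List Data} {p : ι → Data → Prop}
    (hl : Comp e T (fun i => encList (l i)))
    (hp : CompP (ι := {z : ι × Data // z.2 ∈ l z.1}) (fun z => Listing.cons z.1.2 (e z.1.1))
      (fun z => T z.1.1) (fun z => p z.1.1 z.1.2)) :
    CompP e T (fun i => ∃ a ∈ l i, p i a) := by
  classical
  refine (CompP.ne_nil (hl.filter p hp)).congr fun i => ?_
  rw [encList_ne_nil, Ne, List.filter_eq_nil_iff]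
  simp

lemma CompP.mem_list {l : ι → List Data} (hf : Comp e T f)
    (hl : Comp e T (fun i => encList (l i))) : CompP e T (fun i => f i ∈ l i) := by
  have := CompP.exists_mem (p := fun i a => a = f i) hl (CompP.eq (Comp.id.hd.congr fun z => by simp)
    (hf.pull (π := fun z : {z : ι × Data // z.2 ∈ l z.1} => z.1.1)
      (Comp.id.tl.congr fun z => by simp) fun _ => le_rfl))
  exact this.congr fun i => by simp

/-- A loop over the list that prepends a copy of the list in each round; the result has at most
quadratic size. -/
lemma Comp.schedule {l : ι → List Data} (hl : Comp e T (fun i => encList (l i))) :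
    Comp e T (fun i => encList (schedule (l i))) := by
  obtain ⟨q, hq⟩ := hl.exists_sz_le
  have h : ∀ (m u : List Data), m.foldl (fun acc _ => u ++ acc) [] = sweeps u m.length := by
    intro m u
    induction m using List.reverseRecOn with
    | nil => rfl
    | append_singleton m a ih =>
      rw [List.foldl_append, ih]
      simp [sweeps, List.replicate_succ]
  have hs : ∀ (u : List Data) n, sz (encList (sweeps u n)) = n * sz (encList u) := by
    intro u n
    induction n with
    | zero => simp [sweeps]
    | succ n ih =>
      have : sweeps u (n + 1) = u ++ sweeps u n := by simp [sweeps, List.replicate_succ]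
      rw [this, sz_encList_append, ih]
      ring
  refine (Comp.foldl_take l (fun _ a => a) (fun _ m => encList m) (fun _ => [])
    (fun i acc _ => l i ++ acc) (by simpa using hl) Comp.nil ⟨q * q, fun i k => ?_⟩ ?_).congr
    fun i => by rw [h]; rfl
  · rw [h, hs, Polynomial.eval_mul]
    refine Nat.mul_le_mul ?_ (hq i)
    have := length_le_sz_encList (l i)
    have := hq i
    simp
    omega
  · exact Comp.append (hl.pull (π := fun z : {z : ι × ℕ // z.2 < (l z.1).length} => z.1.1)
      (Comp.id.tl.tl.congr fun z => by simp) fun _ => le_rfl)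
      (Comp.id.tl.hd.congr fun z => by simp)

end Listing

namespace Listing

open Finset

/-! ### Computing with set systems -/

/-- The instances of a class. -/
abbrev SetSystemClass.Inst (C : SetSystemClass) : Type :=
  {q : Data × List Data // C.IsInstance q.1 q.2}

/-- The ground set of an instance. -/
abbrev SetSystemClass.ground {C : SetSystemClass} (I : C.Inst) : List Data := I.1.2

/-- The family of an instance. -/
abbrev SetSystemClass.fam {C : SetSystemClass} (I : C.Inst) : Set (Finset Data) := C.family I.1.1

/-- The encoding of an instance. -/
def SetSystemClass.encInst {C : SetSystemClass} (I : C.Inst) : Data := cons I.1.1 (encList I.1.2)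

open SetSystemClass

variable {C : SetSystemClass} {ι κ γ : Type} {e f : ι → Data} {T : ι → ℕ} {I : ι → C.Inst}
  {X Y : ι → Finset Data}

lemma mem_filter_ground {U : List Data} {X : Finset Data} (h : X ⊆ U.toFinset) {a : Data} :
    a ∈ U.filter (· ∈ X) ↔ a ∈ X := by
  simp only [List.mem_filter, decide_eq_true_eq, and_iff_right_iff_imp]
  exact fun ha => by simpa using h ha

lemma encSet_inj {U : List Data} {X Y : Finset Data} (hX : X ⊆ U.toFinset) (hY : Y ⊆ U.toFinset) :
    encSet U X = encSet U Y ↔ X = Y := by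
  refine ⟨fun h => ?_, fun h => h ▸ rfl⟩
  have := encList_injective h
  ext a
  rw [← mem_filter_ground hX, ← mem_filter_ground hY, this]

lemma sz_encSet_le (U : List Data) (X : Finset Data) : sz (encSet U X) ≤ sz (encList U) :=
  sz_encList_le_of_sublist List.filter_sublist

@[simp] lemma encSet_empty (U : List Data) : encSet U ∅ = .nil := by
  simp [encSet]

/-- Computable subsets of the ground set. -/
structure CompS (e : ι → Data) (T : ι → ℕ) (I : ι → C.Inst) (X : ι → Finset Data) : Prop where
  subset : ∀ i, X i ⊆ (ground (I i)).toFinset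
  comp : Comp e T (fun i => encSet (ground (I i)) (X i))

/-- The context determines the instance. -/
abbrev CompI (e : ι → Data) (T : ι → ℕ) (I : ι → C.Inst) : Prop :=
  Comp e T (fun i => encInst (I i))

lemma CompI.ground (hI : CompI e T I) : Comp e T (fun i => encList (ground (I i))) := hI.tl

lemma CompI.desc (hI : CompI e T I) : Comp e T (fun i => (I i).1.1) := hI.hd

lemma CompI.exists_sz_le (hI : CompI e T I) : ∃ q : Polynomial ℕ,
    ∀ i X, sz (encSet (SetSystemClass.ground (I i)) X) ≤ q.eval (sz (e i)) := by
  obtain ⟨q, hq⟩ := hI.ground.exists_sz_le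
  exact ⟨q, fun i X => (sz_encSet_le _ _).trans (hq i)⟩

lemma CompS.pull {e' : κ → Data} {T' : κ → ℕ} {π : κ → ι} (hX : CompS e T I X)
    (hπ : Comp e' T' (fun z => e (π z))) (hT : ∀ z, T (π z) ≤ T' z) :
    CompS e' T' (fun z => I (π z)) (fun z => X (π z)) :=
  ⟨fun _ => hX.subset _, hX.comp.pull hπ hT⟩

lemma CompS.congr (hX : CompS e T I X) (h : ∀ i, X i = Y i) : CompS e T I Y :=
  (funext h : X = Y) ▸ hX

lemma CompS.mem (hX : CompS e T I X) (hf : Comp e T f) : CompP e T (fun i => f i ∈ X i) :=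
  (CompP.mem_list hf hX.comp).congr fun i => mem_filter_ground (hX.subset i)

lemma CompS.eq (hX : CompS e T I X) (hY : CompS e T I Y) : CompP e T (fun i => X i = Y i) :=
  (CompP.eq hX.comp hY.comp).congr fun i => encSet_inj (hX.subset i) (hY.subset i)

/-- A set is encoded by filtering the ground list, so an elementwise membership test computes the
encoding. Insertion and union reduce to this. -/
lemma CompS.of_mem (hI : CompI e T I) (hsub : ∀ i, X i ⊆ (SetSystemClass.ground (I i)).toFinset)
    (hp : CompP (ι := {z : ι × Data // z.2 ∈ SetSystemClass.ground (I z.1)})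
      (fun z => cons z.1.2 (e z.1.1)) (fun z => T z.1.1) (fun z => z.1.2 ∈ X z.1.1)) :
    CompS e T I X :=
  ⟨hsub, Comp.filter (fun i a => a ∈ X i) hI.ground hp⟩

lemma CompS.empty (I : ι → C.Inst) : CompS e T I (fun _ => ∅) :=
  ⟨fun _ => empty_subset _, Comp.nil.congr fun i => by simp⟩

lemma CompS.insert (hI : CompI e T I) (hX : CompS e T I X) (hf : Comp e T f)
    (hfU : ∀ i, f i ∈ SetSystemClass.ground (I i)) :
    CompS e T I (fun i => Insert.insert (f i) (X i)) := by
  refine CompS.of_mem hI (fun i => insert_subset (by simpa using hfU i) (hX.subset i)) ?_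
  have hπ : Comp (fun z : {z : ι × Data // z.2 ∈ SetSystemClass.ground (I z.1)} =>
      cons z.1.2 (e z.1.1)) (fun z => T z.1.1) (fun z => e z.1.1) := Comp.id.tl.congr fun z => rfl
  have ha : Comp (fun z : {z : ι × Data // z.2 ∈ SetSystemClass.ground (I z.1)} =>
      cons z.1.2 (e z.1.1)) (fun z => T z.1.1) (fun z => z.1.2) := Comp.id.hd.congr fun z => rfl
  exact ((CompP.eq ha (hf.pull hπ fun _ => le_rfl)).or
    ((hX.pull hπ fun _ => le_rfl).mem ha)).congr fun z => by simp

lemma CompS.singleton (hI : CompI e T I) (hf : Comp e T f)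
    (hfU : ∀ i, f i ∈ SetSystemClass.ground (I i)) : CompS e T I (fun i => {f i}) :=
  CompS.insert hI (CompS.empty I) hf hfU

lemma CompS.union (hI : CompI e T I) (hX : CompS e T I X) (hY : CompS e T I Y) :
    CompS e T I (fun i => X i ∪ Y i) := by
  refine CompS.of_mem hI (fun i => union_subset (hX.subset i) (hY.subset i)) ?_
  have hπ : Comp (fun z : {z : ι × Data // z.2 ∈ SetSystemClass.ground (I z.1)} =>
      cons z.1.2 (e z.1.1)) (fun z => T z.1.1) (fun z => e z.1.1) := Comp.id.tl.congr fun z => rfl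
  have ha : Comp (fun z : {z : ι × Data // z.2 ∈ SetSystemClass.ground (I z.1)} =>
      cons z.1.2 (e z.1.1)) (fun z => T z.1.1) (fun z => z.1.2) := Comp.id.hd.congr fun z => rfl
  exact (((hX.pull hπ fun _ => le_rfl).mem ha).or
    ((hY.pull hπ fun _ => le_rfl).mem ha)).congr fun z => by simp

/-- Membership in the family is computable. -/
lemma CompS.mem_family (hmem : C.PolyTimeMembership) (hI : CompI e T I) (hX : CompS e T I X) :
    CompP e T (fun i => X i ∈ fam (I i)) := by
  obtain ⟨c, p, h⟩ := hmem
  let κ := {z : C.Inst × Finset Data // z.2 ⊆ (SetSystemClass.ground z.1).toFinset}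
  let inp : κ → Data := fun z =>
    cons z.1.1.1.1 (cons (encList z.1.1.1.2) (encSet z.1.1.1.2 z.1.2))
  choose t σ h1 h2 h3 using fun z : κ => h z.1.1.1.1 z.1.1.1.2 z.1.1.2 z.1.2 z.2
  -- With a trivial accumulator the hook swallows any outputs of the decision program and returns
  -- the answer left in its variable `0`. The space bound comes from the running time.
  have base := Comp.hook (β := Unit) (e := inp) (T := fun _ => 0) c inp t σ h1 (Polynomial.X + p)
    (fun z => (h3 z).trans (by simp [inp])) (fun z => by
      have h4 := ((h1 z).space_le_time c.vars).1
      have h5 := sum_sz_initStore c.vars (inp z)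
      have h6 := h3 z
      simp only [Polynomial.eval_add, Polynomial.eval_X]
      simp only [inp, sz] at *
      omega)
    (fun _ _ => .nil) (fun _ => ()) (fun _ _ _ => ()) (fun _ _ => True) Comp.id Comp.nil
    (fun _ => trivial) (fun _ _ _ _ _ => trivial) ⟨0, fun _ _ _ => by simp⟩ Comp.nil
  have hinp : Comp e T (fun i => inp ⟨(I i, X i), hX.subset i⟩) :=
    hI.desc.cons (hI.ground.cons hX.comp)
  refine ⟨_, (base.hd.comp' hinp (fun i => ⟨(I i, X i), hX.subset i⟩) (fun _ => rfl)
    fun _ => Nat.zero_le _), fun i => ?_⟩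
  simpa using h2 ⟨(I i, X i), hX.subset i⟩

lemma CompS.cases {p : ι → Prop} (hp : CompP e T p)
    (h₁ : CompS (fun i : {i // p i} => e i) (fun i => T i) (fun i => I i) (fun i => X i))
    (h₂ : CompS (fun i : {i // ¬ p i} => e i) (fun i => T i) (fun i => I i) (fun i => X i)) :
    CompS e T I X := by
  refine ⟨fun i => ?_, Comp.cases hp h₁.comp h₂.comp⟩
  by_cases h : p i
  · exact h₁.subset ⟨i, h⟩
  · exact h₂.subset ⟨i, h⟩

lemma CompS.restrict (hX : CompS e T I X) (p : ι → Prop) :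
    CompS (fun i : {i // p i} => e i) (fun i => T i) (fun i => I i) (fun i => X i) :=
  ⟨fun _ => hX.subset _, hX.comp.restrict p⟩

/-- The index type of the body of a loop over `L` with a set as state. -/
abbrev SetLoop (I : ι → C.Inst) (L : ι → List γ) : Type :=
  {z : ι × Finset Data × γ // z.2.1 ⊆ (SetSystemClass.ground (I z.1)).toFinset ∧ z.2.2 ∈ L z.1}

/-- The context of the body of a loop over `L` with a set as state. -/
abbrev setLoopCtx (e : ι → Data) (I : ι → C.Inst) (L : ι → List γ) (ea : ι → γ → Data) :
    SetLoop I L → Data :=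
  fun z => cons (ea z.1.1 z.1.2.2) (cons (encSet (SetSystemClass.ground (I z.1.1)) z.1.2.1) (e z.1.1))

lemma setLoop_env {L : ι → List γ} {ea : ι → γ → Data} :
    Comp (setLoopCtx e I L ea) (fun z => T z.1.1) (fun z => e z.1.1) :=
  Comp.id.tl.tl.congr fun _ => rfl

lemma setLoop_elem {L : ι → List γ} {ea : ι → γ → Data} :
    Comp (setLoopCtx e I L ea) (fun z => T z.1.1) (fun z => ea z.1.1 z.1.2.2) :=
  Comp.id.hd.congr fun _ => rfl

lemma setLoop_state {L : ι → List γ} {ea : ι → γ → Data} :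
    CompS (setLoopCtx e I L ea) (fun z => T z.1.1) (fun z => I z.1.1) (fun z => z.1.2.1) :=
  ⟨fun z => z.2.1, Comp.id.tl.hd.congr fun _ => rfl⟩

/-- A loop whose state is a set. -/
lemma CompS.foldl {L : ι → List γ} {ea : ι → γ → Data}
    {step : ι → Finset Data → γ → Finset Data} (hI : CompI e T I) (hX : CompS e T I X)
    (hL : Comp e T (fun i => encList ((L i).map (ea i))))
    (hc : CompS (setLoopCtx e I L ea) (fun z => T z.1.1) (fun z => I z.1.1)
      (fun z => step z.1.1 z.1.2.1 z.1.2.2)) :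
    CompS e T I (fun i => (L i).foldl (step i) (X i)) := by
  obtain ⟨q, hq⟩ := hI.exists_sz_le
  refine ⟨fun i => ?_, Comp.foldl L ea (fun i D => encSet (SetSystemClass.ground (I i)) D) X step
    (fun i D => D ⊆ (SetSystemClass.ground (I i)).toFinset) hL hX.comp hX.subset
    (fun i D a hD ha => hc.subset ⟨(i, D, a), hD, ha⟩) ⟨q, fun i D _ => hq i D⟩ hc.comp⟩
  exact List.foldlRecOn (motive := fun D => D ⊆ (SetSystemClass.ground (I i)).toFinset) _ _ (hX.subset i)
    fun D hD a ha => hc.subset ⟨(i, D, a), hD, ha⟩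

section

variable {L : ι → List Data}

lemma CompS.extend {Q : ι → Finset Data → Data → Prop} (hI : CompI e T I) (hX : CompS e T I X)
    (hL : Comp e T (fun i => encList (L i)))
    (hLU : ∀ i, ∀ u ∈ L i, u ∈ SetSystemClass.ground (I i))
    (hQ : CompP (setLoopCtx e I L fun _ u => u) (fun z => T z.1.1) (fun z => Q z.1.1 z.1.2.1 z.1.2.2)) :
    CompS e T I (fun i => Listing.extend (Q i) (X i) (L i)) := by
  classical
  refine (CompS.foldl (ea := fun _ u => u) (step := fun i Z u => if Q i Z u then Insert.insert u Z
    else Z) hI hX (by simpa using hL) ?_).congr fun i => by rw [Listing.extend]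
  have h := CompS.insert (hI.pull (setLoop_env (L := L) (ea := fun _ u => u)) fun _ => le_rfl)
    setLoop_state setLoop_elem fun z => hLU _ _ z.2.2
  refine CompS.cases hQ ((h.restrict _).congr fun z => (if_pos z.2).symm)
    ((setLoop_state.restrict _).congr fun z => (if_neg z.2).symm)

end

variable {s : ι → Data} {E S : ι → Finset Data}

lemma CompI.schedule (hI : CompI e T I) :
    Comp e T (fun i => encList (schedule (SetSystemClass.ground (I i)))) :=
  Comp.schedule hI.ground

lemma canon_subset {U : List Data} {F : Set (Finset Data)} {s : Data} {E : Finset Data}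
    (hs : s ∈ U) : canon U F s E ⊆ U.toFinset :=
  extend_induction (P := fun Z => Z ⊆ U.toFinset) (by simpa using hs)
    fun _ _ hu hZ _ => insert_subset (mem_schedule hu) hZ

lemma greedy_subset {U L : List Data} {F : Set (Finset Data)} {s : Data} {E : Finset Data}
    (hs : s ∈ U) (hE : E ⊆ U.toFinset) : greedy F E {s} L ⊆ U.toFinset :=
  extend_induction (P := fun Z => Z ⊆ U.toFinset) (by simpa using hs)
    fun _ _ _ hZ hQ => insert_subset (hE hQ.1) hZ

lemma CompS.canon (hmem : C.PolyTimeMembership) (hI : CompI e T I) (hs : Comp e T s)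
    (hsU : ∀ i, s i ∈ SetSystemClass.ground (I i)) (hE : CompS e T I E) :
    CompS e T I (fun i => canon (SetSystemClass.ground (I i)) (fam (I i)) (s i) (E i)) := by
  have hLU : ∀ i, ∀ u ∈ Listing.schedule (SetSystemClass.ground (I i)),
      u ∈ SetSystemClass.ground (I i) := fun i u hu => mem_of_mem_sweeps hu
  refine CompS.extend hI (CompS.singleton hI hs hsU) hI.schedule hLU ?_
  have hI' := hI.pull (setLoop_env (L := fun i => Listing.schedule (SetSystemClass.ground (I i)))
    (ea := fun _ u => u)
    (I := I) (e := e) (T := T)) fun _ => le_rfl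
  have hE' := hE.pull (setLoop_env (L := fun i => Listing.schedule (SetSystemClass.ground (I i)))
    (ea := fun _ u => u)
    (I := I) (e := e) (T := T)) fun _ => le_rfl
  exact (CompS.mem_family hmem hI' (CompS.insert hI' setLoop_state setLoop_elem
    fun z => hLU _ _ z.2.2)).and (CompS.mem_family hmem hI'
    (CompS.insert hI' (CompS.union hI' setLoop_state hE') setLoop_elem fun z => hLU _ _ z.2.2))

lemma headI_eq_hd (l : List Data) : l.headI = hd (encList l) := by
  cases l <;> rfl

lemma Comp.seed (hmem : C.PolyTimeMembership) (hI : CompI e T I) (hS : CompS e T I S) :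
    Comp e T (fun i => seed (SetSystemClass.ground (I i)) (fam (I i)) (S i)) := by
  classical
  let κ := {z : ι × Data // z.2 ∈ SetSystemClass.ground (I z.1)}
  have hπ : Comp (fun z : κ => Listing.cons z.1.2 (e z.1.1)) (fun z => T z.1.1)
      (fun z => e z.1.1) := Comp.id.tl.congr fun z => rfl
  have ha : Comp (fun z : κ => Listing.cons z.1.2 (e z.1.1)) (fun z => T z.1.1)
      (fun z => z.1.2) := Comp.id.hd.congr fun z => rfl
  have hI' := hI.pull hπ fun _ => le_rfl
  have := (Comp.filter (fun i u => u ∈ S i ∧ {u} ∈ fam (I i)) hI.ground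
    (((hS.pull hπ fun _ => le_rfl).mem ha).and (CompS.mem_family hmem hI'
      (CompS.singleton hI' ha fun z => z.2)))).hd
  refine this.congr fun i => ?_
  rw [Listing.seed, headI_eq_hd]

/-- The head of the accumulator is the current stage, so one greedy step applied to it gives the
next one; the accumulator lists the stages backwards. -/
lemma foldl_stages (F : Set (Finset Data)) (S X : Finset Data) (m : List Data) [∀ Z u,
    Decidable (u ∈ S ∧ insert u Z ∈ F)] :
    m.foldl (fun acc u => (if u ∈ S ∧ insert u acc.headI ∈ F then insert u acc.headI
      else acc.headI) :: acc) [X] =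
    ((List.range (m.length + 1)).map fun k => greedy F S X (m.take k)).reverse := by
  induction m using List.reverseRecOn with
  | nil => rfl
  | append_singleton m a ih =>
    rw [List.foldl_append, ih, List.length_append, List.length_singleton,
      List.range_succ (n := m.length + 1), List.map_append, List.reverse_append]
    have h1 : (List.range (m.length + 1)).map (fun k => greedy F S X ((m ++ [a]).take k)) =
        (List.range (m.length + 1)).map fun k => greedy F S X (m.take k) := by
      refine List.map_congr_left fun k hk => ?_
      rw [List.take_append_of_le_length (by simpa [Nat.lt_succ_iff] using hk)]
    have h2 : ((List.range (m.length + 1)).map fun k => greedy F S X (m.take k)).reverse.headI =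
        greedy F S X m := by
      rw [List.range_succ, List.map_append, List.reverse_append]
      simp
    have h3 : greedy F S X (m ++ [a]) = if a ∈ S ∧ insert a (greedy F S X m) ∈ F then
        insert a (greedy F S X m) else greedy F S X m := by
      rw [greedy, extend_append]
      split_ifs with h
      · exact extend_cons_of_pos h
      · exact extend_cons_of_neg h
    rw [h1, List.foldl_cons, List.foldl_nil, h2, ← h3]
    simp [List.take_of_length_le]

lemma sz_encList_le_length_mul {l : List Data} {n : ℕ} (h : ∀ a ∈ l, sz a ≤ n) :
    sz (encList l) ≤ l.length * (n + 1) := by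
  induction l with
  | nil => simp
  | cons a l ih =>
    have h1 := h a (by simp)
    have h2 := ih fun b hb => h b (by simp [hb])
    simp only [encList_cons, sz_cons, List.length_cons]
    linarith

/-- The list of the stages of the canonical construction is computable. -/
lemma Comp.stages (hmem : C.PolyTimeMembership) (hI : CompI e T I) (hs : Comp e T s)
    (hsU : ∀ i, s i ∈ SetSystemClass.ground (I i)) (hS : CompS e T I S) :
    Comp e T (fun i => encList ((stages (SetSystemClass.ground (I i)) (fam (I i)) (s i) (S i)).map
      fun D => encSet (SetSystemClass.ground (I i)) D)) := by
  classical
  obtain ⟨q, hq⟩ := hI.exists_sz_le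
  obtain ⟨r, hr⟩ := hI.schedule.exists_sz_le
  let L : ι → List Data := fun i => Listing.schedule (SetSystemClass.ground (I i))
  let step : ι → List (Finset Data) → Data → List (Finset Data) := fun i acc u =>
    (if u ∈ S i ∧ insert u acc.headI ∈ fam (I i) then insert u acc.headI else acc.headI) :: acc
  have hfold : ∀ i (m : List Data), m.foldl (step i) [{s i}] =
      ((List.range (m.length + 1)).map fun k => greedy (fam (I i)) (S i) {s i} (m.take k)).reverse :=
    fun i m => foldl_stages _ _ _ m
  have hhead : ∀ i (m : List Data), (m.foldl (step i) [{s i}]).headI = greedy (fam (I i)) (S i) {s i} m := by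
    intro i m
    rw [hfold, List.range_succ, List.map_append, List.reverse_append]
    simp
  suffices h : Comp e T (fun i => encList (((L i).foldl (step i) [{s i}]).map
      fun D => encSet (SetSystemClass.ground (I i)) D)) by
    refine h.reverse.congr fun i => ?_
    rw [hfold, ← List.map_reverse, List.reverse_reverse]
    rfl
  refine Comp.foldl_take L (fun _ u => u) (fun i acc => encList (acc.map
    fun D => encSet (SetSystemClass.ground (I i)) D)) (fun i => [{s i}]) step
    (by simpa using hI.schedule) ((CompS.singleton hI hs hsU).comp.cons Comp.nil)
    ⟨(r + 1) * (q + 1), fun i k => ?_⟩ ?_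
  · refine (sz_encList_le_length_mul (n := q.eval (sz (e i))) ?_).trans ?_
    · intro a ha
      obtain ⟨D, -, rfl⟩ := List.mem_map.1 ha
      exact hq i D
    · have h1 := length_le_sz_encList (L i)
      have h2 := hr i
      simp only [Polynomial.eval_mul, Polynomial.eval_add, Polynomial.eval_one]
      refine Nat.mul_le_mul_right _ ?_
      rw [hfold]
      simp only [List.length_map, List.length_reverse, List.length_range, List.length_take]
      have h3 : sz (encList (L i)) ≤ r.eval (sz (e i)) := h2
      omega
  · let κ := {z : ι × ℕ // z.2 < (L z.1).length}
    let G : κ → Finset Data := fun z =>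
      greedy (fam (I z.1.1)) (S z.1.1) {s z.1.1} ((L z.1.1).take z.1.2)
    let u : κ → Data := fun z => (L z.1.1)[z.1.2]'z.2
    let acc : κ → List (Finset Data) := fun z =>
      ((L z.1.1).take z.1.2).foldl (step z.1.1) [{s z.1.1}]
    let ctx : κ → Data := fun z => Listing.cons (u z) (Listing.cons (encList ((acc z).map
      fun D => encSet (SetSystemClass.ground (I z.1.1)) D)) (e z.1.1))
    have hacc : ∀ z, (acc z).headI = G z := fun z => hhead _ _
    have hu : ∀ z : κ, u z ∈ SetSystemClass.ground (I z.1.1) := fun z =>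
      mem_of_mem_sweeps (List.getElem_mem z.2)
    have hπ : Comp ctx (fun z => T z.1.1) (fun z => e z.1.1) := Comp.id.tl.tl.congr fun z => rfl
    have ha : Comp ctx (fun z => T z.1.1) u := Comp.id.hd.congr fun z => rfl
    have hA : Comp ctx (fun z => T z.1.1) (fun z => encList ((acc z).map
      fun D => encSet (SetSystemClass.ground (I z.1.1)) D)) := Comp.id.tl.hd.congr fun z => rfl
    have hI' := hI.pull hπ fun _ => le_rfl
    have hS' := hS.pull hπ fun _ => le_rfl
    -- The current stage is read off as the head of the encoded accumulator, which is never empty.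
    have hG : CompS ctx (fun z => T z.1.1) (fun z => I z.1.1) G := by
      refine ⟨fun z => greedy_subset (hsU _) (hS.subset _), hA.hd.congr fun z => ?_⟩
      rw [← hacc, ← headI_eq_hd]
      have : acc z ≠ [] := by
        simp only [acc, hfold, ne_eq, List.reverse_eq_nil_iff, List.map_eq_nil_iff,
          List.range_eq_nil]
        omega
      cases h : acc z with
      | nil => exact absurd h this
      | cons D l => rfl
    have hins := CompS.insert hI' hG ha hu
    have hX : Comp ctx (fun z => T z.1.1) (fun z => encSet (SetSystemClass.ground (I z.1.1))
        (if u z ∈ S z.1.1 ∧ insert (u z) (G z) ∈ fam (I z.1.1) then insert (u z) (G z)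
          else G z)) :=
      (Comp.ite ((hS'.mem ha).and (CompS.mem_family hmem hI' hins)) hins.comp hG.comp).congr
        fun z => by split_ifs <;> rfl
    refine (hX.cons hA).congr fun z => ?_
    change _ = encList ((step z.1.1 (acc z) (u z)).map _)
    simp only [step, hacc, List.map_cons, encList_cons]

lemma subset_of_mem_stages {U : List Data} {F : Set (Finset Data)} {s : Data} {S D : Finset Data}
    (hs : s ∈ U) (hS : S ⊆ U.toFinset) (hD : D ∈ stages U F s S) : D ⊆ U.toFinset := by
  obtain ⟨k, -, rfl⟩ := List.mem_map.1 hD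
  exact greedy_subset hs hS

/-- The parent is computable. -/
lemma CompS.parent (hmem : C.PolyTimeMembership) (hcomm : C.Commutable) (hI : CompI e T I)
    (hS : CompS e T I S) (hnode : ∀ i, IsNode (SetSystemClass.ground (I i)) (fam (I i)) (S i)) :
    CompS e T I (fun i => parent (SetSystemClass.ground (I i)) (fam (I i)) (S i)) := by
  classical
  have hc : ∀ i, IsCommutable (SetSystemClass.ground (I i)).toFinset (fam (I i)) :=
    fun i => hcomm _ _ (I i).2
  let s : ι → Data := fun i => Listing.seed (SetSystemClass.ground (I i)) (fam (I i)) (S i)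
  have hsU : ∀ i, s i ∈ SetSystemClass.ground (I i) := fun i => by
    have h := (hnode i).seed_spec (hc i)
    simpa using h.subset h.start_mem
  have hs : Comp e T s := Comp.seed hmem hI hS
  let l : ι → List (Finset Data) := fun i =>
    stages (SetSystemClass.ground (I i)) (fam (I i)) (s i) (S i)
  let step : ι → Finset Data → Finset Data → Finset Data := fun i P D =>
    if Listing.canon (SetSystemClass.ground (I i)) (fam (I i)) (s i) D ≠ S i then
      Listing.canon (SetSystemClass.ground (I i)) (fam (I i)) (s i) D else P
  obtain ⟨q, hq⟩ := hI.exists_sz_le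
  have hpar : ∀ i, Listing.parent (SetSystemClass.ground (I i)) (fam (I i)) (S i) =
      (l i).foldl (step i) ∅ := fun i => by
    rw [Listing.parent]
  refine ⟨fun i => ?_, ?_⟩
  · rcases (hnode i).parent_eq_empty_or (hc i) with h | h
    · rw [h]; exact empty_subset _
    · exact h.1.1.2
  suffices h : Comp e T (fun i => encSet (SetSystemClass.ground (I i)) ((l i).foldl (step i) ∅)) from
    h.congr fun i => by rw [hpar]
  refine Comp.foldl l (fun i D => encSet (SetSystemClass.ground (I i)) D)
    (fun i D => encSet (SetSystemClass.ground (I i)) D) (fun _ => ∅) step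
    (fun i P => P ⊆ (SetSystemClass.ground (I i)).toFinset)
    (Comp.stages hmem hI hs hsU hS) (CompS.empty I).comp (fun _ => empty_subset _) ?_
    ⟨q, fun i P _ => hq i P⟩ ?_
  · intro i P D hP _
    simp only [step]
    split_ifs
    · exact canon_subset (hsU i)
    · exact hP
  · let κ := {z : ι × Finset Data × Finset Data //
      z.2.1 ⊆ (SetSystemClass.ground (I z.1)).toFinset ∧ z.2.2 ∈ l z.1}
    let ctx : κ → Data := fun z => Listing.cons (encSet (SetSystemClass.ground (I z.1.1)) z.1.2.2)
      (Listing.cons (encSet (SetSystemClass.ground (I z.1.1)) z.1.2.1) (e z.1.1))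
    have hπ : Comp ctx (fun z => T z.1.1) (fun z => e z.1.1) := Comp.id.tl.tl.congr fun z => rfl
    have hI' := hI.pull hπ fun _ => le_rfl
    have hD : CompS ctx (fun z => T z.1.1) (fun z => I z.1.1) (fun z => z.1.2.2) :=
      ⟨fun z => subset_of_mem_stages (hsU _) (hS.subset _) z.2.2, Comp.id.hd.congr fun z => rfl⟩
    have hP : CompS ctx (fun z => T z.1.1) (fun z => I z.1.1) (fun z => z.1.2.1) :=
      ⟨fun z => z.2.1, Comp.id.tl.hd.congr fun z => rfl⟩
    have hcan := CompS.canon hmem hI' (hs.pull hπ fun _ => le_rfl) (fun z => hsU _) hD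
    refine (Comp.ite (hcan.eq (hS.pull hπ fun _ => le_rfl)).not hcan.comp hP.comp).congr fun z => ?_
    simp only [step, ne_eq]
    split_ifs <;> rfl

/-! ### A linear order on the subsets of the ground set -/

open Classical in
/-- The position of a subset of the ground set in the lexicographic order. -/
noncomputable def code (A : Finset Data) : List Data → ℕ
  | [] => 0
  | u :: U => (if u ∈ A then 2 ^ U.length else 0) + code A U

lemma code_lt (A : Finset Data) (U : List Data) : code A U < 2 ^ U.length := by
  induction U with
  | nil => simp [code]
  | cons u U ih =>
    rw [code, List.length_cons, pow_succ]
    split_ifs <;> omega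

lemma code_injective {U : List Data} {A B : Finset Data} (hA : A ⊆ U.toFinset)
    (hB : B ⊆ U.toFinset) (h : code A U = code B U) : A = B := by
  suffices ∀ u ∈ U, u ∈ A ↔ u ∈ B by
    ext u
    exact ⟨fun hu => (this u (by simpa using hA hu)).1 hu,
      fun hu => (this u (by simpa using hB hu)).2 hu⟩
  clear hA hB
  induction U with
  | nil => simp
  | cons u U ih =>
    have h1 := code_lt A U
    have h2 := code_lt B U
    rw [code, code] at h
    by_cases hA : u ∈ A <;> by_cases hB : u ∈ B
    · rw [if_pos hA, if_pos hB] at h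
      simpa [hA, hB] using ih (by omega)
    · rw [if_pos hA, if_neg hB] at h
      omega
    · rw [if_neg hA, if_pos hB] at h
      omega
    · rw [if_neg hA, if_neg hB] at h
      simpa [hA, hB] using ih (by omega)

/-- The first element of `U` on which the sets differ carries the leading digit of the difference.
Thus codes can be compared without computing these exponentially large numbers. -/
lemma code_lt_code_iff {U : List Data} {A B : Finset Data}
    [DecidablePred fun u => ¬ (u ∈ A ↔ u ∈ B)] : code A U < code B U ↔
    (U.filter fun u => ¬ (u ∈ A ↔ u ∈ B)) ≠ [] ∧
      (U.filter fun u => ¬ (u ∈ A ↔ u ∈ B)).headI ∈ B := by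
  induction U with
  | nil => simp [code]
  | cons u U ih =>
    have h1 := code_lt A U
    have h2 := code_lt B U
    rw [code, code]
    by_cases hA : u ∈ A <;> by_cases hB : u ∈ B
    · rw [if_pos hA, if_pos hB, List.filter_cons_of_neg (by simp [hA, hB]), ← ih]
      omega
    · rw [if_pos hA, if_neg hB, List.filter_cons_of_pos (by simp [hA, hB])]
      simp [hB]
      omega
    · rw [if_neg hA, if_pos hB, List.filter_cons_of_pos (by simp [hA, hB])]
      simp [hB]
      omega
    · rw [if_neg hA, if_neg hB, List.filter_cons_of_neg (by simp [hA, hB]), ← ih]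
      omega

lemma CompS.code_lt (hI : CompI e T I) (hX : CompS e T I X) (hY : CompS e T I Y) :
    CompP e T (fun i => code (X i) (SetSystemClass.ground (I i)) <
      code (Y i) (SetSystemClass.ground (I i))) := by
  classical
  let κ := {z : ι × Data // z.2 ∈ SetSystemClass.ground (I z.1)}
  have hπ : Comp (fun z : κ => Listing.cons z.1.2 (e z.1.1)) (fun z => T z.1.1)
      (fun z => e z.1.1) := Comp.id.tl.congr fun z => rfl
  have ha : Comp (fun z : κ => Listing.cons z.1.2 (e z.1.1)) (fun z => T z.1.1)
      (fun z => z.1.2) := Comp.id.hd.congr fun z => rfl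
  have hXa := (hX.pull hπ fun _ => le_rfl).mem ha
  have hYa := (hY.pull hπ fun _ => le_rfl).mem ha
  have hl := Comp.filter (fun i u => ¬ (u ∈ X i ↔ u ∈ Y i)) hI.ground
    (((hXa.and hYa.not).or (hYa.and hXa.not)).congr fun z => by tauto)
  refine ((CompP.ne_nil hl).and (hY.mem hl.hd)).congr fun i => ?_
  rw [code_lt_code_iff, encList_ne_nil, headI_eq_hd]

end Listing

namespace Listing

open Finset SetSystemClass

/-! ### The tree of maximal solutions -/

section Tree

variable {U : List Data} {F : Set (Finset Data)} {P Z S N N' : Finset Data}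

/-- `S` is a child of `P`; the children of `∅` are the roots. -/
def IsChild (U : List Data) (F : Set (Finset Data)) (P S : Finset Data) : Prop :=
  IsNode U F S ∧ parent U F S = P

/-- `S` is a child of `P` that comes after `Z`. -/
def IsLater (U : List Data) (F : Set (Finset Data)) (P Z S : Finset Data) : Prop :=
  IsChild U F P S ∧ code Z U < code S U

lemma exists_least_isLater (h : ∃ S, IsLater U F P Z S) :
    ∃ S, IsLater U F P Z S ∧ ∀ S', IsLater U F P Z S' → code S U ≤ code S' U := by
  obtain ⟨S, hS, hmin⟩ := (measure fun S => code S U).wf.has_min {S | IsLater U F P Z S} h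
  exact ⟨S, hS, fun S' hS' => not_lt.1 (hmin S' hS')⟩

open Classical in
/-- The first child of `P` that comes after `Z`, or `∅` if there is none. -/
noncomputable def nextChild (U : List Data) (F : Set (Finset Data)) (P Z : Finset Data) :
    Finset Data :=
  if h : ∃ S, IsLater U F P Z S then (exists_least_isLater h).choose else ∅

lemma IsChild.nonempty (h : IsChild U F P S) : S.Nonempty := h.1.2

lemma IsChild.subset (h : IsChild U F P S) : S ⊆ U.toFinset := h.1.1.1.2

lemma isLater_nextChild (h : nextChild U F P Z ≠ ∅) : IsLater U F P Z (nextChild U F P Z) := by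
  rw [nextChild] at h ⊢
  split_ifs with h'
  · exact (exists_least_isLater h').choose_spec.1
  · exact absurd (dif_neg h') h

lemma IsLater.nextChild_ne_empty (h : IsLater U F P Z S) : nextChild U F P Z ≠ ∅ := by
  rw [nextChild, dif_pos ⟨S, h⟩]
  exact (exists_least_isLater ⟨S, h⟩).choose_spec.1.1.nonempty.ne_empty

lemma IsLater.code_nextChild_le (h : IsLater U F P Z S) :
    code (nextChild U F P Z) U ≤ code S U := by
  rw [nextChild, dif_pos ⟨S, h⟩]
  exact (exists_least_isLater ⟨S, h⟩).choose_spec.2 S h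

lemma nextChild_eq_empty_or : nextChild U F P Z = ∅ ∨ IsNode U F (nextChild U F P Z) := by
  by_cases h : nextChild U F P Z = ∅
  · exact .inl h
  · exact .inr (isLater_nextChild h).1.1

open Classical in
/-- Replace `B` by the node `S` if `S` is a later child of `P` that comes before `B`. -/
noncomputable def update (U : List Data) (F : Set (Finset Data)) (P Z B S : Finset Data) :
    Finset Data :=
  if parent U F S = P ∧ code Z U < code S U ∧ (B = ∅ ∨ code S U < code B U) then S else B

/-- `B` is the first later child of `P` among the elements of `A`. -/
def IsBest (U : List Data) (F : Set (Finset Data)) (P Z : Finset Data) (A : Set (Finset Data))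
    (B : Finset Data) : Prop :=
  (B = ∅ ∨ IsLater U F P Z B) ∧ ∀ S ∈ A, IsLater U F P Z S → B ≠ ∅ ∧ code B U ≤ code S U

/-- Candidates may be repeated or may have another parent: the parent test removes the latter, and
keeping only a minimum makes repetitions harmless. -/
lemma IsBest.update {A : Set (Finset Data)} {B : Finset Data} (h : IsBest U F P Z A B)
    (hS : IsNode U F S) : IsBest U F P Z (A ∪ {S}) (update U F P Z B S) := by
  rw [Listing.update]
  split_ifs with h'
  · refine ⟨.inr ⟨⟨hS, h'.1⟩, h'.2.1⟩, fun S' hS' hl => ⟨hS.2.ne_empty, ?_⟩⟩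
    rcases hS' with hS' | rfl
    swap
    · exact le_rfl
    · obtain ⟨h1, h2⟩ := h.2 S' hS' hl
      exact ((h'.2.2.resolve_left h1).trans_le h2).le
  · refine ⟨h.1, fun S' hS' hl => ?_⟩
    rcases hS' with hS' | rfl
    swap
    · simp only [hl.1.2, hl.2, true_and, not_or, not_lt] at h'
      exact h'
    · exact h.2 S' hS' hl

/-- Each round adds its candidates `A' a` to the inspected set. Stated for an arbitrary `A`, it can
be applied to nested loops from the inside out. -/
lemma IsBest.foldl {γ : Type} {A : Set (Finset Data)} {B : Finset Data} {l : List γ}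
    {step : Finset Data → γ → Finset Data} {A' : γ → Set (Finset Data)}
    (hstep : ∀ a ∈ l, ∀ A B, IsBest U F P Z A B → IsBest U F P Z (A ∪ A' a) (step B a))
    (h : IsBest U F P Z A B) :
    IsBest U F P Z (A ∪ {S | ∃ a ∈ l, S ∈ A' a}) (l.foldl step B) := by
  induction l generalizing A B with
  | nil => simpa using h
  | cons a l ih =>
    have := ih (fun b hb => hstep b (by simp [hb])) (hstep a (by simp) A B h)
    rw [List.foldl_cons]
    convert this using 1
    ext
    simp only [List.mem_cons, Set.mem_union, Set.mem_ofPred_eq, exists_eq_or_imp]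
    tauto

/-- Once every later child has been inspected, the minimum found is the least later child, and codes
are injective on subsets of `U`. -/
lemma IsBest.eq_nextChild {A : Set (Finset Data)} {B : Finset Data} (h : IsBest U F P Z A B)
    (hA : ∀ S, IsLater U F P Z S → S ∈ A) : B = nextChild U F P Z := by
  by_cases hN : nextChild U F P Z = ∅
  · rw [hN]
    exact h.1.resolve_right fun hB => hB.nextChild_ne_empty hN
  · have hN' := isLater_nextChild hN
    obtain ⟨h1, h2⟩ := h.2 _ (hA _ hN') hN'
    have hB := h.1.resolve_left h1
    exact code_injective hB.1.subset hN'.1.subset (h2.antisymm hB.code_nextChild_le)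

/-- The height of a node or of `∅`. -/
noncomputable def height (U : List Data) (F : Set (Finset Data)) (P : Finset Data) : ℕ :=
  if P = ∅ then 0 else nodeRank U F P + 1

/-- A bound for the height. -/
def maxHeight (U : List Data) : ℕ := (U.length + 1) * 2 ^ (schedule U).length + 2

lemma height_lt (U : List Data) (F : Set (Finset Data)) (P : Finset Data) :
    height U F P < maxHeight U := by
  rw [height, maxHeight]
  split_ifs
  · omega
  · have h1 : U.idxOf (seed U F P) ≤ U.length := List.idxOf_le_length
    have h2 := Nat.mul_le_mul_right (2 ^ (schedule U).length) h1
    rw [nodeRank, add_mul, one_mul]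
    generalize 2 ^ (schedule U).length = x at *
    omega

/-- `S` is a descendant of `P`, or `P` itself. -/
def IsDescendant (U : List Data) (F : Set (Finset Data)) : Finset Data → Finset Data → Prop :=
  Relation.ReflTransGen (IsChild U F)

section

variable (hc : IsCommutable U.toFinset F)
include hc

lemma IsChild.height_lt (h : IsChild U F P S) : height U F P < height U F S := by
  rw [height, height, if_neg h.nonempty.ne_empty]
  split_ifs with hP
  · omega
  · have := h.1.nodeRank_parent_lt hc (h.2.symm ▸ hP)
    rw [h.2] at this
    omega

lemma IsDescendant.height_le (h : IsDescendant U F P S) : height U F P ≤ height U F S := by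
  induction h with
  | refl => exact le_rfl
  | tail _ h ih => exact ih.trans (h.height_lt hc).le

/-- Parents are unique, so the ancestors of `S` form a chain; two children of the same node on one
chain coincide because the height strictly increases downwards. This rules out repeated outputs. -/
lemma IsChild.eq_of_isDescendant (hN : IsChild U F P N) (hN' : IsChild U F P N')
    (h : IsDescendant U F N S) (h' : IsDescendant U F N' S) : N = N' := by
  have key : ∀ {A B}, IsChild U F P A → IsChild U F P B → IsDescendant U F A B → A = B := by
    intro A B hA hB hAB
    rcases Relation.ReflTransGen.cases_tail hAB with rfl | ⟨M, hM, hMB⟩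
    · rfl
    · have h1 : M = P := hMB.2.symm.trans hB.2
      subst h1
      exact absurd (hA.height_lt hc) (not_lt.2 (IsDescendant.height_le hc hM))
  have hu : Relator.RightUnique (Function.swap (IsChild U F)) := fun A B B' h₁ h₂ =>
    h₁.2.symm.trans h₂.2
  rcases Relation.ReflTransGen.total_of_right_unique hu (Relation.reflTransGen_swap.2 h)
    (Relation.reflTransGen_swap.2 h') with h₁ | h₁
  · exact (key hN' hN (Relation.reflTransGen_swap.1 h₁)).symm
  · exact key hN hN' (Relation.reflTransGen_swap.1 h₁)

/-- Following parents decreases `nodeRank`, so it ends at a root. -/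
lemma IsNode.exists_root (hS : IsNode U F S) :
    ∃ N, IsChild U F ∅ N ∧ IsDescendant U F N S := by
  induction hn : nodeRank U F S using Nat.strong_induction_on generalizing S with
  | _ n ih =>
    rcases hS.parent_eq_empty_or hc with h | h
    · exact ⟨S, ⟨hS, h⟩, .refl⟩
    · obtain ⟨N, h1, h2⟩ := ih _ (hn ▸ hS.nodeRank_parent_lt hc h.2.ne_empty) h rfl
      exact ⟨N, h1, h2.tail ⟨hS, rfl⟩⟩

end

lemma IsDescendant.isNode (h : IsDescendant U F N S) (hN : IsNode U F N) : IsNode U F S := by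
  rcases Relation.ReflTransGen.cases_tail h with rfl | ⟨M, -, hM⟩
  · exact hN
  · exact hM.1

lemma code_empty (U : List Data) : code ∅ U = 0 := by
  induction U with
  | nil => rfl
  | cons u U ih => simpa [code] using ih

/-- `∅` as last child means that no child has been visited yet: it has code `0`, and every node has
a positive code. -/
lemma IsChild.isLater_empty (h : IsChild U F P S) : IsLater U F P ∅ S := by
  refine ⟨h, ?_⟩
  rw [code_empty]
  refine Nat.pos_of_ne_zero fun h0 => h.nonempty.ne_empty ?_
  exact code_injective h.subset (empty_subset _) (h0.trans (code_empty U).symm)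

end Tree

/-! ### Traversing the tree -/

section Traversal

variable {C : SetSystemClass}

/-- The state of a depth-first traversal: the current node, the last visited child, the parity of
the depth, and the output of the last move. -/
structure Visit (C : SetSystemClass) where
  inst : C.Inst
  node : Finset Data
  last : Finset Data
  odd : Bool
  run : Bool
  out : Option (Finset Data)
  node_spec : node = ∅ ∨ IsNode (ground inst) (fam inst) node
  last_subset : last ⊆ (ground inst).toFinset

namespace Visit

/-- The next unvisited child of the current node. -/
noncomputable def child (s : Visit C) : Finset Data :=
  nextChild (ground s.inst) (fam s.inst) s.node s.last

lemma node_subset (s : Visit C) : s.node ⊆ (ground s.inst).toFinset := by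
  rcases s.node_spec with h | h
  · rw [h]; exact empty_subset _
  · exact h.1.1.2

/-- Move to a child. -/
noncomputable def down (s : Visit C) : Visit C where
  inst := s.inst
  node := s.child
  last := ∅
  odd := !s.odd
  run := true
  out := if s.odd then none else some s.child
  node_spec := nextChild_eq_empty_or
  last_subset := empty_subset _

/-- Move to the parent. -/
noncomputable def up (hcomm : C.Commutable) (s : Visit C) (h : s.node ≠ ∅) : Visit C where
  inst := s.inst
  node := parent (ground s.inst) (fam s.inst) s.node
  last := s.node
  odd := !s.odd
  run := true
  out := if s.odd then none else some s.node
  node_spec := (s.node_spec.resolve_left h).parent_eq_empty_or (hcomm _ _ s.inst.2)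
  last_subset := s.node_subset

/-- The end of the traversal. -/
def halt (s : Visit C) : Visit C :=
  ⟨s.inst, ∅, ∅, false, false, none, .inl rfl, empty_subset _⟩

open Classical in
/-- The moves of the traversal. -/
noncomputable def next (hcomm : C.Commutable) (s : Visit C) : Visit C :=
  if s.child = ∅ then if h : s.node = ∅ then s.halt else s.up hcomm h else s.down

/-- `Path hcomm s l s'`: the traversal leads from `s` to `s'`, with the outputs `l`. -/
inductive Path (hcomm : C.Commutable) : Visit C → List (Finset Data) → Visit C → Prop
  | nil (s) : Path hcomm s [] s
  | cons {s l s'} : s.run → Path hcomm (s.next hcomm) l s' →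
      Path hcomm s ((s.next hcomm).out.toList ++ l) s'

variable {hcomm : C.Commutable} {s s' s'' : Visit C} {l l' : List (Finset Data)}

lemma Path.trans (h : Path hcomm s l s') (h' : Path hcomm s' l' s'') :
    Path hcomm s (l ++ l') s'' := by
  induction h with
  | nil => exact h'
  | cons hr _ ih =>
    rw [List.append_assoc]
    exact .cons hr (ih h')

lemma Path.single (hr : s.run) : Path hcomm s (s.next hcomm).out.toList (s.next hcomm) := by
  simpa using Path.cons hr (.nil (s.next hcomm))

lemma Path.exists_iterate (h : Path hcomm s l s') :
    ∃ n, (next hcomm)^[n] s = s' ∧ (∀ k < n, ((next hcomm)^[k] s).run) ∧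
      (List.range n).filterMap (fun k => ((next hcomm)^[k + 1] s).out) = l := by
  induction h with
  | nil s => exact ⟨0, rfl, by simp, rfl⟩
  | @cons s l s' hr _ ih =>
    obtain ⟨n, h1, h2, h3⟩ := ih
    refine ⟨n + 1, h1, fun k hk => ?_, ?_⟩
    · cases k with
      | zero => exact hr
      | succ k => exact h2 k (by omega)
    · rw [filterMap_range_succ]
      exact congrArg _ h3

/-- The traversal of the part of the tree below the remaining children of a node. -/
lemma exists_path (hcomm : C.Commutable) (s : Visit C) (hr : s.run) :
    ∃ l s', Path hcomm s l s' ∧ s'.inst = s.inst ∧ s'.node = s.node ∧ s'.odd = s.odd ∧ s'.run ∧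
      s'.child = ∅ ∧ l.Nodup ∧ ∀ S, S ∈ l ↔ ∃ N, IsLater (ground s.inst) (fam s.inst) s.node s.last N
        ∧ IsDescendant (ground s.inst) (fam s.inst) N S := by
  obtain ⟨I, hI⟩ : ∃ I, s.inst = I := ⟨_, rfl⟩
  have hc : IsCommutable (ground I).toFinset (fam I) := hcomm _ _ I.2
  -- Double induction: the outer one on the distance to the maximal height (going down), the inner
  -- one on the codes after the last visited child (going sideways).
  obtain ⟨m, hm⟩ : ∃ m, maxHeight (ground I) - height (ground I) (fam I) s.node ≤ m := ⟨_, le_rfl⟩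
  induction m generalizing s with
  | zero =>
    have := height_lt (ground I) (fam I) s.node
    omega
  | succ m ihm =>
  obtain ⟨k, hk⟩ : ∃ k, 2 ^ (ground I).length - code s.last (ground I) ≤ k := ⟨_, le_rfl⟩
  induction k generalizing s with
  | zero =>
    have := code_lt s.last (ground I)
    omega
  | succ k ihk =>
  by_cases hch : s.child = ∅
  · refine ⟨[], s, .nil s, rfl, rfl, rfl, hr, hch, List.nodup_nil, fun S => ?_⟩
    simp only [List.not_mem_nil, false_iff, not_exists, not_and]
    exact fun N hN => absurd hch hN.nextChild_ne_empty
  have hN : IsLater (ground I) (fam I) s.node s.last s.child := hI ▸ isLater_nextChild hch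
  have hmin : ∀ S, IsLater (ground I) (fam I) s.node s.last S →
      code s.child (ground I) ≤ code S (ground I) := by
    intro S hS
    rw [← hI] at hS ⊢
    exact hS.code_nextChild_le
  have h₁ : s.next hcomm = s.down := by rw [next, if_neg hch]
  have hlt := hN.1.height_lt hc
  obtain ⟨l₁, s₁, p₁, hI₁, hP₁, ho₁, hr₁, hc₁, hn₁, hm₁⟩ := ihm s.down rfl hI (by
    change _ - height _ _ s.child ≤ m
    omega)
  have hne : s₁.node ≠ ∅ := hP₁ ▸ hch
  have hI₁' : s₁.inst = I := hI₁.trans hI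
  have h₂ : s₁.next hcomm = s₁.up hcomm hne := by rw [next, if_pos hc₁, dif_neg hne]
  have hnode : (s₁.up hcomm hne).node = s.node := by
    change parent (ground s₁.inst) (fam s₁.inst) s₁.node = s.node
    rw [hI₁', hP₁]
    exact hN.1.2
  have hlast : (s₁.up hcomm hne).last = s.child := hP₁
  have hodd : (s₁.up hcomm hne).odd = s.odd := by
    change (!s₁.odd) = s.odd
    rw [ho₁]
    exact Bool.not_not _
  obtain ⟨l₂, s₂, p₂, hI₂, hP₂, ho₂, hr₂, hc₂, hn₂, hm₂⟩ := ihk (s₁.up hcomm hne) rfl hI₁'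
    (by rw [hnode]; exact hm) (by
      rw [hlast]
      have := hN.2
      omega)
  have hp := ((Path.single hr).trans (h₁.symm ▸ p₁)).trans
    ((Path.single hr₁).trans (h₂.symm ▸ p₂))
  refine ⟨_, s₂, hp, hI₂.trans hI₁, hP₂.trans hnode, ho₂.trans hodd, hr₂, hc₂, ?_⟩
  -- The child is output exactly once: on the move down if the current parity is even, on the move
  -- back up otherwise.
  have hperm : (((s.next hcomm).out.toList ++ l₁) ++ ((s₁.next hcomm).out.toList ++ l₂)).Perm
      (s.child :: (l₁ ++ l₂)) := by
    rw [h₁, h₂]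
    have e₁ : s.down.out = if s.odd then none else some s.child := rfl
    have e₂ : (s₁.up hcomm hne).out = if s.odd then some s.child else none := by
      change (if s₁.odd then none else some s₁.node) = _
      rw [ho₁, hP₁]
      change (if (!s.odd) then none else some s.child) = _
      cases s.odd <;> rfl
    rw [e₁, e₂]
    cases s.odd
    · simp
    · simp
  have hm₁' : ∀ S, S ∈ l₁ ↔ ∃ N, IsChild (ground I) (fam I) s.child N ∧
      IsDescendant (ground I) (fam I) N S := by
    intro S
    rw [hm₁]
    change (∃ N, IsLater (ground s.inst) (fam s.inst) s.child ∅ N ∧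
      IsDescendant (ground s.inst) (fam s.inst) N S) ↔ _
    rw [hI]
    exact exists_congr fun N => and_congr_left' ⟨fun h => h.1, IsChild.isLater_empty⟩
  have hm₂' : ∀ S, S ∈ l₂ ↔ ∃ N, IsLater (ground I) (fam I) s.node s.child N ∧
      IsDescendant (ground I) (fam I) N S := by
    intro S
    rw [hm₂, hnode, hlast]
    change (∃ N, IsLater (ground s₁.inst) (fam s₁.inst) s.node s.child N ∧
      IsDescendant (ground s₁.inst) (fam s₁.inst) N S) ↔ _
    rw [hI₁']
  have hdesc : ∀ S ∈ l₁, IsDescendant (ground I) (fam I) s.child S := fun S hS => by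
    obtain ⟨N, h1, h2⟩ := (hm₁' S).1 hS
    exact h2.head h1
  rw [hperm.nodup_iff]
  refine ⟨List.nodup_cons.2 ⟨fun h => ?_, List.nodup_append'.2 ⟨hn₁, hn₂, fun S h1 h2 => ?_⟩⟩,
    fun S => ?_⟩
  · rcases List.mem_append.1 h with h | h
    · obtain ⟨N, h1, h2⟩ := (hm₁' _).1 h
      have := h1.height_lt hc
      have := IsDescendant.height_le hc h2
      omega
    · obtain ⟨N, h1, h2⟩ := (hm₂' _).1 h
      have := hN.1.eq_of_isDescendant hc h1.1 .refl h2
      exact absurd h1.2 (this ▸ lt_irrefl _)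
  · obtain ⟨N, h3, h4⟩ := (hm₂' _).1 h2
    have := hN.1.eq_of_isDescendant hc h3.1 (hdesc S h1) h4
    exact absurd h3.2 (this ▸ lt_irrefl _)
  · rw [hperm.mem_iff, List.mem_cons, List.mem_append, hm₁', hm₂', hI]
    constructor
    · rintro (rfl | ⟨N, h1, h2⟩ | ⟨N, h1, h2⟩)
      · exact ⟨_, hN, .refl⟩
      · exact ⟨_, hN, h2.head h1⟩
      · exact ⟨N, ⟨h1.1, hN.2.trans h1.2⟩, h2⟩
    · rintro ⟨N, h1, h2⟩
      -- `s.child` is the least later child, so any other later child comes after it and belongs to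
      -- the second part of the traversal.
      rcases (hmin N h1).eq_or_lt with h3 | h3
      · have : s.child = N := code_injective hN.1.subset h1.1.subset h3
        subst this
        rcases Relation.ReflTransGen.cases_head h2 with h | ⟨M, h, h'⟩
        · exact .inl h.symm
        · exact .inr (.inl ⟨M, h, h'⟩)
      · exact .inr (.inr ⟨N, ⟨h1.1, h3⟩, h2⟩)

end Visit

end Traversal

end Listing

namespace Listing

open Finset SetSystemClass

/-! ### Computing the next child -/

section Scan

variable {U : List Data} {F : Set (Finset Data)} {P Z R D : Finset Data} {A : Set (Finset Data)}

open Classical in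
/-- The subset of the ground set with a given encoding. -/
noncomputable def decSet (U : List Data) (d : Data) : Finset Data :=
  if h : ∃ R ⊆ U.toFinset, encSet U R = d then h.choose else ∅

lemma decSet_encSet (h : R ⊆ U.toFinset) : decSet U (encSet U R) = R := by
  have h' : ∃ R' ⊆ U.toFinset, encSet U R' = encSet U R := ⟨R, h, rfl⟩
  rw [decSet, dif_pos h']
  exact (encSet_inj h'.choose_spec.1 h).1 h'.choose_spec.2

/-- Update `D` with the candidates that arise from a solution `R` and a starting point `s`. -/
noncomputable def scanStages (U : List Data) (F : Set (Finset Data)) (P Z R D : Finset Data)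
    (s : Data) : Finset Data :=
  (stages U F s R).foldl (fun D E => update U F P Z D (canon U F s E)) D

open Classical in
/-- Update `D` with the candidates that arise from a solution `R`. -/
noncomputable def scanSeeds (U : List Data) (F : Set (Finset Data)) (P Z D R : Finset Data) :
    Finset Data :=
  U.foldl (fun D s => if s ∈ R ∧ {s} ∈ F then scanStages U F P Z R D s else D) D

open Classical in
/-- The best candidate that arises from a singleton. -/
noncomputable def scanRoots (U : List Data) (F : Set (Finset Data)) (P Z : Finset Data) :
    Finset Data :=
  U.foldl (fun D s => if {s} ∈ F then scanStages U F P Z {s} D s else D) ∅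

variable (hc : IsCommutable U.toFinset F)
include hc

lemma isNode_of_mem_stages {s : Data} (hs : SolutionFrom U F s R) (hD : D ∈ stages U F s R) :
    IsNode U F (canon U F s D) := by
  obtain ⟨k, -, rfl⟩ := List.mem_map.1 hD
  exact (hs.greedy.1.isNode_canon hc).1

lemma IsBest.scanStages (h : IsBest U F P Z A D) {s : Data} (hs : SolutionFrom U F s R) :
    IsBest U F P Z (A ∪ {S | ∃ D ∈ stages U F s R, canon U F s D = S})
      (scanStages U F P Z R D s) := by
  rw [Listing.scanStages]
  convert h.foldl (A' := fun E => {canon U F s E}) fun E hE A B hB =>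
    hB.update (isNode_of_mem_stages hc hs hE) using 3
  simp [eq_comm]

lemma IsBest.scanSeeds (h : IsBest U F P Z A D) (hR : R ∈ F) (hRU : R ⊆ U.toFinset) :
    IsBest U F P Z (A ∪ {S | ∃ s ∈ U, (s ∈ R ∧ {s} ∈ F) ∧
      ∃ D ∈ stages U F s R, canon U F s D = S}) (scanSeeds U F P Z D R) := by
  refine h.foldl (A' := fun s => {S | (s ∈ R ∧ {s} ∈ F) ∧
    ∃ D ∈ stages U F s R, canon U F s D = S}) fun s _ A B hB => ?_
  split_ifs with hs
  · simpa [hs] using hB.scanStages hc ⟨hs.2, hs.1, hR, hRU⟩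
  · simpa [hs] using hB

/-- A root is the completion of the singleton of its seed, which is the stage with index `0` of that
singleton. The other case of `parent_spec` would make the empty set a nonempty completion. -/
lemma scanRoots_eq_nextChild (hP : P = ∅) : scanRoots U F P Z = nextChild U F P Z := by
  refine (IsBest.foldl (A := ∅) (A' := fun s => {S | {s} ∈ F ∧
    ∃ D ∈ stages U F s {s}, canon U F s D = S}) (fun s hs A B hB => ?_)
    ⟨.inl rfl, by simp⟩).eq_nextChild fun S hS => ?_
  · split_ifs with hF
    · simpa [hF] using hB.scanStages hc ⟨hF, by simp, hF, by simpa using hs⟩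
    · simpa [hF] using hB
  · have hs := hS.1.1.seed_spec hc
    rcases hS.1.1.parent_spec hc with ⟨-, h⟩ | ⟨L₁, u, L₂, -, h, -⟩
    · refine .inr ⟨seed U F S, by simpa using hs.subset hs.start_mem, hs.singleton_mem, _, ?_, h⟩
      exact List.mem_map.2 ⟨0, by simp, rfl⟩
    · rw [hS.1.2, hP] at h
      have := ((hs.greedy (L := L₁)).1.isNode_canon hc).1.2
      rw [h] at this
      simp at this

end Scan

variable {C : SetSystemClass} {ι κ γ : Type} {e f : ι → Data} {T : ι → ℕ} {I : ι → C.Inst}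
  {X Y P Z B R S : ι → Finset Data} {s w : ι → Data}

/-- A loop over the outputs of a program whose state is a set. -/
lemma CompS.foldl_outputs {step : ι → Finset Data → Data → Finset Data} (c : Cmd) (inp : ι → Data)
    (t : ι → List Event) (hexec : ∀ i, ∃ σ, Exec c (initStore (inp i)) (t i) σ) (p : Polynomial ℕ)
    (htime : ∀ i, time (t i) ≤ p.eval (sz (e i) + T i))
    (hspace : ∀ i, space c.vars (t i) ≤ p.eval (sz (e i)))
    (hinp : Comp e T inp) (hI : CompI e T I) (hX : CompS e T I X)
    (hc : CompS (setLoopCtx e I (fun i => outputs (t i)) fun _ a => a) (fun z => T z.1.1)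
      (fun z => I z.1.1) (fun z => step z.1.1 z.1.2.1 z.1.2.2)) :
    CompS e T I (fun i => (outputs (t i)).foldl (step i) (X i)) := by
  obtain ⟨q, hq⟩ := hI.exists_sz_le
  choose σ hσ using hexec
  refine ⟨fun i => ?_, (Comp.hook c inp t σ hσ p htime hspace (fun i D => encSet (ground (I i)) D) X
    step (fun i D => D ⊆ (ground (I i)).toFinset) hinp hX.comp hX.subset
    (fun i D a hD ha => hc.subset ⟨(i, D, a), hD, ha⟩) ⟨q, fun i D _ => hq i D⟩ hc.comp).tl⟩
  exact List.foldlRecOn (motive := fun D => D ⊆ (ground (I i)).toFinset) _ _ (hX.subset i)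
    fun D hD a ha => hc.subset ⟨(i, D, a), hD, ha⟩

/-! ### Computability of the scans over candidates -/

section Candidates

variable (hmem : C.PolyTimeMembership) (hcomm : C.Commutable)
include hmem hcomm

lemma CompS.update (hI : CompI e T I) (hP : CompS e T I P) (hZ : CompS e T I Z)
    (hB : CompS e T I B) (hS : CompS e T I S)
    (hnode : ∀ i, IsNode (ground (I i)) (fam (I i)) (S i)) :
    CompS e T I (fun i => update (ground (I i)) (fam (I i)) (P i) (Z i) (B i) (S i)) := by
  classical
  refine CompS.cases (((CompS.parent hmem hcomm hI hS hnode).eq hP).and ((CompS.code_lt hI hZ hS).and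
    ((hB.eq (CompS.empty I)).or (CompS.code_lt hI hS hB)))) ?_ ?_
  · exact (hS.restrict _).congr fun i => (if_pos i.2).symm
  · exact (hB.restrict _).congr fun i => (if_neg i.2).symm

/-- The candidates that arise from a solution `R` and a starting point `s`. -/
lemma CompS.scanStages {D : ι → Finset Data} (hI : CompI e T I) (hP : CompS e T I P)
    (hZ : CompS e T I Z) (hD : CompS e T I D) (hR : CompS e T I R) (hs : Comp e T s)
    (hsR : ∀ i, SolutionFrom (ground (I i)) (fam (I i)) (s i) (R i)) :
    CompS e T I (fun i => scanStages (ground (I i)) (fam (I i)) (P i) (Z i) (R i) (D i) (s i)) := by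
  have hsU : ∀ i, s i ∈ ground (I i) := fun i => by
    simpa using (hsR i).subset (hsR i).start_mem
  refine CompS.foldl (ea := fun i D => encSet (ground (I i)) D) hI hD
    (Comp.stages hmem hI hs hsU hR) ?_
  have hπ := setLoop_env (e := e) (T := T) (I := I) (ea := fun i D => encSet (ground (I i)) D)
    (L := fun i => stages (ground (I i)) (fam (I i)) (s i) (R i))
  have hI' := hI.pull hπ fun _ => le_rfl
  refine CompS.update hmem hcomm hI' (hP.pull hπ fun _ => le_rfl) (hZ.pull hπ fun _ => le_rfl)
    setLoop_state (CompS.canon hmem hI' (hs.pull hπ fun _ => le_rfl) (fun z => hsU _)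
      ⟨fun z => subset_of_mem_stages (hsU _) (hR.subset _) z.2.2, setLoop_elem⟩) fun z => ?_
  exact isNode_of_mem_stages (hcomm _ _ (I _).2) (hsR _) z.2.2

lemma CompS.scanSeeds {D : ι → Finset Data} (hI : CompI e T I) (hP : CompS e T I P)
    (hZ : CompS e T I Z) (hD : CompS e T I D) (hR : CompS e T I R)
    (hRF : ∀ i, R i ∈ fam (I i)) :
    CompS e T I (fun i => scanSeeds (ground (I i)) (fam (I i)) (P i) (Z i) (D i) (R i)) := by
  classical
  refine CompS.foldl (ea := fun i u => u) hI hD (by simpa using hI.ground) ?_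
  have hπ := setLoop_env (e := e) (T := T) (I := I) (ea := fun i u => u)
    (L := fun i => ground (I i))
  have ha := setLoop_elem (e := e) (T := T) (I := I) (ea := fun i u => u)
    (L := fun i => ground (I i))
  have hI' := hI.pull hπ fun _ => le_rfl
  have hR' := hR.pull hπ fun _ => le_rfl
  have hp := (hR'.mem ha).and (CompS.mem_family hmem hI' (CompS.singleton hI' ha fun z => z.2.2))
  refine CompS.cases hp ?_ ?_
  · refine (CompS.scanStages hmem hcomm (hI'.restrict _) ((hP.pull hπ fun _ => le_rfl).restrict _)
      ((hZ.pull hπ fun _ => le_rfl).restrict _) (setLoop_state.restrict _) (hR'.restrict _)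
      (ha.restrict _) fun z => ?_).congr fun z => (if_pos z.2).symm
    exact ⟨z.2.2, z.2.1, hRF _, hR.subset _⟩
  · exact (setLoop_state.restrict _).congr fun z => (if_neg z.2).symm

lemma CompS.scanRoots (hI : CompI e T I) (hP : CompS e T I P) (hZ : CompS e T I Z) :
    CompS e T I (fun i => scanRoots (ground (I i)) (fam (I i)) (P i) (Z i)) := by
  classical
  refine CompS.foldl (ea := fun i u => u) hI (CompS.empty I) (by simpa using hI.ground) ?_
  have hπ := setLoop_env (e := e) (T := T) (I := I) (ea := fun i u => u)
    (L := fun i => ground (I i))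
  have ha := setLoop_elem (e := e) (T := T) (I := I) (ea := fun i u => u)
    (L := fun i => ground (I i))
  have hI' := hI.pull hπ fun _ => le_rfl
  have hs := CompS.singleton hI' ha fun z => z.2.2
  refine CompS.cases (CompS.mem_family hmem hI' hs) ?_ ?_
  · refine (CompS.scanStages hmem hcomm (hI'.restrict _) ((hP.pull hπ fun _ => le_rfl).restrict _)
      ((hZ.pull hπ fun _ => le_rfl).restrict _) (setLoop_state.restrict _) (hs.restrict _)
      (ha.restrict _) fun z => ?_).congr fun z => (if_pos z.2).symm
    exact ⟨z.2, by simp, z.2, by simpa using z.1.2.2⟩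
  · exact (setLoop_state.restrict _).congr fun z => (if_neg z.2).symm

end Candidates

/-- The program `c` solves the restricted problem in polynomial space and in time polynomial in the
size of the input plus `b`. -/
def SolvesRestricted (C : SetSystemClass) (c : Cmd) (p : Polynomial ℕ) (b : C.Inst → ℕ) : Prop :=
  ∀ j : C.restrictedProblem.ι, ∃ t, C.restrictedProblem.Lists c j t ∧
    time t ≤ p.eval (C.restrictedProblem.size j + b ⟨(j.1.1, j.1.2.1), j.2.1⟩) ∧
    space c.vars t ≤ p.eval (C.restrictedProblem.size j)

/-- The inputs of the restricted problem. -/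
def IsRestricted (I : C.Inst) (P : Finset Data) (w : Data) : Prop :=
  P ∈ maximalSolutions (ground I).toFinset (fam I) ∧ w ∈ ground I ∧ w ∉ P

/-- An input of the restricted problem. -/
def IsRestricted.toInput {I : C.Inst} {P : Finset Data} {w : Data} (h : IsRestricted I P w) :
    C.restrictedProblem.ι :=
  ⟨(I.1.1, I.1.2, P, w), I.2, h⟩

lemma IsRestricted.sols_toInput {I : C.Inst} {P : Finset Data} {w : Data}
    (h : IsRestricted I P w) : C.restrictedProblem.sols h.toInput = encSet (ground I) ''
      {R | R ∈ maximalSolutions (insert w P) (fam I) ∧ R ≠ P} := rfl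

/-- The first later child is computable with the help of a solver for the restricted problem. -/
theorem CompS.nextChild (hmem : C.PolyTimeMembership) (hcomm : C.Commutable) {c : Cmd}
    {p : Polynomial ℕ} {b : C.Inst → ℕ} (hsolve : SolvesRestricted C c p b)
    (hI : CompI e T I) (hP : CompS e T I P) (hZ : CompS e T I Z)
    (hnode : ∀ i, P i = ∅ ∨ IsNode (ground (I i)) (fam (I i)) (P i)) (hT : ∀ i, b (I i) ≤ T i) :
    CompS e T I (fun i => nextChild (ground (I i)) (fam (I i)) (P i) (Z i)) := by
  classical
  choose t hlists htime hspace using hsolve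
  -- The default `[]` only makes the function total; the scan calls it on inputs of the restricted
  -- problem.
  let outs : (I : C.Inst) → Finset Data → Data → List Data := fun I P w =>
    if h : IsRestricted I P w then outputs (t h.toInput) else []
  have houts : ∀ (I : C.Inst) (P : Finset Data) w (h : IsRestricted I P w), outs I P w =
      outputs (t h.toInput) := fun I P w h => dif_pos h
  have hmem_outs : ∀ (I : C.Inst) (P : Finset Data) w, IsRestricted I P w → ∀ d,
      d ∈ outs I P w ↔ ∃ R ∈ maximalSolutions (Insert.insert w P) (fam I), R ≠ P ∧
        encSet (ground I) R = d := by
    intro I P w h d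
    rw [houts I P w h, (hlists h.toInput).2.2 d, h.sols_toInput]
    simp only [Set.mem_image, Set.mem_ofPred_eq, and_assoc]
  have hsub : ∀ (I : C.Inst) (P : Finset Data) w, IsRestricted I P w →
      Insert.insert w P ⊆ (ground I).toFinset := fun I P w h =>
    insert_subset (by simpa using h.2.1) h.1.1.2
  have hdec : ∀ (I : C.Inst) (P : Finset Data) w, IsRestricted I P w → ∀ d ∈ outs I P w,
      decSet (ground I) d ∈ fam I ∧ decSet (ground I) d ⊆ (ground I).toFinset ∧
        encSet (ground I) (decSet (ground I) d) = d := by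
    intro I P w h d hd
    obtain ⟨R, hR, -, rfl⟩ := (hmem_outs I P w h d).1 hd
    have hRU : R ⊆ (ground I).toFinset := hR.1.2.trans (hsub I P w h)
    rw [decSet_encSet hRU]
    exact ⟨hR.1.1, hRU, rfl⟩
  let scan : ι → Finset Data → Data → Finset Data := fun i D w => (outs (I i) (P i) w).foldl
    (fun D d => Listing.scanSeeds (ground (I i)) (fam (I i)) (P i) (Z i) D (decSet (ground (I i)) d)) D
  let body : ι → Finset Data → Data → Finset Data := fun i D w =>
    if w ∈ P i then D else scan i D w
  -- Children of `∅` are roots and are found from singletons; the restricted solver is needed only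
  -- at proper nodes.
  refine CompS.cases (hP.eq (CompS.empty I)) ?_ ?_
  · refine ((CompS.scanRoots hmem hcomm hI hP hZ).restrict _).congr fun i => ?_
    obtain ⟨i, hi⟩ := i
    exact scanRoots_eq_nextChild (hcomm _ _ (I i).2) hi
  have hnode' : ∀ i : {i // ¬ P i = ∅}, IsNode (ground (I i)) (fam (I i)) (P i) := fun i =>
    (hnode i).resolve_left i.2
  suffices h : CompS (fun i : {i // ¬ P i = ∅} => e i) (fun i => T i) (fun i => I i)
      (fun i => (ground (I i)).foldl (body i) ∅) by
    refine h.congr fun i => ?_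
    have hc : IsCommutable (ground (I i)).toFinset (fam (I i)) := hcomm _ _ (I i).2
    refine (IsBest.foldl (A := ∅) (A' := fun w => {S | w ∉ P i ∧ ∃ d ∈ outs (I i) (P i) w,
      ∃ s ∈ ground (I i), (s ∈ decSet (ground (I i)) d ∧ {s} ∈ fam (I i)) ∧
        ∃ D ∈ stages (ground (I i)) (fam (I i)) s (decSet (ground (I i)) d),
          Listing.canon (ground (I i)) (fam (I i)) s D = S}) ?_ ⟨.inl rfl, by simp⟩).eq_nextChild ?_
    · intro w hw A B hB
      simp only [body]
      split_ifs with hwP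
      · simpa [hwP] using hB
      · have hr : IsRestricted (I i) (P i) w := ⟨(hnode' i).1, hw, hwP⟩
        simpa [hwP] using hB.foldl (l := outs (I i) (P i) w) fun d hd A B hB =>
          hB.scanSeeds hc (hdec _ _ w hr d hd).1 (hdec _ _ w hr d hd).2.1
    · intro S hS
      -- Completeness of the search: every child arises from some `w`, some restricted solution `R`,
      -- a start `s` and a stage.
      obtain ⟨w, hw, hwP, R, hR, hRP, s, hs, hsF, hD⟩ := hS.1.1.exists_restricted hc
        (by rw [hS.1.2]; exact i.2)
      rw [hS.1.2] at hwP hR hRP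
      have hr : IsRestricted (I i) (P i) w := ⟨(hnode' i).1, hw, hwP⟩
      have hRU : R ⊆ (ground (I i)).toFinset := hR.1.2.trans (hsub _ _ w hr)
      refine .inr ⟨w, hw, hwP, _, (hmem_outs _ _ w hr _).2 ⟨R, hR, hRP, rfl⟩, s,
        by simpa using hRU hs, ?_⟩
      rw [decSet_encSet hRU]
      exact ⟨⟨hs, hsF⟩, hD⟩
  have hI₁ := hI.restrict (fun i => ¬ P i = ∅)
  refine CompS.foldl (ea := fun i u => u) (L := fun i : {i // ¬ P i = ∅} => ground (I i))
    (step := fun i => body i) hI₁ (CompS.empty _) (by simpa using CompI.ground hI₁) ?_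
  have hπ := setLoop_env (e := fun i : {i // ¬ P i = ∅} => e i) (T := fun i => T i)
    (I := fun i => I i) (ea := fun i u => u) (L := fun i => ground (I i))
  have ha := setLoop_elem (e := fun i : {i // ¬ P i = ∅} => e i) (T := fun i => T i)
    (I := fun i => I i) (ea := fun i u => u) (L := fun i => ground (I i))
  have hst := setLoop_state (e := fun i : {i // ¬ P i = ∅} => e i) (T := fun i => T i)
    (I := fun i => I i) (ea := fun i u => u) (L := fun i => ground (I i))
  have hI₂ := hI₁.pull hπ fun _ => le_rfl
  have hP₂ := (hP.restrict (fun i => ¬ P i = ∅)).pull hπ fun _ => le_rfl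
  have hZ₂ := (hZ.restrict (fun i => ¬ P i = ∅)).pull hπ fun _ => le_rfl
  refine CompS.cases (hP₂.mem ha) ?_ ?_
  · exact (hst.restrict _).congr fun z => (if_pos z.2).symm
  let π : {z : SetLoop (fun i : {i // ¬ P i = ∅} => I i) (fun i => ground (I i)) //
    ¬ z.1.2.2 ∈ P z.1.1} → ι := fun z => z.1.1.1
  let w : {z : SetLoop (fun i : {i // ¬ P i = ∅} => I i) (fun i => ground (I i)) //
    ¬ z.1.2.2 ∈ P z.1.1} → Data := fun z => z.1.1.2.2
  have hr : ∀ z, IsRestricted (I (π z)) (P (π z)) (w z) := fun z =>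
    ⟨(hnode' z.1.1.1).1, z.1.2.2, z.2⟩
  let j : {z : SetLoop (fun i : {i // ¬ P i = ∅} => I i) (fun i => ground (I i)) //
      ¬ z.1.2.2 ∈ P z.1.1} → C.restrictedProblem.ι := fun z =>
    (hr z).toInput
  have hI₃ := hI₂.restrict (fun z => ¬ z.1.2.2 ∈ P z.1.1)
  have hP₃ := hP₂.restrict (fun z => ¬ z.1.2.2 ∈ P z.1.1)
  have hZ₃ := hZ₂.restrict (fun z => ¬ z.1.2.2 ∈ P z.1.1)
  have hinp := (CompI.desc hI₃).cons ((CompI.ground hI₃).cons (hP₃.comp.cons (ha.restrict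
    (fun z => ¬ z.1.2.2 ∈ P z.1.1))))
  obtain ⟨q, hq⟩ := hinp.exists_sz_le
  have hq' : ∀ z, C.restrictedProblem.size (j z) ≤ q.eval (sz (setLoopCtx
    (fun i : {i // ¬ P i = ∅} => e i) (fun i => I i) (fun i => ground (I i)) (fun _ u => u) z.1)) :=
    fun z => hq z
  -- Each solution is scanned at the moment the solver outputs it, and only the best candidate is
  -- kept, so the space does not grow with the number of solutions.
  refine (CompS.foldl_outputs c (fun z => C.restrictedProblem.input (j z)) (fun z => t (j z))
    (step := fun z D d => Listing.scanSeeds (ground (I (π z))) (fam (I (π z))) (P (π z)) (Z (π z)) D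
      (decSet (ground (I (π z))) d))
    (fun z => (hlists (j z)).1) (p.comp (q + Polynomial.X)) (fun z => ?_) (fun z => ?_) hinp hI₃
    (hst.restrict _) ?_).congr fun z => ?_
  · refine (htime (j z)).trans ?_
    rw [Polynomial.eval_comp, Polynomial.eval_add, Polynomial.eval_X]
    refine polynomial_eval_mono p (Nat.add_le_add ?_ ?_)
    · exact (hq' z).trans (polynomial_eval_mono q (Nat.le_add_right _ _))
    · exact (hT (π z)).trans (Nat.le_add_left _ _)
  · refine (hspace (j z)).trans ?_
    rw [Polynomial.eval_comp, Polynomial.eval_add, Polynomial.eval_X]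
    exact polynomial_eval_mono p ((hq' z).trans (Nat.le_add_right _ _))
  · have hdec' : ∀ z : SetLoop (fun z => I (π z)) (fun z => outputs (t (j z))),
        decSet (ground (I (π z.1.1))) z.1.2.2 ∈ fam (I (π z.1.1)) ∧
        decSet (ground (I (π z.1.1))) z.1.2.2 ⊆ (ground (I (π z.1.1))).toFinset ∧
        encSet (ground (I (π z.1.1))) (decSet (ground (I (π z.1.1))) z.1.2.2) = z.1.2.2 := fun z =>
      hdec _ _ _ (hr z.1.1) _ (by rw [houts _ _ _ (hr z.1.1)]; exact z.2.2)
    have hπ₃ := setLoop_env (e := fun z => setLoopCtx (fun i : {i // ¬ P i = ∅} => e i)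
      (fun i => I i) (fun i => ground (I i)) (fun _ u => u) z.1) (T := fun z => T (π z))
      (I := fun z => I (π z)) (L := fun z => outputs (t (j z))) (ea := fun _ a => a)
    have ha₃ := setLoop_elem (e := fun z => setLoopCtx (fun i : {i // ¬ P i = ∅} => e i)
      (fun i => I i) (fun i => ground (I i)) (fun _ u => u) z.1) (T := fun z => T (π z))
      (I := fun z => I (π z)) (L := fun z => outputs (t (j z))) (ea := fun _ a => a)
    have hst₃ := setLoop_state (e := fun z => setLoopCtx (fun i : {i // ¬ P i = ∅} => e i)
      (fun i => I i) (fun i => ground (I i)) (fun _ u => u) z.1) (T := fun z => T (π z))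
      (I := fun z => I (π z)) (L := fun z => outputs (t (j z))) (ea := fun _ a => a)
    exact CompS.scanSeeds hmem hcomm (hI₃.pull hπ₃ fun _ => le_rfl)
      (hP₃.pull hπ₃ fun _ => le_rfl) (hZ₃.pull hπ₃ fun _ => le_rfl) hst₃
      ⟨fun z => (hdec' z).2.1, ha₃.congr fun z => (hdec' z).2.2.symm⟩ fun z => (hdec' z).1
  · simp only [body, scan]
    rw [if_neg z.2, houts _ _ _ (hr z)]

end Listing

namespace Listing

open Finset SetSystemClass

/-! ### Listing all maximal solutions -/

section Lister

variable {C : SetSystemClass}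

/-- The encoding of a truth value. -/
def encBool (b : Bool) : Data := if b then tt else .nil

lemma encBool_ne_nil (b : Bool) : encBool b ≠ .nil ↔ b = true := by
  cases b <;> simp [encBool, tt_ne_nil]

lemma sz_encBool_le (b : Bool) : sz (encBool b) ≤ 1 := by
  cases b <;> simp [encBool, tt]

namespace Visit

/-- The encoding of a state. -/
def dat (s : Visit C) : Data :=
  cons (encBool s.run) (cons (encBool s.out.isSome) (cons (encSet (ground s.inst) (s.out.getD ∅))
    (cons (encInst s.inst) (cons (encSet (ground s.inst) s.node)
      (cons (encSet (ground s.inst) s.last) (encBool s.odd))))))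

lemma sz_dat_le (s : Visit C) : sz s.dat ≤ 4 * sz (encInst s.inst) + 9 := by
  have h1 := sz_encBool_le s.run
  have h2 := sz_encBool_le s.out.isSome
  have h3 := sz_encBool_le s.odd
  have h4 := sz_encSet_le (ground s.inst) (s.out.getD ∅)
  have h5 := sz_encSet_le (ground s.inst) s.node
  have h6 := sz_encSet_le (ground s.inst) s.last
  have h7 : sz (encList (ground s.inst)) ≤ sz (encInst s.inst) := by
    change sz (encList s.inst.1.2) ≤ sz (cons s.inst.1.1 (encList s.inst.1.2))
    rw [sz_cons]
    omega
  rw [dat]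
  simp only [sz_cons]
  omega

/-- The moves of the traversal are computable. -/
lemma comp_next (hmem : C.PolyTimeMembership) (hcomm : C.Commutable) {c : Cmd}
    {p : Polynomial ℕ} {b : C.Inst → ℕ} (hsolve : SolvesRestricted C c p b) :
    Comp (fun s : {s : Visit C // s.run = true} => dat s.1) (fun s => b s.1.inst)
      (fun s => dat (s.1.next hcomm)) := by
  classical
  let e : {s : Visit C // s.run = true} → Data := fun s => dat s.1
  let T : {s : Visit C // s.run = true} → ℕ := fun s => b s.1.inst
  have hI : CompI e T (fun s => s.1.inst) := Comp.id.tl.tl.tl.hd.congr fun _ => rfl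
  have hP : CompS e T (fun s => s.1.inst) (fun s => s.1.node) :=
    ⟨fun s => s.1.node_subset, Comp.id.tl.tl.tl.tl.hd.congr fun _ => rfl⟩
  have hZ : CompS e T (fun s => s.1.inst) (fun s => s.1.last) :=
    ⟨fun s => s.1.last_subset, Comp.id.tl.tl.tl.tl.tl.hd.congr fun _ => rfl⟩
  have hodd : CompP e T (fun s => s.1.odd = true) :=
    (CompP.ne_nil (Comp.id.tl.tl.tl.tl.tl.tl)).congr fun s => encBool_ne_nil _
  have hN : CompS e T (fun s => s.1.inst) (fun s => s.1.child) :=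
    CompS.nextChild hmem hcomm hsolve hI hP hZ (fun s => s.1.node_spec) fun _ => le_rfl
  have htt : ∀ {ι : Type} {e : ι → Data} {T : ι → ℕ}, Comp e T (fun _ => tt) :=
    Comp.nil.cons Comp.nil
  have hflag : Comp e T (fun s => if s.1.odd = true then .nil else tt) :=
    Comp.ite hodd Comp.nil htt
  refine Comp.cases (hN.eq (CompS.empty _)) (Comp.cases ((hP.eq (CompS.empty _)).restrict _) ?_ ?_) ?_
  · refine (Comp.nil.cons (Comp.nil.cons (Comp.nil.cons (((hI.restrict _).restrict _).cons
      (Comp.nil.cons (Comp.nil.cons Comp.nil)))))).congr fun s => ?_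
    rw [next, if_pos s.1.2, dif_pos s.2]
    simp [dat, halt, encBool]
  · have hI' : CompI _ _ _ := (hI.restrict (fun s => s.1.child = ∅)).restrict
      (fun s => ¬ s.1.1.node = ∅)
    have hP' := (hP.restrict (fun s => s.1.child = ∅)).restrict (fun s => ¬ s.1.1.node = ∅)
    have hodd' := (hodd.restrict (fun s => s.1.child = ∅)).restrict (fun s => ¬ s.1.1.node = ∅)
    have hflag' := (hflag.restrict (fun s => s.1.child = ∅)).restrict (fun s => ¬ s.1.1.node = ∅)
    refine (htt.cons (hflag'.cons ((Comp.ite hodd' Comp.nil hP'.comp).cons (hI'.cons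
      ((CompS.parent hmem hcomm hI' hP' fun s => s.1.1.1.node_spec.resolve_left s.2).comp.cons
        (hP'.comp.cons hflag')))))).congr fun s => ?_
    rw [next, if_pos s.1.2, dif_neg s.2]
    simp only [dat, up, encBool]
    by_cases h : s.1.1.1.odd = true <;> simp [h]
  · have hI' : CompI _ _ _ := hI.restrict (fun s => ¬ s.1.child = ∅)
    have hN' := hN.restrict (fun s => ¬ s.1.child = ∅)
    have hflag' := hflag.restrict (fun s => ¬ s.1.child = ∅)
    refine (htt.cons (hflag'.cons ((Comp.ite (hodd.restrict _) Comp.nil hN'.comp).cons (hI'.cons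
      (hN'.comp.cons (Comp.nil.cons hflag')))))).congr fun s => ?_
    rw [next, if_neg s.2]
    simp only [dat, down, encBool]
    by_cases h : s.1.1.odd = true <;> simp [h]

open Classical in
/-- The initial state. -/
noncomputable def init (I : C.Inst) : Visit C :=
  if ∃ u ∈ ground I, {u} ∈ fam I then
    ⟨I, ∅, ∅, false, true, none, .inl rfl, empty_subset _⟩
  else ⟨I, ∅, ∅, false, false, some ∅, .inl rfl, empty_subset _⟩

lemma inst_init (I : C.Inst) : (init I).inst = I := by
  rw [init]
  split_ifs <;> rfl

lemma inst_next {hcomm : C.Commutable} (s : Visit C) : (s.next hcomm).inst = s.inst := by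
  rw [next]
  split_ifs <;> rfl

lemma inst_iterate {hcomm : C.Commutable} (s : Visit C) (n : ℕ) :
    ((next hcomm)^[n] s).inst = s.inst := by
  induction n generalizing s with
  | zero => rfl
  | succ n ih => exact (ih _).trans (inst_next s)

lemma odd_next {hcomm : C.Commutable} {s : Visit C} (h : (s.next hcomm).run = true) :
    (s.next hcomm).odd = !s.odd := by
  rw [next] at h ⊢
  split_ifs at h ⊢
  · simp [halt] at h
  · rfl
  · rfl

/-- Silent moves that do not halt start in odd states, and each such move flips the parity; so two
of them are never consecutive. -/
lemma odd_of_out_next_eq_none {hcomm : C.Commutable} {s : Visit C}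
    (h : (s.next hcomm).run = true) (ho : (s.next hcomm).out = none) : s.odd = true := by
  rw [next] at h ho
  split_ifs at h ho
  · simp [halt] at h
  · simpa [up] using ho
  · simpa [down] using ho

lemma comp_init (hmem : C.PolyTimeMembership) (b : C.Inst → ℕ) :
    Comp encInst b (fun I : C.Inst => dat (init I)) := by
  classical
  have hI : CompI encInst b (fun I : C.Inst => I) := Comp.id
  have hmem' : CompP encInst b (fun I : C.Inst => ∃ u ∈ ground I, {u} ∈ fam I) := by
    refine CompP.exists_mem (p := fun I u => {u} ∈ fam I) hI.ground ?_
    have hI' : CompI (fun z : {z : C.Inst × Data // z.2 ∈ ground z.1} =>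
        cons z.1.2 (encInst z.1.1)) (fun z => b z.1.1) (fun z => z.1.1) :=
      Comp.id.tl.congr fun _ => rfl
    exact CompS.mem_family hmem hI' (CompS.singleton hI' (Comp.id.hd.congr fun _ => rfl)
      fun z => z.2)
  have htt : Comp encInst b (fun _ : C.Inst => tt) := Comp.nil.cons Comp.nil
  refine (Comp.ite hmem' (htt.cons (Comp.nil.cons (Comp.nil.cons (hI.cons
    (Comp.nil.cons (Comp.nil.cons Comp.nil)))))) (Comp.nil.cons (htt.cons (Comp.nil.cons (hI.cons
    (Comp.nil.cons (Comp.nil.cons Comp.nil))))))).congr fun I => ?_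
  rw [init]
  split_ifs <;> simp [dat, encBool]

/-- The traversal outputs all maximal solutions. -/
lemma exists_outputs (hcomm : C.Commutable) (I : C.Inst) : ∃ n,
    (∀ k < n, ((next hcomm)^[k] (init I)).run = true) ∧
    ¬ ((next hcomm)^[n] (init I)).run = true ∧
    ((List.range (n + 1)).filterMap fun k => ((next hcomm)^[k] (init I)).out).Nodup ∧
    ∀ S, S ∈ (List.range (n + 1)).filterMap (fun k => ((next hcomm)^[k] (init I)).out) ↔
      S ∈ maximalSolutions (ground I).toFinset (fam I) := by
  have hc : IsCommutable (ground I).toFinset (fam I) := hcomm _ _ I.2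
  by_cases h : ∃ u ∈ ground I, {u} ∈ fam I
  · obtain ⟨u, hu, huF⟩ := h
    have hi : init I = ⟨I, ∅, ∅, false, true, none, .inl rfl, empty_subset _⟩ :=
      if_pos ⟨u, hu, huF⟩
    obtain ⟨l, s, hp, -, hs, -, hr, hch, hn, hl⟩ := exists_path hcomm (init I) (by rw [hi])
    have hs : s.node = ∅ := by rw [hs, hi]
    have hnext : s.next hcomm = s.halt := by rw [next, if_pos hch, dif_pos hs]
    obtain ⟨n, h1, h2, h3⟩ := (hp.trans (Path.single hr)).exists_iterate
    have hL : (List.range (n + 1)).filterMap (fun k => ((next hcomm)^[k] (init I)).out) = l := by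
      rw [filterMap_range_succ, h3, hnext, Function.iterate_zero, id_eq, hi]
      simp [halt]
    refine ⟨n, h2, by rw [h1, hnext]; simp [halt], by rwa [hL], fun S => ?_⟩
    rw [hL, hl, hi]
    constructor
    · rintro ⟨N, h1, h2⟩
      exact (IsDescendant.isNode h2 h1.1.1).1
    -- A singleton solution exists, so `∅` is not maximal and every maximal solution is a node below
    -- some root.
    · intro hS
      have h0 : S.Nonempty := by
        by_contra h0
        rw [not_nonempty_iff_eq_empty] at h0
        have := hS.2 (y := {u}) ⟨huF, by simpa using hu⟩ (by rw [h0]; exact empty_subset _)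
        rw [h0] at this
        simp at this
      obtain ⟨N, h1, h2⟩ := IsNode.exists_root hc ⟨hS, h0⟩
      exact ⟨N, h1.isLater_empty, h2⟩
  · have hi : init I = ⟨I, ∅, ∅, false, false, some ∅, .inl rfl, empty_subset _⟩ :=
      if_neg h
    have hL : (List.range (0 + 1)).filterMap (fun k => ((next hcomm)^[k] (init I)).out) = [∅] := by
      rw [filterMap_range_succ, Function.iterate_zero, id_eq, hi]
      rfl
    refine ⟨0, by simp, by simp [hi], by rw [hL]; exact List.nodup_singleton _, fun S => ?_⟩
    rw [hL, List.mem_singleton]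
    -- Without singleton solutions `∅` is the only solution, by `seed_spec`; the initial state
    -- outputs it and stops.
    have hempty : ∀ X ∈ fam I, X ⊆ (ground I).toFinset → X = ∅ := fun X hX hXU => by
      by_contra h0
      rw [← ne_eq, ← nonempty_iff_ne_empty] at h0
      have := hc.seed_spec hX hXU h0
      exact h ⟨_, by simpa using hXU this.start_mem, this.singleton_mem⟩
    constructor
    · rintro rfl
      exact ⟨⟨hc.empty_mem, empty_subset _⟩, fun Y hY _ => (hempty Y hY.1 hY.2).le⟩
    · intro hS
      exact hempty S hS.1.1 hS.1.2

end Visit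

/-- With a solver for the restricted problem, the general problem can be solved with a delay that
is polynomial in the size of the input plus `b`. -/
theorem exists_delayLE (hmem : C.PolyTimeMembership) (hcomm : C.Commutable) {c : Cmd}
    {p : Polynomial ℕ} {b : C.Inst → ℕ} (hsolve : SolvesRestricted C c p b) :
    ∃ (c' : Cmd) (q : Polynomial ℕ), ∀ I : C.generalProblem.ι, ∃ t, C.generalProblem.Lists c' I t ∧
      DelayLE t (q.eval (C.generalProblem.size I + b I)) ∧
      space c'.vars t ≤ q.eval (C.generalProblem.size I) := by
  choose n hn hend hnodup hmax using Visit.exists_outputs (C := C) hcomm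
  have hsize : ∀ I : C.Inst, C.generalProblem.size I = sz (encInst I) := fun _ => rfl
  obtain ⟨c', q, h⟩ := exists_lister C.generalProblem b Visit.dat Visit.inst (fun s => s.run = true)
    (fun s => s.out.map (encSet (ground s.inst))) (Visit.next hcomm) Visit.init
    (fun s => encBool_ne_nil _) (fun s a ha => by
      obtain ⟨O, hO, rfl⟩ := Option.map_eq_some_iff.1 ha
      simp [Visit.dat, hO, encBool, tt_ne_nil])
    (fun s hs => by
      rw [Option.map_eq_none_iff] at hs
      simp [Visit.dat, hs, encBool])
    (Visit.comp_init hmem b) (Visit.comp_next hmem hcomm hsolve) Visit.inst_init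
    (fun s _ => Visit.inst_next s) (4 * Polynomial.X + 9) (fun s => by
      rw [hsize]
      simpa using s.sz_dat_le)
    (fun s _ hs' he hs'' => by
      intro he'
      rw [Option.map_eq_none_iff] at he he'
      have h1 := Visit.odd_next hs'
      rw [Visit.odd_of_out_next_eq_none hs' he, Visit.odd_of_out_next_eq_none hs'' he'] at h1
      simp at h1) n hn hend
  refine ⟨c', q, fun I => ?_⟩
  obtain ⟨t, σ', h1, h2, h3, h4⟩ := h I
  have hout : outputs t = ((List.range (n I + 1)).filterMap fun k =>
      ((Visit.next hcomm)^[k] (Visit.init I)).out).map (encSet (ground I)) := by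
    rw [h2, List.map_filterMap]
    congr 1
    funext k
    exact congrArg (fun J : C.Inst => Option.map (encSet (ground J)) _)
      ((Visit.inst_iterate _ k).trans (Visit.inst_init _))
  refine ⟨t, ⟨⟨σ', h1⟩, ?_, fun d => ?_⟩, h3, h4⟩
  · rw [hout]
    refine List.Nodup.map_on (fun A hA B hB hAB => ?_) (hnodup I)
    exact (encSet_inj ((hmax I A).1 hA).1.2 ((hmax I B).1 hB).1.2).1 hAB
  · rw [hout, List.mem_map]
    simp only [hmax I]
    rfl

end Lister

end Listing

namespace Listing

open Finset SetSystemClass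

/-! ### Suppressing an output -/

/-- The program `c` without the output of the tree in the variable `h`. -/
def Cmd.except (h : ℕ) : Cmd → Cmd
  | skip => skip
  | assign v e => assign v e
  | seq c₁ c₂ => seq (except h c₁) (except h c₂)
  | ite e c₁ c₂ => ite e (except h c₁) (except h c₂)
  | loop e c => loop e (except h c)
  | output e => ite (.eq e (.var h)) skip (output e)

lemma Cmd.vars_except {h : ℕ} {V : Finset ℕ} {c : Cmd} (hc : c.vars ⊆ V) :
    (c.except h).vars ⊆ insert h V := by
  induction c with
  | skip => simp [Cmd.except, Cmd.vars]
  | assign v e => exact hc.trans (subset_insert _ _)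
  | seq c₁ c₂ h₁ h₂ =>
    exact union_subset (h₁ (subset_union_left.trans hc)) (h₂ (subset_union_right.trans hc))
  | ite e c₁ c₂ h₁ h₂ =>
    simp only [Cmd.vars, Cmd.except, union_subset_iff] at hc ⊢
    exact ⟨⟨hc.1.1.trans (subset_insert _ _), h₁ hc.1.2⟩, h₂ hc.2⟩
  | loop e c h₁ =>
    simp only [Cmd.vars, Cmd.except, union_subset_iff] at hc ⊢
    exact ⟨hc.1.trans (subset_insert _ _), h₁ hc.2⟩
  | output e =>
    have hc : e.vars ⊆ insert h V := Finset.Subset.trans hc (subset_insert _ _)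
    simp only [Cmd.vars, Cmd.except, Expr.vars, union_subset_iff, singleton_subset_iff]
    exact ⟨⟨⟨hc, mem_insert_self _ _⟩, empty_subset _⟩, hc⟩

/-- The variable `h` is foreign to `c`, so it holds `a` throughout. A suppressed or permitted output
costs one extra comparison, linear in the size of `a`, which the factor covers since every
evaluation costs at least `1`. -/
lemma Exec.except {h : ℕ} {V : Finset ℕ} (hV : h ∉ V) (a : Data) {c : Cmd} {σ σ' : Store}
    {t : List Event} (hexec : Exec c σ t σ') (hc : c.vars ⊆ V) :
    ∃ t', Exec (c.except h) (Function.update σ h a) t' (Function.update σ' h a) ∧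
      outputs t' = (outputs t).filter (· ≠ a) ∧ time t' ≤ (sz a + 6) * time t ∧
      space (insert h V) t' ≤ 2 * space V t + 2 * sz a + 5 := by
  have hev : ∀ (e : Expr) σ, e.vars ⊆ V → e.eval (Function.update σ h a) = e.eval σ :=
    fun e σ he => e.eval_congr fun v hv =>
      Function.update_of_ne (ne_of_mem_of_not_mem (he hv) hV) _ _
  have hco : ∀ (e : Expr) σ, e.vars ⊆ V → e.cost (Function.update σ h a) = e.cost σ :=
    fun e σ he => e.cost_congr fun v hv =>
      Function.update_of_ne (ne_of_mem_of_not_mem (he hv) hV) _ _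
  have hsum : ∀ σ : Store, ∑ v ∈ insert h V, sz (Function.update σ h a v) =
      sz a + ∑ v ∈ V, sz (σ v) := fun σ => by
    rw [sum_insert hV, Function.update_self]
    congr 1
    exact sum_congr rfl fun v hv => by rw [Function.update_of_ne (ne_of_mem_of_not_mem hv hV)]
  have hstep : ∀ k : ℕ, k ≤ (sz a + 6) * k := fun k => by nlinarith
  induction hexec with
  | skip σ =>
    refine ⟨_, Exec.skip _, rfl, ?_, ?_⟩
    · simp
    · simp [hsum]
      omega
  | assign v e σ =>
    have he : e.vars ⊆ V := (subset_insert _ _).trans hc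
    have hv : v ≠ h := fun h' => hV (h' ▸ hc (mem_insert_self _ _))
    refine ⟨_, Exec.assign' (e := e) ?_, rfl, ?_, ?_⟩
    · rw [hev e σ he, Function.update_comm hv]
    · simpa [hco e σ he] using hstep (e.cost σ)
    · simp [hsum, hco e σ he]
      omega
  | seq _ _ ih₁ ih₂ =>
    obtain ⟨t₁, e₁, o₁, m₁, s₁⟩ := ih₁ (subset_union_left.trans hc)
    obtain ⟨t₂, e₂, o₂, m₂, s₂⟩ := ih₂ (subset_union_right.trans hc)
    refine ⟨_, e₁.seq e₂, by simp [o₁, o₂], ?_, ?_⟩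
    · simp only [time_append]
      linarith
    · simp only [space_append]
      omega
  | @iteTrue e c₁ c₂ σ σ' t hv _ ih =>
    simp only [Cmd.vars, union_subset_iff] at hc
    obtain ⟨t₁, e₁, o₁, m₁, s₁⟩ := ih hc.1.2
    refine ⟨_, Exec.iteTrue (by rwa [hev e σ hc.1.1]) e₁, by simpa using o₁, ?_, ?_⟩
    · have := hstep (e.cost σ)
      simp only [time_cons, Event.time_step, hco e σ hc.1.1]
      linarith
    · simp only [space_cons, Event.space_step, hsum, hco e σ hc.1.1]
      omega
  | @iteFalse e c₁ c₂ σ σ' t hv _ ih =>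
    simp only [Cmd.vars, union_subset_iff] at hc
    obtain ⟨t₁, e₁, o₁, m₁, s₁⟩ := ih hc.2
    refine ⟨_, Exec.iteFalse (by rwa [hev e σ hc.1.1]) e₁, by simpa using o₁, ?_, ?_⟩
    · have := hstep (e.cost σ)
      simp only [time_cons, Event.time_step, hco e σ hc.1.1]
      linarith
    · simp only [space_cons, Event.space_step, hsum, hco e σ hc.1.1]
      omega
  | @loopDone e c σ hv =>
    simp only [Cmd.vars, union_subset_iff] at hc
    refine ⟨_, Exec.loopDone (by rwa [hev e σ hc.1]), rfl, ?_, ?_⟩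
    · simpa [hco e σ hc.1] using hstep (e.cost σ)
    · simp [hsum, hco e σ hc.1]
      omega
  | @loopStep e c σ σ₁ σ₂ t₁ t₂ hv _ _ ih₁ ih₂ =>
    have hc' := hc
    simp only [Cmd.vars, union_subset_iff] at hc
    obtain ⟨t₁, e₁, o₁, m₁, s₁⟩ := ih₁ hc.2
    obtain ⟨t₂, e₂, o₂, m₂, s₂⟩ := ih₂ hc'
    refine ⟨_, Exec.loopStep (by rwa [hev e σ hc.1]) e₁ e₂, by simp [o₁, o₂], ?_, ?_⟩
    · have := hstep (e.cost σ)
      simp only [time_cons, Event.time_step, time_append, hco e σ hc.1]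
      linarith
    · simp only [space_cons, space_append, Event.space_step, hsum, hco e σ hc.1]
      omega
  | output e σ =>
    have hc : e.vars ⊆ V := hc
    have hle := e.sz_eval_lt_cost σ
    have hval : (Expr.eq e (.var h)).eval (Function.update σ h a) =
        if e.eval σ = a then cons .nil .nil else .nil := by
      simp [Expr.eval, hev e σ hc]
    have hcost : (Expr.eq e (.var h)).cost (Function.update σ h a) ≤ e.cost σ + sz a + 3 := by
      have h1 : sz (if e.eval σ = a then cons .nil .nil else .nil) ≤ 1 := by
        split_ifs <;> simp
      rw [Expr.cost, hval, hco e σ hc]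
      simp only [Expr.cost, Function.update_self, sz] at *
      omega
    by_cases he : e.eval σ = a
    · refine ⟨_, Exec.iteTrue (by rw [hval, if_pos he]; exact cons_ne_nil _ _) (Exec.skip _),
        by simp [he], ?_, ?_⟩
      · simp only [time_cons, Event.time_step, time_nil, Event.time_out]
        nlinarith
      · simp only [space_cons, Event.space_step, hsum, space_nil, Event.space_out]
        omega
    · refine ⟨_, Exec.iteFalse (by rw [hval, if_neg he]) (Exec.output _ _),
        by simp [he, hev e σ hc], ?_, ?_⟩
      · simp only [time_cons, Event.time_step, time_nil, Event.time_out, hco e σ hc]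
        nlinarith
      · simp only [space_cons, Event.space_step, hsum, space_nil, Event.space_out, hco e σ hc]
        omega

/-! ### Solving the restricted problem -/

section Reduction

variable {C : SetSystemClass}

lemma toFinset_filter_mem {U : List Data} {Y : Finset Data} (h : Y ⊆ U.toFinset) :
    (U.filter (· ∈ Y)).toFinset = Y := by
  ext a
  rw [List.mem_toFinset]
  exact mem_filter_ground h

/-- The reduced ground list keeps the order of `U`; hence the outputs for the reduced instance are
already encoded as the restricted problem requires. -/
lemma encSet_filter {U : List Data} {X Y : Finset Data} (h : X ⊆ Y) :
    encSet (U.filter (· ∈ Y)) X = encSet U X := by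
  rw [encSet, encSet, List.filter_filter]
  congr 1
  refine List.filter_congr fun a _ => ?_
  by_cases ha : a ∈ X
  · simp [ha, h ha]
  · simp [ha]

/-- The general problem is at least as hard as the restricted problem for a class that is closed
under reduction. -/
theorem restricted_of_general (hclosed : C.ClosedUnderReduction)
    (h : C.generalProblem.PolyTotalTimePolySpace) :
    C.restrictedProblem.PolyTotalTimePolySpace := by
  classical
  obtain ⟨c, p, hc⟩ := h
  let e : C.restrictedProblem.ι → Data := C.restrictedProblem.input
  let T : C.restrictedProblem.ι → ℕ := fun _ => 0
  let I : C.restrictedProblem.ι → C.Inst := fun j => ⟨(j.1.1, j.1.2.1), j.2.1⟩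
  let P : C.restrictedProblem.ι → Finset Data := fun j => j.1.2.2.1
  let w : C.restrictedProblem.ι → Data := fun j => j.1.2.2.2
  have hr : ∀ j, IsRestricted (I j) (P j) (w j) := fun j => j.2.2
  have hsub : ∀ j, insert (w j) (P j) ⊆ (ground (I j)).toFinset := fun j =>
    insert_subset (by simpa using (hr j).2.1) (hr j).1.1.2
  let I' : C.restrictedProblem.ι → C.Inst := fun j =>
    ⟨((I j).1.1, (ground (I j)).filter (· ∈ insert (w j) (P j))),
      hclosed _ _ (I j).2 _ (hr j).1 _ (hr j).2.1 (hr j).2.2⟩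
  have hI : CompI e T I := (Comp.id.hd.cons Comp.id.tl.hd).congr fun _ => rfl
  have hP : CompS e T I P := ⟨fun j => (hr j).1.1.2, Comp.id.tl.tl.hd.congr fun _ => rfl⟩
  have hw : Comp e T w := Comp.id.tl.tl.tl.congr fun _ => rfl
  have hU' := CompS.insert hI hP hw fun j => (hr j).2.1
  -- Preprocessing: the reduced instance, on which the general solver is run, paired with the
  -- encoding of `P`, the output to be suppressed.
  obtain ⟨K, c₀, p₀, h₀⟩ : Comp e T (fun j => cons (encInst (I' j)) (encSet (ground (I j)) (P j))) :=
    (hI.desc.cons hU'.comp).cons hP.comp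
  obtain ⟨N, hN, hcN⟩ := exists_vars_subset c
  obtain ⟨h, hh⟩ : ∃ h, h = max N K := ⟨_, rfl⟩
  have hcV : c.vars ⊆ range h := hcN.trans (range_subset_range.2 (by omega))
  have hsols : ∀ j d, d ∈ C.generalProblem.sols (I' j) ↔
      d ∈ C.restrictedProblem.sols j ∨ d = encSet (ground (I j)) (P j) := by
    intro j d
    -- `P` stays maximal in the smaller system, so it is the single superfluous solution there.
    have hmax : P j ∈ maximalSolutions (insert (w j) (P j)) (fam (I j)) :=
      ⟨⟨(hr j).1.1.1, subset_insert _ _⟩, fun Y hY hPY => (hr j).1.2 ⟨hY.1, hY.2.trans (hsub j)⟩ hPY⟩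
    change (∃ R, R ∈ maximalSolutions ((ground (I j)).filter
      (· ∈ insert (w j) (P j))).toFinset (fam (I j)) ∧ encSet _ R = d) ↔ (∃ R, (R ∈
      maximalSolutions (insert (w j) (P j)) (fam (I j)) ∧ R ≠ P j) ∧ encSet (ground (I j)) R = d) ∨ _
    rw [toFinset_filter_mem (hsub j)]
    constructor
    · rintro ⟨R, hR, rfl⟩
      rw [encSet_filter hR.1.2]
      by_cases hRP : R = P j
      · exact .inr (by rw [hRP])
      · exact .inl ⟨R, ⟨hR, hRP⟩, rfl⟩
    · rintro (⟨R, ⟨hR, -⟩, rfl⟩ | rfl)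
      · exact ⟨R, hR, encSet_filter hR.1.2⟩
      · exact ⟨P j, hmax, encSet_filter hmax.1.2⟩
  have hnot : ∀ j, encSet (ground (I j)) (P j) ∉ C.restrictedProblem.sols j := by
    rintro j ⟨R, ⟨hR, hRP⟩, h⟩
    exact hRP ((encSet_inj (hR.1.2.trans (hsub j)) (hr j).1.1.2).1 h)
  have hcard : ∀ j, (C.generalProblem.sols (I' j)).ncard ≤
      (C.restrictedProblem.sols j).ncard + 1 := fun j => by
    rw [show C.generalProblem.sols (I' j) = insert (encSet (ground (I j)) (P j))
      (C.restrictedProblem.sols j) by ext d; rw [hsols]; exact or_comm]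
    exact Set.ncard_insert_le _ _
  let q : Polynomial ℕ := (p₀ + 6) * (p.comp (p₀ + Polynomial.X + 1) + p₀) + 12 * p₀ + 20 +
    2 * p.comp p₀
  refine ⟨.seq c₀ (.seq (.assign h (.tl (.var 0))) (.seq (.assign 0 (.hd (.var 0))) (c.except h))),
    q, fun j => ?_⟩
  set W := range (h + 1)
  have hW : insert h (range h) = W := range_add_one.symm
  obtain ⟨t₁, e₁, o₁, m₁, s₁⟩ := h₀.call j (τ := initStore (e j)) rfl
    fun v hv _ => initStore_of_ne _ hv
  rw [update_initStore] at e₁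
  obtain ⟨t, ⟨⟨σ', hexec⟩, hnodup, hmem⟩, htime, hspace⟩ := hc (I' j)
  obtain ⟨t₂, e₂, m₂, o₂, s₂⟩ := hexec.frame_self
  obtain ⟨t₃, e₃, o₃, m₃, s₃⟩ := e₂.except (h := h) (V := range h) (by simp)
    (encSet (ground (I j)) (P j)) hcV
  obtain ⟨n, hn⟩ : ∃ n, n = C.restrictedProblem.size j := ⟨_, rfl⟩
  obtain ⟨m, hm⟩ : ∃ m, m = n + (C.restrictedProblem.sols j).ncard := ⟨_, rfl⟩
  obtain ⟨f, hf⟩ : ∃ f, f = cons (encInst (I' j)) (encSet (ground (I j)) (P j)) := ⟨_, rfl⟩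
  have hsz : sz (encInst (I' j)) + sz (encSet (ground (I j)) (P j)) + 1 ≤ p₀.eval n := by
    have := h₀.sz_le j
    rw [sz_cons] at this
    rwa [hn]
  have hszf : sz f ≤ p₀.eval n := by rw [hf, sz_cons]; exact hsz
  have hmono : p₀.eval n ≤ p₀.eval m := polynomial_eval_mono _ (by omega)
  have htl := sz_tl_le f
  have hhd := sz_hd_le f
  have hh0 : (0 : ℕ) ≠ h := by omega
  rw [← hf] at e₁
  have e₄ : Exec (.assign h (.tl (.var 0))) (initStore f) _
      (Function.update (initStore f) h (encSet (ground (I j)) (P j))) :=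
    Exec.assign' (by rw [Expr.eval, Expr.eval, initStore_zero, hf]; rfl)
  have e₅ : Exec (.assign 0 (.hd (.var 0)))
      (Function.update (initStore f) h (encSet (ground (I j)) (P j))) _
      (Function.update (initStore (encInst (I' j))) h (encSet (ground (I j)) (P j))) :=
    Exec.assign' (by
      rw [Expr.eval, Expr.eval, Function.update_of_ne hh0, initStore_zero,
        Function.update_comm hh0.symm, update_initStore, hf]
      rfl)
  have hout : ∀ k τ k' τ', outputs (t₁ ++ ([.step k τ] ++ ([.step k' τ'] ++ t₃))) =
      (outputs t).filter (· ≠ encSet (ground (I j)) (P j)) := fun k τ k' τ' => by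
    rw [outputs_append, outputs_append, outputs_append, o₁, o₃, o₂]
    rfl
  have hsum₁ := sum_sz_initStore W f
  have hsum₂ := sum_sz_update_le W (initStore f) h (encSet (ground (I j)) (P j))
  have hsum₃ := sum_sz_initStore (range h \ c.vars) (encInst (I' j))
  refine ⟨_, ⟨⟨_, e₁.seq (e₄.seq (e₅.seq e₃))⟩, ?_, fun d => ?_⟩, ?_, ?_⟩
  · rw [hout]
    exact hnodup.filter _
  · rw [hout, List.mem_filter, hmem, hsols]
    simp only [ne_eq, decide_not, Bool.not_eq_true', decide_eq_false_iff_not]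
    constructor
    · rintro ⟨h1 | h1, h2⟩
      · exact h1
      · exact absurd h1 h2
    · exact fun h1 => ⟨.inl h1, fun h2 => hnot j (h2 ▸ h1)⟩
  · have h1 : p.eval (C.generalProblem.size (I' j) + (C.generalProblem.sols (I' j)).ncard) ≤
        p.eval (p₀.eval m + m + 1) := polynomial_eval_mono p (by
      have := hcard j
      change sz (encInst (I' j)) + _ ≤ _
      omega)
    have h2 : time t₃ ≤ (p₀.eval m + 6) * p.eval (p₀.eval m + m + 1) :=
      m₃.trans (Nat.mul_le_mul (by omega) (by omega))
    have h3 : time t₁ ≤ p₀.eval m := m₁.trans (polynomial_eval_mono _ (by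
      change C.restrictedProblem.size j + 0 ≤ m
      omega))
    rw [← hn, ← hm]
    simp only [time_append, time_cons, Event.time_step, time_nil, Expr.cost, Expr.eval,
      Function.update_of_ne hh0, initStore_zero, q, Polynomial.eval_add, Polynomial.eval_mul,
      Polynomial.eval_comp, Polynomial.eval_X, Polynomial.eval_ofNat, Polynomial.eval_one, mul_add]
    simp only [sz] at *
    omega
  · have h1 : p.eval (C.generalProblem.size (I' j)) ≤ p.eval (p₀.eval n) :=
      polynomial_eval_mono p (by
        change sz (encInst (I' j)) ≤ _
        omega)
    have h2 := s₁ W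
    have h3 : ∑ v ∈ W \ range K, sz (initStore (e j) v) = 0 :=
      Finset.sum_eq_zero fun v hv => by
        have := h₀.pos
        rw [initStore_of_ne _ (by simp at hv; omega)]
        rfl
    have h4 := s₂ (range h)
    change _ ≤ _ + ∑ v ∈ range h \ c.vars, sz (initStore (encInst (I' j)) v) at h4
    have h5 : p₀.eval (sz (e j)) = p₀.eval n := by rw [hn]; rfl
    have hvars : (Cmd.seq c₀ (.seq (.assign h (.tl (.var 0)))
        (.seq (.assign 0 (.hd (.var 0))) (c.except h)))).vars ⊆ W := by
      have hv₁ : c₀.vars ⊆ W := h₀.vars.trans (range_subset_range.2 (by omega))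
      have hv₂ : (c.except h).vars ⊆ W := hW ▸ Cmd.vars_except hcV
      simp only [Cmd.vars, Expr.vars, union_subset_iff, insert_subset_iff, singleton_subset_iff]
      refine ⟨hv₁, ⟨?_, ?_⟩, ⟨?_, ?_⟩, hv₂⟩ <;> exact mem_range.2 (by omega)
    refine (space_mono hvars _).trans ?_
    rw [hW] at s₃
    rw [← hn]
    simp only [space_append, space_cons, Event.space_step, space_nil, Expr.cost, Expr.eval,
      Function.update_of_ne hh0, initStore_zero, q, Polynomial.eval_add, Polynomial.eval_mul,
      Polynomial.eval_comp, Polynomial.eval_X, Polynomial.eval_ofNat, Polynomial.eval_one]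
    simp only [sz] at *
    omega

end Reduction

end Listing

namespace Listing

open Finset SetSystemClass

/-! ### The general problem -/

section General

variable {C : SetSystemClass}

lemma finite_maximalSolutions (U : Finset Data) (F : Set (Finset Data)) :
    (maximalSolutions U F).Finite :=
  U.powerset.finite_toSet.subset fun _ hY => mem_coe.2 (mem_powerset.2 hY.1.2)

/-- The number of solutions of the restricted problem is at most `|U|` times the number of
maximal solutions of the general problem. -/
lemma ncard_restricted_sols_le (hcomm : C.Commutable) (j : C.restrictedProblem.ι) :
    (C.restrictedProblem.sols j).ncard ≤ C.restrictedProblem.size j *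
      (C.generalProblem.sols ⟨(j.1.1, j.1.2.1), j.2.1⟩).ncard := by
  obtain ⟨⟨x, U, P, w⟩, hI, hP, hw, hwP⟩ := j
  have hc : IsCommutable U.toFinset (C.family x) := hcomm _ _ hI
  -- A maximal `R = ∅` would be contained in the solution `P` and hence equal to it; so `R ≠ P`
  -- already implies that `R` is nonempty.
  have hset : {R | R ∈ maximalSolutions (insert w P) (C.family x) ∧ R ≠ P} =
      {R | R ∈ maximalSolutions (insert w P) (C.family x) ∧ R ≠ P ∧ R.Nonempty} := by
    ext R
    refine and_congr_right fun hR => ⟨fun h => ⟨h, ?_⟩, fun h => h.1⟩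
    by_contra h0
    rw [not_nonempty_iff_eq_empty] at h0
    have := hR.2 (y := P) ⟨hP.1.1, subset_insert _ _⟩ (by rw [h0]; exact empty_subset _)
    exact h (Subset.antisymm (by rw [h0]; exact empty_subset _) this)
  have h1 : (C.restrictedProblem.sols ⟨(x, U, P, w), hI, hP, hw, hwP⟩).ncard ≤
      U.length * (maximalSolutions U.toFinset (C.family x)).ncard := by
    change (encSet U '' {R | R ∈ maximalSolutions (insert w P) (C.family x) ∧ R ≠ P}).ncard ≤ _
    rw [hset]
    exact (Set.ncard_image_le ((finite_maximalSolutions _ _).subset fun R hR => hR.1)).trans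
      (hc.ncard_restricted_le hP.1.2 hw)
  have h2 : (C.generalProblem.sols ⟨(x, U), hI⟩).ncard =
      (maximalSolutions U.toFinset (C.family x)).ncard :=
    Set.InjOn.ncard_image fun A hA B hB h => (encSet_inj hA.1.2 hB.1.2).1 h
  have h3 : U.length ≤ C.restrictedProblem.size ⟨(x, U, P, w), hI, hP, hw, hwP⟩ := by
    have := length_le_sz_encList U
    change _ ≤ sz (cons x (cons (encList U) (cons (encSet U P) w)))
    simp only [sz_cons]
    omega
  rw [h2]
  exact h1.trans (Nat.mul_le_mul_right _ h3)

/-- A polynomial-time solver needs no extra time parameter, so `exists_delayLE` applies with `b =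
0`. -/
theorem polyDelay_of_restricted (hcomm : C.Commutable) (hmem : C.PolyTimeMembership)
    (h : C.restrictedProblem.PolyTimePolySpace) : C.generalProblem.PolyDelayPolySpace := by
  obtain ⟨c, p, h⟩ := h
  have hsolve : SolvesRestricted C c p fun _ => 0 := h
  exact exists_delayLE hmem hcomm hsolve

/-- The restricted problem has at most size times `b` solutions, where `b` is the number of maximal
solutions, so its solver is polynomial in the size plus `b`; the substitution `X + X * X` records
this. The delay is then polynomial in the same quantity, and there are `b + 1` stretches without
output. -/
theorem polyTotalTime_of_restricted (hcomm : C.Commutable) (hmem : C.PolyTimeMembership)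
    (h : C.restrictedProblem.PolyTotalTimePolySpace) :
    C.generalProblem.PolyTotalTimePolySpace := by
  obtain ⟨c, p, h⟩ := h
  have hsolve : SolvesRestricted C c (p.comp (Polynomial.X + Polynomial.X * Polynomial.X))
      fun I => (C.generalProblem.sols I).ncard := by
    intro j
    obtain ⟨t, h1, h2, h3⟩ := h j
    have h4 := ncard_restricted_sols_le hcomm j
    refine ⟨t, h1, h2.trans ?_, h3.trans ?_⟩
    · simp only [Polynomial.eval_comp, Polynomial.eval_add, Polynomial.eval_mul, Polynomial.eval_X]
      exact polynomial_eval_mono p (by nlinarith)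
    · simp only [Polynomial.eval_comp, Polynomial.eval_add, Polynomial.eval_mul, Polynomial.eval_X]
      exact polynomial_eval_mono p (Nat.le_add_right _ _)
  obtain ⟨c', q, h'⟩ := exists_delayLE hmem hcomm hsolve
  refine ⟨c', (Polynomial.X + 1) * q, fun I => ?_⟩
  obtain ⟨t, h1, h2, h3⟩ := h' I
  have hlen : (outputs t).length = (C.generalProblem.sols I).ncard := by
    rw [← List.toFinset_card_of_nodup h1.2.1, ← Set.ncard_coe_finset]
    congr 1
    ext d
    simp [h1.2.2 d]
  refine ⟨t, h1, h2.time_le.trans ?_, h3.trans ?_⟩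
  · rw [hlen, Polynomial.eval_mul, Polynomial.eval_add, Polynomial.eval_X, Polynomial.eval_one]
    exact Nat.mul_le_mul_right _ (by omega)
  · rw [Polynomial.eval_mul, Polynomial.eval_add, Polynomial.eval_X, Polynomial.eval_one]
    exact Nat.le_mul_of_pos_left _ (by omega)

end General

end Listing

theorem mainTheorem7 (C : Listing.SetSystemClass) (hcomm : C.Commutable)
    (hmem : C.PolyTimeMembership) :
    (C.ClosedUnderReduction →
      (C.generalProblem.PolyTotalTimePolySpace ↔ C.restrictedProblem.PolyTotalTimePolySpace)) ∧
    (C.restrictedProblem.PolyTotalTimePolySpace → C.generalProblem.PolyTotalTimePolySpace) ∧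
    (C.restrictedProblem.PolyTimePolySpace → C.generalProblem.PolyDelayPolySpace) := by
  exact ⟨fun hclosed => ⟨Listing.restricted_of_general hclosed,
    Listing.polyTotalTime_of_restricted hcomm hmem⟩,
    Listing.polyTotalTime_of_restricted hcomm hmem, Listing.polyDelay_of_restricted hcomm hmem⟩
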